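/- Let $G=(V,E)$ be a finite simple connected graph with $n=|V|$ vertices, minimum degree at least $2$ and maximum degree $\Delta$. A turn of $G$ is an unordered pair of distinct edges with a common endpoint, and turn costs are a function $\alpha$ assigning a nonnegative real number to each turn. For a closed walk in $G$ with cyclic vertex sequence $v_1,\dots,v_\ell$, the junction graph of a vertex $v$ has as vertices the edges of $G$ incident to $v$, with an edge between two of them for each time the walk visits $v$ immediately in between traversing them. A threading of $G$ is a closed walk that traverses every edge, never (cyclically) traverses the same edge twice in sequence, and whose junction graph at every vertex is connected; its turn cost is $\sum_{i=1}^{\ell}\alpha(v_{i-1}v_i,\,v_iv_{i+1})$, with indices modulo $\ell$. The problem Exactly-Double Threading asks, given $(G,\alpha)$, for a threading of minimum turn cost among those that traverse every edge exactly twice. The model of computation is a random access machine with unit-cost operations: reading and writing memory cells, addition, truncated subtraction, halving and comparison of natural numbers (which may serve as addresses), and addition and comparison of real numbers. The input is $n$, the adjacency matrix of $G$ on the vertices $0,\dots,n-1$, and the table of turn costs; the output is the vertex sequence of a closed walk. **Theorem.** Exactly-Double Threading can be solved in polynomial time if $\Delta$ is in $O(\log n)$. More precisely, there is a single program that solves Exactly-Double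 Threading on every such instance $(G,\alpha)$ in at most $p(n)\cdot 2^{\Delta}$ steps, for some polynomial $p$; and for every function $\delta$ with $\delta(n)\in O(\log n)$ there is a polynomial $q$ such that the program solves every such instance with $\Delta\le\delta(n)$ in at most $q(n)$ steps. -/

import Mathlib

open scoped NNReal

namespace Threading

section Walks

variable {V : Type*}

/-- The set `T(G)` of turns of `G`: unordered pairs of distinct edges with a common endpoint. -/
def turnSet (G : SimpleGraph V) : Set (Sym2 (Sym2 V)) :=
  {t | ∃ (v : V) (e f : Sym2 V),
    e ∈ G.incidenceSet v ∧ f ∈ G.incidenceSet v ∧ e ≠ f ∧ t = s(e, f)}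

/-- Turn costs for `G`: a nonnegative real number for each turn. -/
abbrev TurnCost (G : SimpleGraph V) : Type _ := turnSet G → ℝ≥0

open Classical in
/-- The cost of the pair of edges `{e, f}`; it is `0` if the pair is not a turn of `G`. -/
noncomputable def TurnCost.cost {G : SimpleGraph V} (α : TurnCost G) (e f : Sym2 V) : ℝ≥0 :=
  if h : s(e, f) ∈ turnSet G then α ⟨s(e, f), h⟩ else 0

/-! A closed walk of length `ℓ ≥ 1` is given by its cyclic sequence of vertices `w : Fin ℓ → V`;
the addition in `Fin ℓ` is cyclic, so the walk goes from `w i` to `w (i + 1)` for every `i`, and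
from the last vertex back to the first one. -/

/-- The `i`-th edge traversed by the closed walk `w`. -/
def walkEdge {ℓ : ℕ} [NeZero ℓ] (w : Fin ℓ → V) (i : Fin ℓ) : Sym2 V :=
  s(w i, w (i + 1))

/-- The junction graph of `v` induced by `w`: its vertices are the edges of `G` incident to `v`,
and two of them are adjacent if `w` visits `v` immediately in between traversing them.
(Multiplicities are not recorded; they are irrelevant for connectedness.) -/
def junctionGraph (G : SimpleGraph V) {ℓ : ℕ} [NeZero ℓ] (w : Fin ℓ → V) (v : V) :
    SimpleGraph (G.incidenceSet v) :=
  SimpleGraph.fromRel fun e f =>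
    ∃ i : Fin ℓ, w (i + 1) = v ∧ walkEdge w i = e ∧ walkEdge w (i + 1) = f

/-- A threading of `G`: a closed walk of `G` that traverses every edge, never traverses the same
edge twice in sequence, and induces a connected junction graph at every vertex. -/
structure IsThreading (G : SimpleGraph V) {ℓ : ℕ} [NeZero ℓ] (w : Fin ℓ → V) : Prop where
  adj : ∀ i, G.Adj (w i) (w (i + 1))
  covers : ∀ e ∈ G.edgeSet, ∃ i, walkEdge w i = e
  no_uturn : ∀ i, walkEdge w i ≠ walkEdge w (i + 1)
  connected : ∀ v, (junctionGraph G w v).Connected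

/-- A threading that traverses every edge exactly twice (in whichever directions). -/
structure IsExactlyDoubleThreading (G : SimpleGraph V) {ℓ : ℕ} [NeZero ℓ]
    (w : Fin ℓ → V) : Prop extends IsThreading G w where
  twice : ∀ e ∈ G.edgeSet, {i | walkEdge w i = e}.ncard = 2

/-- The turn cost of a closed walk: the sum of the costs of its cyclically consecutive pairs of
edges. -/
noncomputable def walkCost {G : SimpleGraph V} (α : TurnCost G) {ℓ : ℕ} [NeZero ℓ]
    (w : Fin ℓ → V) : ℝ≥0 :=
  ∑ i : Fin ℓ, α.cost (walkEdge w i) (walkEdge w (i + 1))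

/-- `w` is a solution of Exactly-Double Threading on `(G, α)`: an exactly-double threading whose
turn cost is minimum among all exactly-double threadings. -/
def IsOptimal (G : SimpleGraph V) (α : TurnCost G) {ℓ : ℕ} [NeZero ℓ] (w : Fin ℓ → V) : Prop :=
  IsExactlyDoubleThreading G w ∧
    ∀ (ℓ' : ℕ) [NeZero ℓ'] (w' : Fin ℓ' → V),
      IsExactlyDoubleThreading G w' → walkCost α w ≤ walkCost α w'

end Walks

/-! ### The machine model

Programs for a random access machine with a memory of natural numbers and a memory of real
numbers. There are finitely many operations, each of cost one: reading and writing a memory cell,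
addition, truncated subtraction and halving of natural numbers, addition of real numbers, and
comparisons. Natural numbers can be used as addresses. There is no multiplication, so that in `t`
steps the length of a number (and of an address) in binary grows by `O(t)` only, and unit costs are
polynomially equivalent to bit costs; no information can be extracted from the real numbers except
by comparing sums of them. -/

/-- Memory: scalar variables and arrays of natural numbers, and arrays of real numbers. -/
structure State where
  var : ℕ → ℕ
  arr : ℕ → ℕ → ℕ
  real : ℕ → ℕ → ℝ

/-- Expressions of type `ℕ`. -/
inductive NExpr : Type
  | const (k : ℕ)
  | var (x : ℕ)
  | get (a : ℕ) (i : NExpr)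
  | add (e₁ e₂ : NExpr)
  | sub (e₁ e₂ : NExpr)
  | half (e : NExpr)

/-- Expressions of type `ℝ`. -/
inductive RExpr : Type
  | zero
  | get (a : ℕ) (i : NExpr)
  | add (e₁ e₂ : RExpr)

/-- Tests. -/
inductive BExpr : Type
  | le (e₁ e₂ : NExpr)
  | rle (e₁ e₂ : RExpr)
  | not (b : BExpr)
  | and (b₁ b₂ : BExpr)

/-- The value of an expression. -/
def NExpr.eval (s : State) : NExpr → ℕ
  | .const k => k
  | .var x => s.var x
  | .get a i => s.arr a (i.eval s)
  | .add e₁ e₂ => e₁.eval s + e₂.eval s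
  | .sub e₁ e₂ => e₁.eval s - e₂.eval s
  | .half e => e.eval s / 2

/-- The value of an expression. -/
noncomputable def RExpr.eval (s : State) : RExpr → ℝ
  | .zero => 0
  | .get a i => s.real a (i.eval s)
  | .add e₁ e₂ => e₁.eval s + e₂.eval s

/-- The truth of a test. -/
def BExpr.Holds (s : State) : BExpr → Prop
  | .le e₁ e₂ => e₁.eval s ≤ e₂.eval s
  | .rle e₁ e₂ => e₁.eval s ≤ e₂.eval s
  | .not b => ¬ b.Holds s
  | .and b₁ b₂ => b₁.Holds s ∧ b₂.Holds s

/-- The number of steps taken to evaluate an expression. -/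
def NExpr.size : NExpr → ℕ
  | .const _ => 1
  | .var _ => 1
  | .get _ i => i.size + 1
  | .add e₁ e₂ => e₁.size + e₂.size + 1
  | .sub e₁ e₂ => e₁.size + e₂.size + 1
  | .half e => e.size + 1

/-- The number of steps taken to evaluate an expression. -/
def RExpr.size : RExpr → ℕ
  | .zero => 1
  | .get _ i => i.size + 1
  | .add e₁ e₂ => e₁.size + e₂.size + 1

/-- The number of steps taken to evaluate a test. -/
def BExpr.size : BExpr → ℕ
  | .le e₁ e₂ => e₁.size + e₂.size + 1
  | .rle e₁ e₂ => e₁.size + e₂.size + 1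
  | .not b => b.size + 1
  | .and b₁ b₂ => b₁.size + b₂.size + 1

/-- Programs. -/
inductive Program : Type
  | skip
  | set (x : ℕ) (e : NExpr)
  | store (a : ℕ) (i e : NExpr)
  | rstore (a : ℕ) (i : NExpr) (e : RExpr)
  | seq (p q : Program)
  | ite (b : BExpr) (p q : Program)
  | loop (b : BExpr) (p : Program)

/-- Assign `k` to the variable `x`. -/
def State.setVar (s : State) (x k : ℕ) : State :=
  { s with var := Function.update s.var x k }

/-- Write `k` into the cell `i` of the array `a` of natural numbers. -/
def State.setArr (s : State) (a i k : ℕ) : State :=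
  { s with arr := Function.update s.arr a (Function.update (s.arr a) i k) }

/-- Write `r` into the cell `i` of the array `a` of real numbers. -/
def State.setReal (s : State) (a i : ℕ) (r : ℝ) : State :=
  { s with real := Function.update s.real a (Function.update (s.real a) i r) }

/-- `Run p s t s'`: started in the state `s`, the program `p` halts after exactly `t` steps in the
state `s'`. The program `loop b p` repeats `p` while the test `b` holds. -/
inductive Run : Program → State → ℕ → State → Prop
  | skip (s : State) : Run .skip s 1 s
  | set (s : State) (x : ℕ) (e : NExpr) :
      Run (.set x e) s (e.size + 1) (s.setVar x (e.eval s))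
  | store (s : State) (a : ℕ) (i e : NExpr) :
      Run (.store a i e) s (i.size + e.size + 1) (s.setArr a (i.eval s) (e.eval s))
  | rstore (s : State) (a : ℕ) (i : NExpr) (e : RExpr) :
      Run (.rstore a i e) s (i.size + e.size + 1) (s.setReal a (i.eval s) (e.eval s))
  | seq {p q : Program} {s s₁ s₂ : State} {t₁ t₂ : ℕ} :
      Run p s t₁ s₁ → Run q s₁ t₂ s₂ → Run (.seq p q) s (t₁ + t₂) s₂
  | ite_true {b : BExpr} {p q : Program} {s s₁ : State} {t : ℕ} :
      b.Holds s → Run p s t s₁ → Run (.ite b p q) s (b.size + t) s₁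
  | ite_false {b : BExpr} {p q : Program} {s s₁ : State} {t : ℕ} :
      ¬ b.Holds s → Run q s t s₁ → Run (.ite b p q) s (b.size + t) s₁
  | loop_true {b : BExpr} {p : Program} {s s₁ s₂ : State} {t₁ t₂ : ℕ} :
      b.Holds s → Run p s t₁ s₁ → Run (.loop b p) s₁ t₂ s₂ →
        Run (.loop b p) s (b.size + t₁ + t₂) s₂
  | loop_false {b : BExpr} {p : Program} {s : State} :
      ¬ b.Holds s → Run (.loop b p) s b.size s

section Problem

variable {n : ℕ}

open Classical in
/-- The entry `(u, v)` of the adjacency matrix of `G`. -/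
noncomputable def adjEntry (G : SimpleGraph (Fin n)) (u v : ℕ) : ℕ :=
  if ∃ (hu : u < n) (hv : v < n), G.Adj ⟨u, hu⟩ ⟨v, hv⟩ then 1 else 0

/-- The cost of the turn `{uv, vw}`; it is `0` if this is not a turn. -/
noncomputable def costEntry {G : SimpleGraph (Fin n)} (α : TurnCost G) (u v w : ℕ) : ℝ :=
  if h : u < n ∧ v < n ∧ w < n then
    (α.cost s(⟨u, h.1⟩, ⟨v, h.2.1⟩) s(⟨v, h.2.1⟩, ⟨w, h.2.2⟩) : ℝ)
  else 0

/-- The initial memory for the instance `(G, α)`: variable `0` holds the number `n` of vertices;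
array `0` of natural numbers is the adjacency matrix in row-major order (`(u, v)` has index
`u * n + v`); array `0` of real numbers is the table of turn costs in row-major order (the turn
`{uv, vw}` has index `(u * n + v) * n + w`); everything else is `0`. -/
noncomputable def inputState (G : SimpleGraph (Fin n)) (α : TurnCost G) : State where
  var x := if x = 0 then n else 0
  arr a k := if a = 0 then adjEntry G (k / n) (k % n) else 0
  real a k := if a = 0 then costEntry α (k / n / n) (k / n % n) (k % n) else 0

/-- A final memory holds the closed walk `w`: variable `1` is its length, and array `1` of natural
numbers starts with its vertices. -/
def Outputs (s : State) {ℓ : ℕ} (w : Fin ℓ → Fin n) : Prop :=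
  s.var 1 = ℓ ∧ ∀ i : Fin ℓ, s.arr 1 i = w i

/-- Started on the instance `(G, α)`, the program `P` halts after at most `B` steps and outputs an
exactly-double threading of minimum turn cost. -/
def SolvesWithin (P : Program) (G : SimpleGraph (Fin n)) (α : TurnCost G) (B : ℕ) : Prop :=
  ∃ t ≤ B, ∃ s : State, Run P (inputState G α) t s ∧
    ∃ (ℓ : ℕ) (_ : NeZero ℓ) (w : Fin ℓ → Fin n), Outputs s w ∧ IsOptimal G α w

end Problem

end Threading

namespace Threading

/-! ### Verification of programs -/

/-! The cost of an exactly-double threading splits into independent local problems, and any choice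
of local solutions can be assembled into one closed walk.

Local structure. At a vertex `v`, every incident edge is used by exactly two halves of visits to
`v`, so the junction multigraph is 2-regular. Being connected, it is a single cycle, that is, a tour
of the neighbors of `v` (`IsExactlyDoubleThreading.exists_tour`). The turn cost is the sum of these
tour costs over all vertices (`walkCost_eq_sum`), hence at least the sum of the minimum tour costs.

Assembly. Choose a minimum tour at every vertex. Split each end of each edge into two flags, one for
each of the two corners of the tour that use this edge. An involution `f` joins the two flags of
every corner, and an involution `g` joins flags at opposite ends of an edge. An orbit of the group
generated by `f` and `g` is a closed walk together with its reversal (`exists_walk`). The cost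
depends on `f` only, so at each edge `g` may be switched between the parallel and the crossed
gluing. If the two sides of an edge lie in different orbits, the switch merges these orbits and
splits no other (`SameOrbit.merge`); one sweep over the edges therefore puts the two sides of every
edge into a common orbit. Then each tour connects all flags at its vertex, and connectedness of `G`
leaves a single orbit (`Corners.sameOrbit`). Its walk attains the lower bound
(`isOptimal_of_corners`).

Running time. A minimum tour at a vertex of degree `d` is found by the Held–Karp dynamic program
over subsets (`IsTable`), in `O(2 ^ d * d ^ 2)` steps apart from lower terms. The sweep traces one
walk for each edge end and costs `O(n ^ 4)`. Correctness and step counts of the concrete program are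
derived with the time-bounded triples `Ends` and the loop rule `Ends.forTo`. For maximum degree
`O(log n)` the factor `2 ^ Δ` is polynomial (`exists_pow_bound`). -/

@[simp] theorem State.setVar_var (s : State) (x k y : ℕ) :
    (s.setVar x k).var y = if y = x then k else s.var y := by
  simp [State.setVar, Function.update_apply]

@[simp] theorem State.setVar_arr (s : State) (x k : ℕ) : (s.setVar x k).arr = s.arr := rfl

@[simp] theorem State.setVar_real (s : State) (x k : ℕ) : (s.setVar x k).real = s.real := rfl

@[simp] theorem State.setArr_var (s : State) (a i k : ℕ) : (s.setArr a i k).var = s.var := rfl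

@[simp] theorem State.setArr_arr (s : State) (a i k b : ℕ) :
    (s.setArr a i k).arr b = if b = a then Function.update (s.arr a) i k else s.arr b := by
  simp [State.setArr, Function.update_apply]

@[simp] theorem State.setArr_real (s : State) (a i k : ℕ) : (s.setArr a i k).real = s.real := rfl

@[simp] theorem State.setReal_var (s : State) (a i : ℕ) (r : ℝ) :
    (s.setReal a i r).var = s.var := rfl

@[simp] theorem State.setReal_arr (s : State) (a i : ℕ) (r : ℝ) :
    (s.setReal a i r).arr = s.arr := rfl

@[simp] theorem State.setReal_real (s : State) (a i : ℕ) (r : ℝ) (b : ℕ) :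
    (s.setReal a i r).real b = if b = a then Function.update (s.real a) i r else s.real b := by
  simp [State.setReal, Function.update_apply]

/-- The program never writes the variable `x`. -/
def Program.keepsVar (x : ℕ) : Program → Bool
  | .set y _ => !(x == y)
  | .seq p q => p.keepsVar x && q.keepsVar x
  | .ite _ p q => p.keepsVar x && q.keepsVar x
  | .loop _ p => p.keepsVar x
  | _ => true

/-- The program never writes the array `a` of natural numbers. -/
def Program.keepsArr (a : ℕ) : Program → Bool
  | .store b _ _ => !(a == b)
  | .seq p q => p.keepsArr a && q.keepsArr a
  | .ite _ p q => p.keepsArr a && q.keepsArr a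
  | .loop _ p => p.keepsArr a
  | _ => true

/-- The program never writes the array `a` of real numbers. -/
def Program.keepsReal (a : ℕ) : Program → Bool
  | .rstore b _ _ => !(a == b)
  | .seq p q => p.keepsReal a && q.keepsReal a
  | .ite _ p q => p.keepsReal a && q.keepsReal a
  | .loop _ p => p.keepsReal a
  | _ => true

/-- The states agree outside of the memory that the program may write. -/
structure Program.Frame (P : Program) (s s' : State) : Prop where
  var : ∀ x, P.keepsVar x = true → s'.var x = s.var x
  arr : ∀ a, P.keepsArr a = true → s'.arr a = s.arr a
  real : ∀ a, P.keepsReal a = true → s'.real a = s.real a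

/-- What a program may write is computed from its syntax. For a concrete program the `keeps…`
conditions thus hold by `rfl`, and untouched memory need not appear in loop invariants. -/
theorem Run.frame {P : Program} {s s' : State} {t : ℕ} (h : Run P s t s') : P.Frame s s' := by
  induction h with
  | skip s => exact ⟨fun _ _ => rfl, fun _ _ => rfl, fun _ _ => rfl⟩
  | set s x e =>
    refine ⟨fun y hy => ?_, fun _ _ => rfl, fun _ _ => rfl⟩
    simp [Program.keepsVar] at hy
    simp [hy]
  | store s a i e =>
    refine ⟨fun _ _ => rfl, fun y hy => ?_, fun _ _ => rfl⟩
    simp [Program.keepsArr] at hy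
    simp [hy]
  | rstore s a i e =>
    refine ⟨fun _ _ => rfl, fun _ _ => rfl, fun y hy => ?_⟩
    simp [Program.keepsReal] at hy
    simp [hy]
  | seq _ _ h₁ h₂ =>
    refine ⟨fun y hy => ?_, fun y hy => ?_, fun y hy => ?_⟩
    · simp [Program.keepsVar] at hy
      rw [h₂.var y hy.2, h₁.var y hy.1]
    · simp [Program.keepsArr] at hy
      rw [h₂.arr y hy.2, h₁.arr y hy.1]
    · simp [Program.keepsReal] at hy
      rw [h₂.real y hy.2, h₁.real y hy.1]
  | ite_true _ _ h =>
    refine ⟨fun y hy => ?_, fun y hy => ?_, fun y hy => ?_⟩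
    · simp [Program.keepsVar] at hy
      exact h.var y hy.1
    · simp [Program.keepsArr] at hy
      exact h.arr y hy.1
    · simp [Program.keepsReal] at hy
      exact h.real y hy.1
  | ite_false _ _ h =>
    refine ⟨fun y hy => ?_, fun y hy => ?_, fun y hy => ?_⟩
    · simp [Program.keepsVar] at hy
      exact h.var y hy.2
    · simp [Program.keepsArr] at hy
      exact h.arr y hy.2
    · simp [Program.keepsReal] at hy
      exact h.real y hy.2
  | loop_true _ _ _ h₁ h₂ =>
    refine ⟨fun y hy => ?_, fun y hy => ?_, fun y hy => ?_⟩
    · rw [h₂.var y hy, h₁.var y hy]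
    · rw [h₂.arr y hy, h₁.arr y hy]
    · rw [h₂.real y hy, h₁.real y hy]
  | loop_false _ => exact ⟨fun _ _ => rfl, fun _ _ => rfl, fun _ _ => rfl⟩

/-- Started in the state `s`, the program halts after at most `B` steps in a state with the
property `Q`. -/
def Ends (P : Program) (s : State) (B : ℕ) (Q : State → Prop) : Prop :=
  ∃ t ≤ B, ∃ s', Run P s t s' ∧ Q s'

theorem Ends.mono {P : Program} {s : State} {B B' : ℕ} {Q Q' : State → Prop}
    (h : Ends P s B Q) (hB : B ≤ B') (hQ : ∀ s', P.Frame s s' → Q s' → Q' s') :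
    Ends P s B' Q' := by
  obtain ⟨t, ht, s', hr, hq⟩ := h
  exact ⟨t, ht.trans hB, s', hr, hQ s' hr.frame hq⟩

theorem Ends.seq {P P' : Program} {s : State} {B B' : ℕ} {Q R : State → Prop}
    (h : Ends P s B Q) (h' : ∀ s', P.Frame s s' → Q s' → Ends P' s' B' R) :
    Ends (.seq P P') s (B + B') R := by
  obtain ⟨t, ht, s', hr, hq⟩ := h
  obtain ⟨t', ht', s'', hr', hq'⟩ := h' s' hr.frame hq
  exact ⟨t + t', by omega, s'', .seq hr hr', hq'⟩

theorem Ends.ite {P P' : Program} {b : BExpr} {s : State} {B : ℕ} {Q : State → Prop}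
    (h : b.Holds s → Ends P s B Q) (h' : ¬ b.Holds s → Ends P' s B Q) :
    Ends (.ite b P P') s (b.size + B) Q := by
  by_cases hb : b.Holds s
  · obtain ⟨t, ht, s', hr, hq⟩ := h hb
    exact ⟨_, by omega, s', .ite_true hb hr, hq⟩
  · obtain ⟨t, ht, s', hr, hq⟩ := h' hb
    exact ⟨_, by omega, s', .ite_false hb hr, hq⟩

/-- The program has no loops. -/
def Program.loopFree : Program → Bool
  | .seq p q => p.loopFree && q.loopFree
  | .ite _ p q => p.loopFree && q.loopFree
  | .loop _ _ => false
  | _ => true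

open Classical in
/-- The final state of a program without loops. -/
noncomputable def Program.exec : Program → State → State
  | .skip, s => s
  | .set x e, s => s.setVar x (e.eval s)
  | .store a i e, s => s.setArr a (i.eval s) (e.eval s)
  | .rstore a i e, s => s.setReal a (i.eval s) (e.eval s)
  | .seq p q, s => q.exec (p.exec s)
  | .ite b p q, s => if b.Holds s then p.exec s else q.exec s
  | .loop _ _, s => s

/-- A bound on the number of steps of a program without loops. -/
def Program.maxSteps : Program → ℕ
  | .skip => 1
  | .set _ e => e.size + 1
  | .store _ i e => i.size + e.size + 1
  | .rstore _ i e => i.size + e.size + 1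
  | .seq p q => p.maxSteps + q.maxSteps
  | .ite b p q => b.size + (p.maxSteps + q.maxSteps)
  | .loop _ _ => 0

/-- Straight-line code is verified by evaluation: its final state is simplified symbolically, and
its step bound is a closed numeral. -/
theorem Ends.block {P : Program} {s : State} {B : ℕ} {Q : State → Prop}
    (hP : P.loopFree = true) (hB : P.maxSteps ≤ B) (hQ : P.Frame s (P.exec s) → Q (P.exec s)) :
    Ends P s B Q := by
  suffices h : ∀ s, ∃ t ≤ P.maxSteps, Run P s t (P.exec s) by
    obtain ⟨t, ht, hr⟩ := h s
    exact ⟨t, ht.trans hB, _, hr, hQ hr.frame⟩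
  clear hQ hB s
  induction P with
  | skip => exact fun s => ⟨1, le_rfl, .skip s⟩
  | set x e => exact fun s => ⟨_, le_rfl, .set s x e⟩
  | store a i e => exact fun s => ⟨_, le_rfl, .store s a i e⟩
  | rstore a i e => exact fun s => ⟨_, le_rfl, .rstore s a i e⟩
  | seq p q hp hq =>
    intro s
    simp only [Program.loopFree, Bool.and_eq_true] at hP
    obtain ⟨t, ht, hr⟩ := hp hP.1 s
    obtain ⟨t', ht', hr'⟩ := hq hP.2 (p.exec s)
    exact ⟨t + t', by simp only [Program.maxSteps]; omega, .seq hr hr'⟩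
  | ite b p q hp hq =>
    intro s
    simp only [Program.loopFree, Bool.and_eq_true] at hP
    obtain ⟨t, ht, hr⟩ := hp hP.1 s
    obtain ⟨t', ht', hr'⟩ := hq hP.2 s
    by_cases hb : b.Holds s
    · exact ⟨b.size + t, by simp only [Program.maxSteps]; omega, by
        simpa only [Program.exec, hb, if_true] using Run.ite_true hb hr⟩
    · exact ⟨b.size + t', by simp only [Program.maxSteps]; omega, by
        simpa only [Program.exec, hb, if_false] using Run.ite_false hb hr'⟩
  | loop b p => simp [Program.loopFree] at hP

/-- Run `P` for all values of the variable `x` that are less than the variable `y`. -/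
def forTo (x y : ℕ) (P : Program) : Program :=
  .seq (.set x (.const 0))
    (.loop (.not (.le (.var y) (.var x))) (.seq P (.set x (.add (.var x) (.const 1)))))

theorem Program.Frame.refl (P : Program) (s : State) : P.Frame s s :=
  ⟨fun _ _ => rfl, fun _ _ => rfl, fun _ _ => rfl⟩

/-- Each round costs 4 for the test and 4 for the increment besides the body; the remaining 6 are 2
for the initialization and 4 for the last, failing test. The invariant is required only after the
increment, which the body does not perform. -/
theorem Ends.forTo {x y m B : ℕ} {P : Program} {s : State} {Q : State → Prop}
    (I : ℕ → State → Prop) (hm : s.var y = m) (hxy : y ≠ x) (hx : P.keepsVar x = true)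
    (hy : P.keepsVar y = true) (h0 : I 0 (s.setVar x 0))
    (hI : ∀ k < m, ∀ s', (forTo x y P).Frame s s' → s'.var x = k → s'.var y = m → I k s' →
      Ends P s' B fun s'' => I (k + 1) (s''.setVar x (k + 1)))
    (hQ : ∀ s', (Threading.forTo x y P).Frame s s' → I m s' → Q s') :
    Ends (Threading.forTo x y P) s (m * (B + 8) + 6) Q := by
  have key : ∀ j k s', j + k = m → (Threading.forTo x y P).Frame s s' → s'.var x = k → I k s' →
      Ends (.loop (.not (.le (.var y) (.var x))) (.seq P (.set x (.add (.var x) (.const 1)))))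
        s' (j * (B + 8) + 4) Q := by
    intro j
    induction j with
    | zero =>
      intro k s' hk hf hxk hi
      have hym : s'.var y = m := by
        rw [hf.var y (by simp [Threading.forTo, Program.keepsVar, hxy, hy]), hm]
      refine ⟨4, by omega, s', ?_, hQ s' hf ?_⟩
      · exact Run.loop_false (by simp [BExpr.Holds, NExpr.eval, hym, hxk]; omega)
      · rwa [show m = k by omega]
    | succ j ih =>
      intro k s' hk hf hxk hi
      have hym : s'.var y = m := by
        rw [hf.var y (by simp [Threading.forTo, Program.keepsVar, hxy, hy]), hm]
      obtain ⟨t, ht, s₁, hr, hq⟩ := hI k (by omega) s' hf hxk hym hi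
      have hf₁ := hr.frame
      have hf₂ : (Threading.forTo x y P).Frame s (s₁.setVar x (k + 1)) := by
        refine ⟨fun z hz => ?_, fun z hz => ?_, fun z hz => ?_⟩
        · have := hf.var z hz
          simp [Threading.forTo, Program.keepsVar] at hz
          simp [hz.1, hf₁.var z hz.2.1, this]
        · have := hf.arr z hz
          simp [Threading.forTo, Program.keepsArr] at hz
          simp [hf₁.arr z hz, this]
        · have := hf.real z hz
          simp [Threading.forTo, Program.keepsReal] at hz
          simp [hf₁.real z hz, this]
      obtain ⟨t', ht', s₂, hr', hq'⟩ := ih (k + 1) _ (by omega) hf₂ (by simp) hq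
      have hset : Run (.set x (.add (.var x) (.const 1))) s₁ 4 (s₁.setVar x (k + 1)) := by
        have := Run.set s₁ x (.add (.var x) (.const 1))
        simpa [NExpr.eval, NExpr.size, hf₁.var x hx, hxk] using this
      refine ⟨4 + (t + 4) + t', by nlinarith, s₂, ?_, hq'⟩
      exact Run.loop_true (b := .not (.le (.var y) (.var x)))
        (by simp [BExpr.Holds, NExpr.eval, hym, hxk]; omega) (hr.seq hset) hr'
  have h₀ : (Threading.forTo x y P).Frame s (s.setVar x 0) := by
    refine ⟨fun z hz => ?_, fun _ _ => rfl, fun _ _ => rfl⟩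
    simp [Threading.forTo, Program.keepsVar] at hz
    simp [hz.1]
  obtain ⟨t, ht, s', hr, hq⟩ := key m 0 _ (by omega) h₀ (by simp) h0
  exact ⟨2 + t, by omega, s', .seq (.set s x (.const 0)) hr, hq⟩

/-! ### Pairs of involutions without fixed points -/

section Involutions

variable {ι : Type*}

/-- `f` is an involution of `X` without fixed points. -/
structure PairsOn (X : Finset ι) (f : ι → ι) : Prop where
  mem : ∀ x ∈ X, f x ∈ X
  invol : ∀ x ∈ X, f (f x) = x
  ne : ∀ x ∈ X, f x ≠ x

/-- `x` and `y` are in the same orbit of the group generated by the two involutions. -/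
def SameOrbit (X : Finset ι) (f g : ι → ι) : ι → ι → Prop :=
  Relation.EqvGen fun x y => x ∈ X ∧ (y = f x ∨ y = g x)

variable {X : Finset ι} {f g : ι → ι}

theorem SameOrbit.left {x : ι} (hx : x ∈ X) : SameOrbit X f g x (f x) :=
  .rel _ _ ⟨hx, .inl rfl⟩

theorem SameOrbit.right {x : ι} (hx : x ∈ X) : SameOrbit X f g x (g x) :=
  .rel _ _ ⟨hx, .inr rfl⟩

theorem iterate_succ_comp (k : ℕ) (x : ι) : g (f ((g ∘ f)^[k] x)) = (g ∘ f)^[k + 1] x :=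
  (Function.iterate_succ_apply' (g ∘ f) k x).symm

theorem iterate_mem (hf : PairsOn X f) (hg : PairsOn X g) {x : ι} (hx : x ∈ X) (k : ℕ) :
    (g ∘ f)^[k] x ∈ X := by
  induction k with
  | zero => exact hx
  | succ k ih => rw [Function.iterate_succ_apply']; exact hg.mem _ (hf.mem _ ih)

theorem iterate_sameOrbit (hf : PairsOn X f) (hg : PairsOn X g) {x : ι} (hx : x ∈ X) (k : ℕ) :
    SameOrbit X f g x ((g ∘ f)^[k] x) := by
  induction k with
  | zero => exact .refl _
  | succ k ih =>
    rw [Function.iterate_succ_apply']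
    have h := iterate_mem hf hg hx k
    exact ih.trans _ _ _ ((SameOrbit.left h).trans _ _ _ (SameOrbit.right (hf.mem _ h)))

theorem iterate_injective (hf : PairsOn X f) (hg : PairsOn X g) {x y : ι} (hx : x ∈ X)
    (hy : y ∈ X) (k : ℕ) (h : (g ∘ f)^[k] x = (g ∘ f)^[k] y) : x = y := by
  induction k with
  | zero => exact h
  | succ k ih =>
    rw [Function.iterate_succ_apply', Function.iterate_succ_apply'] at h
    apply ih
    have hx' := iterate_mem hf hg hx k
    have hy' := iterate_mem hf hg hy k
    have := congrArg (f ∘ g) h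
    simpa [hg.invol _ (hf.mem _ hx'), hg.invol _ (hf.mem _ hy'), hf.invol _ hx', hf.invol _ hy']
      using this

/-- The reversed walk does not meet the walk. -/
theorem left_iterate_ne (hf : PairsOn X f) (hg : PairsOn X g) {x : ι} (hx : x ∈ X) (k : ℕ) :
    f ((g ∘ f)^[k] x) ≠ x := by
  -- The word `f (g f)^k` is a palindrome of odd length, hence conjugate to its middle letter, which
  -- has no fixed point. The induction removes two letters at each end.
  induction k using Nat.strong_induction_on generalizing x with
  | _ k ih =>
    match k with
    | 0 => exact hf.ne x hx
    | 1 =>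
      intro h
      have h' := congrArg f h
      simp only [Function.iterate_one, Function.comp_apply] at h'
      rw [hf.invol _ (hg.mem _ (hf.mem _ hx))] at h'
      exact hg.ne _ (hf.mem _ hx) h'
    | k + 2 =>
      intro h
      have hk := iterate_mem hf hg hx (k + 1)
      have h' := congrArg (g ∘ f) h
      rw [Function.iterate_succ_apply'] at h'
      simp only [Function.comp_apply] at h'
      rw [hf.invol _ (hg.mem _ (hf.mem _ hk)), hg.invol _ (hf.mem _ hk),
        Function.iterate_succ_apply] at h'
      exact ih k (by omega) (hg.mem _ (hf.mem _ hx)) h'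

theorem left_iterate_ne_iterate (hf : PairsOn X f) (hg : PairsOn X g) {x : ι} (hx : x ∈ X)
    (j k : ℕ) : f ((g ∘ f)^[k] x) ≠ (g ∘ f)^[j] x := by
  intro h
  rcases le_total j k with hjk | hjk
  · obtain ⟨i, rfl⟩ := Nat.exists_eq_add_of_le' hjk
    rw [Function.iterate_add_apply] at h
    exact left_iterate_ne hf hg (iterate_mem hf hg hx j) i h
  · obtain ⟨i, rfl⟩ := Nat.exists_eq_add_of_le' hjk
    have h' := congrArg f h
    rw [hf.invol _ (iterate_mem hf hg hx k), Function.iterate_add_apply] at h'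
    exact left_iterate_ne hf hg (iterate_mem hf hg hx k) i h'.symm

/-- Pigeonhole gives a repetition among the first `X.card + 1` iterates, and injectivity cancels it
back to `x`. Taking the least period gives distinct iterates; its bound by `X.card` limits how long
a walk has to be traced. -/
theorem exists_period (hf : PairsOn X f) (hg : PairsOn X g) {x : ι} (hx : x ∈ X) :
    ∃ K, 0 < K ∧ K ≤ X.card ∧ (g ∘ f)^[K] x = x ∧
      Set.InjOn (fun k => (g ∘ f)^[k] x) (Finset.range K) := by
  have hex : ∃ K, 0 < K ∧ K ≤ X.card ∧ (g ∘ f)^[K] x = x := by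
    obtain ⟨i, hi, j, hj, hij, h⟩ := Finset.exists_ne_map_eq_of_card_lt_of_maps_to
      (s := Finset.range (X.card + 1)) (t := X) (f := fun k => (g ∘ f)^[k] x) (by simp)
      (fun k _ => iterate_mem hf hg hx k)
    wlog hlt : i < j generalizing i j
    · exact this j hj i hi hij.symm h.symm (by omega)
    simp only [Finset.mem_range] at hi hj
    refine ⟨j - i, by omega, by omega, ?_⟩
    refine iterate_injective hf hg (iterate_mem hf hg hx _) hx i ?_
    rw [← Function.iterate_add_apply, show i + (j - i) = j by omega, ← h]
  classical
  refine ⟨Nat.find hex, (Nat.find_spec hex).1, (Nat.find_spec hex).2.1,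
    (Nat.find_spec hex).2.2, ?_⟩
  intro i hi j hj h
  by_contra hij
  wlog hlt : i < j generalizing i j
  · exact this hj hi h.symm (Ne.symm hij) (by omega)
  simp only [Finset.coe_range, Set.mem_Iio] at hi hj
  refine Nat.find_min hex (m := j - i) (by omega) ⟨by omega, ?_, ?_⟩
  · have := (Nat.find_spec hex).2.1
    omega
  · refine iterate_injective hf hg (iterate_mem hf hg hx _) hx i ?_
    rw [← Function.iterate_add_apply, show i + (j - i) = j by omega]
    exact h.symm

theorem iterate_add_period {h : ι → ι} {x : ι} {K : ℕ} (hK : h^[K] x = x) (k : ℕ) :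
    h^[k % K] x = h^[k] x := by
  conv_rhs => rw [← Nat.mod_add_div k K, Function.iterate_add_apply]
  congr 1
  exact ((show Function.IsPeriodicPt h K x from hK).mul_const _).symm

/-- The orbit of `x` consists of the walk of `x` and of the reversed walk. -/
theorem sameOrbit_iff (hf : PairsOn X f) (hg : PairsOn X g) {x : ι} (hx : x ∈ X) {K : ℕ}
    (hK : 0 < K) (hp : (g ∘ f)^[K] x = x) {y : ι} :
    SameOrbit X f g x y ↔ ∃ k < K, y = (g ∘ f)^[k] x ∨ y = f ((g ∘ f)^[k] x) := by
  constructor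
  · intro h
    -- With unbounded `k`, the right-hand side is visibly preserved by both generators. The exponent
    -- is reduced modulo the period only afterwards.
    suffices hc : ∀ y z, SameOrbit X f g y z →
        ((∃ k, y = (g ∘ f)^[k] x ∨ y = f ((g ∘ f)^[k] x)) ↔
          ∃ k, z = (g ∘ f)^[k] x ∨ z = f ((g ∘ f)^[k] x)) by
      obtain ⟨k, hk⟩ := (hc x y h).1 ⟨0, .inl rfl⟩
      refine ⟨k % K, Nat.mod_lt _ hK, ?_⟩
      rwa [iterate_add_period hp]
    have hf' : ∀ y, (∃ k, y = (g ∘ f)^[k] x ∨ y = f ((g ∘ f)^[k] x)) →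
        ∃ k, f y = (g ∘ f)^[k] x ∨ f y = f ((g ∘ f)^[k] x) := by
      rintro y ⟨k, rfl | rfl⟩
      · exact ⟨k, .inr rfl⟩
      · exact ⟨k, .inl (hf.invol _ (iterate_mem hf hg hx k))⟩
    have hg' : ∀ y, (∃ k, y = (g ∘ f)^[k] x ∨ y = f ((g ∘ f)^[k] x)) →
        ∃ k, g y = (g ∘ f)^[k] x ∨ g y = f ((g ∘ f)^[k] x) := by
      rintro y ⟨k, rfl | rfl⟩
      -- Applying `g` steps back to exponent `k - 1`; adding the period avoids truncation at `k =
      -- 0`.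
      · refine ⟨k + K - 1, .inr ?_⟩
        have : (g ∘ f)^[k] x = g (f ((g ∘ f)^[k + K - 1] x)) := by
          rw [iterate_succ_comp (f := f) (g := g),
            show k + K - 1 + 1 = k + K by omega, Function.iterate_add_apply, hp]
        rw [this, hg.invol _ (hf.mem _ (iterate_mem hf hg hx _))]
      · exact ⟨k + 1, .inl (by rw [Function.iterate_succ_apply', Function.comp_apply])⟩
    intro y z h
    induction h with
    | rel y z h =>
      rcases h with ⟨hy, rfl | rfl⟩
      · exact ⟨hf' y, fun h => by simpa [hf.invol y hy] using hf' _ h⟩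
      · exact ⟨hg' y, fun h => by simpa [hg.invol y hy] using hg' _ h⟩
    | refl => rfl
    | symm _ _ _ ih => exact ih.symm
    | trans _ _ _ _ _ h₁ h₂ => exact h₁.trans h₂
  · rintro ⟨k, -, rfl | rfl⟩
    · exact iterate_sameOrbit hf hg hx k
    · exact (iterate_sameOrbit hf hg hx k).trans _ _ _
        (SameOrbit.left (iterate_mem hf hg hx k))

/-- A single orbit is traversed once by the walk and once by the reversed walk. -/
theorem exists_walk (hf : PairsOn X f) (hg : PairsOn X g) {x : ι} (hx : x ∈ X)
    (hX : ∀ y ∈ X, SameOrbit X f g x y) :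
    ∃ K, 0 < K ∧ 2 * K = X.card ∧ (g ∘ f)^[K] x = x ∧
      Set.InjOn (fun k => (g ∘ f)^[k] x) (Finset.range K) ∧
      (∀ y ∈ X, ((∃ k < K, (g ∘ f)^[k] x = y) ↔ ¬ ∃ k < K, (g ∘ f)^[k] x = f y)) ∧
      (∀ y ∈ X, ((∃ k < K, (g ∘ f)^[k] x = y) ↔ ¬ ∃ k < K, (g ∘ f)^[k] x = g y)) ∧
      ∀ c : ι → ℝ, (∀ y ∈ X, c (f y) = c y) →
        2 * ∑ k ∈ Finset.range K, c ((g ∘ f)^[k] x) = ∑ y ∈ X, c y := by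
  classical
  obtain ⟨K, hK, -, hp, hinj⟩ := exists_period hf hg hx
  -- The walk and its image under `f` partition `X`. So the walk has half the size of `X`, contains
  -- exactly one of `y` and `f y`, and carries half of every `f`-invariant sum.
  have hunion : X = (Finset.range K).image (fun k => (g ∘ f)^[k] x) ∪
      (Finset.range K).image (fun k => f ((g ∘ f)^[k] x)) := by
    ext y
    simp only [Finset.mem_union, Finset.mem_image, Finset.mem_range]
    constructor
    · intro hy
      obtain ⟨k, hk, h | h⟩ := (sameOrbit_iff hf hg hx hK hp).1 (hX y hy)
      · exact .inl ⟨k, hk, h.symm⟩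
      · exact .inr ⟨k, hk, h.symm⟩
    · rintro (⟨k, -, rfl⟩ | ⟨k, -, rfl⟩)
      · exact iterate_mem hf hg hx k
      · exact hf.mem _ (iterate_mem hf hg hx k)
  have hinj' : Set.InjOn (fun k => f ((g ∘ f)^[k] x)) (Finset.range K) := by
    intro i hi j hj h
    apply hinj hi hj
    simpa [hf.invol _ (iterate_mem hf hg hx _)] using congrArg f h
  have hdisj : Disjoint ((Finset.range K).image (fun k => (g ∘ f)^[k] x))
      ((Finset.range K).image (fun k => f ((g ∘ f)^[k] x))) := by
    rw [Finset.disjoint_left]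
    simp only [Finset.mem_image, Finset.mem_range]
    rintro y ⟨j, -, rfl⟩ ⟨k, -, h⟩
    exact left_iterate_ne_iterate hf hg hx j k h
  have hl : ∀ y ∈ X, ((∃ k < K, (g ∘ f)^[k] x = y) ↔ ¬ ∃ k < K, (g ∘ f)^[k] x = f y) := by
    intro y hy
    constructor
    · rintro ⟨k, -, rfl⟩ ⟨j, -, h⟩
      exact left_iterate_ne_iterate hf hg hx j k h.symm
    · intro h
      obtain ⟨k, hk, h' | h'⟩ := (sameOrbit_iff hf hg hx hK hp).1 (hX y hy)
      · exact ⟨k, hk, h'.symm⟩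
      · exact absurd ⟨k, hk, by rw [h', hf.invol _ (iterate_mem hf hg hx k)]⟩ h
  refine ⟨K, hK, ?_, hp, hinj, hl, ?_, ?_⟩
  · conv_rhs => rw [hunion]
    rw [Finset.card_union_of_disjoint hdisj, Finset.card_image_of_injOn hinj,
      Finset.card_image_of_injOn hinj', Finset.card_range]
    omega
  · intro y hy
    -- The walk contains `f y` if and only if it contains the next point `g (f (f y)) = g y`.
    rw [hl y hy, not_iff_not]
    constructor
    · rintro ⟨k, -, h⟩
      refine ⟨(k + 1) % K, Nat.mod_lt _ hK, ?_⟩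
      rw [iterate_add_period hp, Function.iterate_succ_apply', h, Function.comp_apply,
        hf.invol y hy]
    · rintro ⟨k, -, h⟩
      refine ⟨(k + K - 1) % K, Nat.mod_lt _ hK, ?_⟩
      rw [iterate_add_period hp]
      have h' : g (f ((g ∘ f)^[k + K - 1] x)) = g y := by
        rw [iterate_succ_comp (f := f) (g := g),
            show k + K - 1 + 1 = k + K by omega, Function.iterate_add_apply, hp, h]
      have h2 := iterate_mem hf hg hx (k + K - 1)
      have h'' := congrArg g h'
      rw [hg.invol _ (hf.mem _ h2), hg.invol y hy] at h''
      rw [← h'', hf.invol _ h2]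
  · intro c hc
    conv_rhs => rw [hunion]
    rw [Finset.sum_union hdisj, Finset.sum_image hinj, Finset.sum_image hinj']
    rw [two_mul]
    congr 1
    exact Finset.sum_congr rfl fun k _ => (hc _ (iterate_mem hf hg hx k)).symm

/-- The orbit of `x` is not split if `g` is modified on the pairs of `x` and of a point `z` of
another orbit. -/
theorem SameOrbit.of_modify (hf : PairsOn X f) (hg : PairsOn X g) {g' : ι → ι} {x z : ι}
    (hx : x ∈ X) (hzX : z ∈ X) (hz : ¬ SameOrbit X f g x z)
    (hg' : ∀ y ∈ X, y ≠ x → y ≠ g x → y ≠ z → y ≠ g z → g' y = g y) :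
    SameOrbit X f g' x (g x) := by
  obtain ⟨K, hK, -, hp, hinj⟩ := exists_period hf hg hx
  -- The walk from `x` reaches `g x = f ((g ∘ f)^[K - 1] x)` before it would use the pair of `x`,
  -- and it never meets the pair of `z`, which lies in another orbit. So `g'` agrees with `g` all
  -- along this path.
  have key : ∀ k < K, SameOrbit X f g' x ((g ∘ f)^[k] x) := by
    intro k hk
    induction k with
    | zero => exact .refl _
    | succ k ih =>
      have hkX := iterate_mem hf hg hx k
      refine (ih (by omega)).trans _ _ _ ((SameOrbit.left hkX).trans _ _ _ ?_)
      have hs : SameOrbit X f g x (f ((g ∘ f)^[k] x)) :=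
        (iterate_sameOrbit hf hg hx k).trans _ _ _ (SameOrbit.left hkX)
      have : (g ∘ f)^[k + 1] x = g' (f ((g ∘ f)^[k] x)) := by
        rw [Function.iterate_succ_apply', Function.comp_apply]
        refine (hg' _ (hf.mem _ hkX) ?_ ?_ ?_ ?_).symm
        · exact left_iterate_ne hf hg hx k
        · intro h
          have h' := congrArg g h
          rw [hg.invol _ hx, iterate_succ_comp (f := f) (g := g)] at h'
          have := hinj (x₁ := k + 1) (x₂ := 0) (by simpa using hk) (by simpa using hK) h'
          omega
        · rintro rfl
          exact hz hs
        · intro h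
          rw [h] at hs
          exact hz (hs.trans _ _ _ (SameOrbit.right hzX).symm)
      rw [this]
      exact SameOrbit.right (hf.mem _ hkX)
  have hlast : g x = f ((g ∘ f)^[K - 1] x) := by
    have h2 := iterate_mem hf hg hx (K - 1)
    have : x = g (f ((g ∘ f)^[K - 1] x)) := by
      rw [iterate_succ_comp (f := f) (g := g),
        show K - 1 + 1 = K by omega, hp]
    conv_lhs => rw [this]
    rw [hg.invol _ (hf.mem _ h2)]
  rw [hlast]
  exact (key (K - 1) (by omega)).trans _ _ _ (SameOrbit.left (iterate_mem hf hg hx _))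

/-- Exchanging the partners of `x` and `z` merges the orbits of `x` and `z`, and splits no orbit. -/
theorem SameOrbit.merge (hf : PairsOn X f) (hg : PairsOn X g) {g' : ι → ι} {x z : ι}
    (hx : x ∈ X) (hz : z ∈ X) (hxz : ¬ SameOrbit X f g x z)
    (hg' : ∀ y ∈ X, y ≠ x → y ≠ g x → y ≠ z → y ≠ g z → g' y = g y) (hgx : g' x = g z) :
    SameOrbit X f g' x z ∧ ∀ y y', SameOrbit X f g y y' → SameOrbit X f g' y y' := by
  have hx' := SameOrbit.of_modify hf hg hx hz hxz hg'
  have hz' := SameOrbit.of_modify hf hg hz hx (fun h => hxz h.symm)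
    (fun y hy h₁ h₂ h₃ h₄ => hg' y hy h₃ h₄ h₁ h₂)
  refine ⟨?_, fun y y' h => ?_⟩
  · have : SameOrbit X f g' x (g' x) := SameOrbit.right hx
    rw [hgx] at this
    exact this.trans _ _ _ hz'.symm
  · induction h with
    | rel y y' h =>
      rcases h with ⟨hy, rfl | rfl⟩
      · exact SameOrbit.left hy
      -- Only steps across the two broken pairs need an argument, and `hx'` and `hz'` bridge those.
      · by_cases h₁ : y = x
        · rwa [h₁]
        by_cases h₂ : y = g x
        · rw [h₂, hg.invol x hx]; exact hx'.symm
        by_cases h₃ : y = z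
        · rwa [h₃]
        by_cases h₄ : y = g z
        · rw [h₄, hg.invol z hz]; exact hz'.symm
        rw [← hg' y hy h₁ h₂ h₃ h₄]
        exact SameOrbit.right hy
    | refl => exact .refl _
    | symm _ _ _ ih => exact ih.symm
    | trans _ _ _ _ _ h₁ h₂ => exact h₁.trans _ _ _ h₂

end Involutions

/-! ### Tours and dynamic programming over subsets -/

/-- The sequence `t 0, t 1, …` is a cyclic enumeration of `X`. -/
structure IsTour {ι : Type*} (X : Finset ι) (t : ℕ → ι) : Prop where
  maps : ∀ i < X.card, t i ∈ X
  inj : Set.InjOn t (Finset.range X.card)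
  closed : t X.card = t 0

theorem IsTour.exists_eq {ι : Type*} {X : Finset ι} {t : ℕ → ι} (h : IsTour X t) {x : ι}
    (hx : x ∈ X) : ∃ i < X.card, t i = x := by
  classical
  have : (Finset.range X.card).image t = X :=
    Finset.eq_of_subset_of_card_le
      (fun y hy => by
        obtain ⟨i, hi, rfl⟩ := Finset.mem_image.1 hy
        exact h.maps i (Finset.mem_range.1 hi))
      (by rw [Finset.card_image_of_injOn h.inj, Finset.card_range])
  rw [← this] at hx
  obtain ⟨i, hi, rfl⟩ := Finset.mem_image.1 hx
  exact ⟨i, Finset.mem_range.1 hi, rfl⟩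

/-- The cost of a closed sequence of length `d`. -/
def tourCost {ι : Type*} (c : ι → ι → ℝ) (d : ℕ) (t : ℕ → ι) : ℝ :=
  ∑ i ∈ Finset.range d, c (t i) (t (i + 1))

/-! ### Held–Karp dynamic programming for minimum tours -/

theorem testBit_sub_two_pow {S k : ℕ} (h : S.testBit k = true) (m : ℕ) :
    (S - 2 ^ k).testBit m = true ↔ S.testBit m = true ∧ m ≠ k := by
  induction k generalizing S m with
  | zero =>
    simp only [Nat.testBit_zero, decide_eq_true_eq] at h
    cases m with
    | zero => simp [Nat.testBit_zero]; omega
    | succ m => simp [Nat.testBit_succ, show (S - 1) / 2 = S / 2 by omega]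
  | succ k ih =>
    rw [Nat.testBit_succ] at h
    have hk : 2 ^ (k + 1) = 2 * 2 ^ k := by ring
    cases m with
    | zero =>
      have := Nat.ge_two_pow_of_testBit h
      simp only [Nat.testBit_zero, decide_eq_true_eq]
      omega
    | succ m =>
      rw [Nat.testBit_succ, Nat.testBit_succ,
        show (S - 2 ^ (k + 1)) / 2 = S / 2 - 2 ^ k by omega, ih h]
      simp

/-- `D j S` is the minimum cost of a path from `j` through all elements of the set `S` to `0`, and
`C j S` is the first vertex of such a path after `j`. Sets are coded in binary. -/
structure IsTable (d : ℕ) (c : ℕ → ℕ → ℝ) (D : ℕ → ℕ → ℝ) (C : ℕ → ℕ → ℕ) (S j : ℕ) :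
    Prop where
  zero : S = 0 → C j S = 0 ∧ D j S = c j 0
  choice : S ≠ 0 → C j S < d ∧ S.testBit (C j S) = true ∧
    D j S = c j (C j S) + D (C j S) (S - 2 ^ C j S)
  le : ∀ k < d, S.testBit k = true → D j S ≤ c j k + D k (S - 2 ^ k)

/-- The next vertex of the tour, and the set of the vertices to be visited after it. -/
def tourStep (C : ℕ → ℕ → ℕ) (q : ℕ × ℕ) : ℕ × ℕ :=
  (C q.1 q.2, q.2 - 2 ^ C q.1 q.2)

theorem testBit_start {d k : ℕ} (hd : 0 < d) :
    (2 ^ d - 2).testBit k = true ↔ k < d ∧ k ≠ 0 := by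
  have h := testBit_sub_two_pow (S := 2 ^ d - 1) (k := 0) (by simp [hd]) k
  rw [show 2 ^ d - 2 = 2 ^ d - 1 - 2 ^ 0 by omega, h]
  simp [Nat.testBit_two_pow_sub_one]

/-- The number `2 ^ d - 2` codes all vertices except the starting vertex `0`. Following the recorded
choices from there spells out a tour whose cost is the corresponding table value. -/
theorem IsTable.tour {d : ℕ} (hd : 0 < d) {c : ℕ → ℕ → ℝ} {D : ℕ → ℕ → ℝ} {C : ℕ → ℕ → ℕ}
    (h : ∀ S < 2 ^ d, ∀ j < d, IsTable d c D C S j) :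
    IsTour (Finset.range d) (fun i => ((tourStep C)^[i] (0, 2 ^ d - 2)).1) ∧
      tourCost c d (fun i => ((tourStep C)^[i] (0, 2 ^ d - 2)).1) = D 0 (2 ^ d - 2) := by
  set j : ℕ → ℕ := fun i => ((tourStep C)^[i] (0, 2 ^ d - 2)).1 with hj
  set S : ℕ → ℕ := fun i => ((tourStep C)^[i] (0, 2 ^ d - 2)).2 with hS
  have j0 : j 0 = 0 := rfl
  have S0 : S 0 = 2 ^ d - 2 := rfl
  have js : ∀ i, j (i + 1) = C (j i) (S i) := fun i => by
    simp only [hj, hS, Function.iterate_succ_apply']; rfl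
  have Ss : ∀ i, S (i + 1) = S i - 2 ^ j (i + 1) := fun i => by
    rw [js]
    simp only [hj, hS, Function.iterate_succ_apply']; rfl
  clear_value j S
  -- The set `S i` is the complement of the vertices visited so far, and the cost paid plus the
  -- table value of the remaining path is constant.
  have key : ∀ i < d, (∀ a ≤ i, j a < d) ∧ Set.InjOn j (Finset.range (i + 1)) ∧ S i < 2 ^ d ∧
      (∀ k, (S i).testBit k = true ↔ k < d ∧ ∀ a ≤ i, j a ≠ k) ∧
      tourCost c i j + D (j i) (S i) = D 0 (2 ^ d - 2) := by
    intro i hi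
    induction i with
    | zero =>
      refine ⟨?_, ?_, ?_, ?_, ?_⟩
      · intro a ha
        obtain rfl : a = 0 := by omega
        omega
      · simp
      · have := Nat.two_pow_pos d
        omega
      · intro k
        rw [S0, testBit_start hd]
        simp [j0, eq_comm]
      · simp [tourCost, j0, S0]
    | succ i ih =>
      obtain ⟨h1, h2, h3, h4, h5⟩ := ih (by omega)
      have hne : S i ≠ 0 := by
        intro h0
        have hsub : Finset.range d ⊆ (Finset.range (i + 1)).image j := by
          intro k hk
          by_contra hk'
          have := (h4 k).2 ⟨Finset.mem_range.1 hk, fun a ha hak => hk'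
            (Finset.mem_image.2 ⟨a, Finset.mem_range.2 (by omega), hak⟩)⟩
          simp [h0] at this
        have := (Finset.card_le_card hsub).trans Finset.card_image_le
        simp at this
        omega
      obtain ⟨hc1, hc2, hc3⟩ := (h _ h3 _ (h1 i le_rfl)).choice hne
      rw [← js] at hc1 hc2 hc3
      refine ⟨?_, ?_, ?_, ?_, ?_⟩
      · intro a ha
        rcases Nat.lt_or_eq_of_le ha with ha | rfl
        · exact h1 a (by omega)
        · exact hc1
      · have hnew := ((h4 _).1 hc2).2
        intro a ha b hb hab
        simp only [Finset.coe_range, Set.mem_Iio] at ha hb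
        rcases Nat.lt_or_eq_of_le (Nat.lt_succ_iff.1 ha) with ha | rfl
        · rcases Nat.lt_or_eq_of_le (Nat.lt_succ_iff.1 hb) with hb | rfl
          · exact h2 (by simpa using ha) (by simpa using hb) hab
          · exact absurd hab (hnew a (by omega))
        · rcases Nat.lt_or_eq_of_le (Nat.lt_succ_iff.1 hb) with hb | rfl
          · exact absurd hab.symm (hnew b (by omega))
          · rfl
      · rw [Ss]
        exact (Nat.sub_le _ _).trans_lt h3
      · intro k
        rw [Ss, testBit_sub_two_pow hc2, h4]
        constructor
        · rintro ⟨⟨hk, hk'⟩, hk''⟩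
          refine ⟨hk, fun a ha => ?_⟩
          rcases Nat.lt_or_eq_of_le ha with ha | rfl
          · exact hk' a (by omega)
          · exact hk''.symm
        · rintro ⟨hk, hk'⟩
          exact ⟨⟨hk, fun a ha => hk' a (by omega)⟩, (hk' _ le_rfl).symm⟩
      · rw [← h5, hc3, tourCost, Finset.sum_range_succ, ← Ss, tourCost]
        ring
  obtain ⟨h1, h2, h3, h4, h5⟩ := key (d - 1) (by omega)
  rw [show d - 1 + 1 = d by omega] at h2
  -- By now `d` distinct vertices have been visited, so none is left. The value `C j 0 = 0` in the
  -- table then makes the next step close the tour.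
  have hzero : S (d - 1) = 0 := by
    apply Nat.eq_of_testBit_eq
    intro k
    rw [Nat.zero_testBit, Bool.eq_false_iff]
    intro hk
    obtain ⟨hkd, hk⟩ := (h4 k).1 hk
    have himg : (Finset.range d).image j = Finset.range d := by
      refine Finset.eq_of_subset_of_card_le (fun y hy => ?_)
        (by rw [Finset.card_image_of_injOn h2])
      obtain ⟨a, ha, rfl⟩ := Finset.mem_image.1 hy
      have := Finset.mem_range.1 ha
      exact Finset.mem_range.2 (h1 a (by omega))
    have : k ∈ (Finset.range d).image j := by rw [himg]; simpa using hkd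
    obtain ⟨a, ha, hak⟩ := Finset.mem_image.1 this
    have := Finset.mem_range.1 ha
    exact hk a (by omega) hak
  obtain ⟨hC, hD⟩ := (h _ h3 _ (h1 (d - 1) le_rfl)).zero hzero
  have hjd : j d = 0 := by
    have := js (d - 1)
    rwa [hC, show d - 1 + 1 = d by omega] at this
  refine ⟨⟨?_, ?_, ?_⟩, ?_⟩
  · intro i hi
    simp only [Finset.card_range] at hi
    exact Finset.mem_range.2 (h1 i (by omega))
  · simpa using h2
  · simp [hjd, j0]
  · rw [← h5, hD]
    obtain ⟨e, rfl⟩ : ∃ e, d = e + 1 := ⟨d - 1, by omega⟩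
    rw [tourCost, Finset.sum_range_succ, hjd]
    rfl

theorem IsTable.le_tourCost {d : ℕ} (hd : 0 < d) {c : ℕ → ℕ → ℝ} {D : ℕ → ℕ → ℝ}
    {C : ℕ → ℕ → ℕ} (h : ∀ S < 2 ^ d, ∀ j < d, IsTable d c D C S j) {t : ℕ → ℕ}
    (ht : IsTour (Finset.range d) t) (h0 : t 0 = 0) : D 0 (2 ^ d - 2) ≤ tourCost c d t := by
  have ht1 : ∀ i < d, t i < d := fun i hi => by simpa using ht.maps i (by simpa using hi)
  have ht2 : ∀ i < d, ∀ j < d, t i = t j → i = j := fun i hi j hj hij =>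
    ht.inj (by simpa using hi) (by simpa using hj) hij
  have ht3 : t d = 0 := by simpa [h0] using ht.closed
  -- Every final segment of a tour competes for the entry of the set of vertices still ahead; the
  -- induction is on its length.
  have key : ∀ a i, i + a + 1 = d → ∀ S < 2 ^ d,
      (∀ k, S.testBit k = true ↔ ∃ b, i < b ∧ b < d ∧ t b = k) →
      D (t i) S ≤ ∑ b ∈ Finset.Ico i d, c (t b) (t (b + 1)) := by
    intro a
    induction a with
    | zero =>
      intro i hi S hS hbit
      have hzero : S = 0 := by
        apply Nat.eq_of_testBit_eq
        intro k
        rw [Nat.zero_testBit, Bool.eq_false_iff, Ne, hbit]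
        rintro ⟨b, hb, hb', -⟩
        omega
      rw [((h S hS _ (ht1 i (by omega))).zero hzero).2]
      rw [← hi, Finset.sum_Ico_succ_top (by omega)]
      simp [show i + 1 = d by omega, ht3]
    | succ a ih =>
      intro i hi S hS hbit
      have hb : S.testBit (t (i + 1)) = true := (hbit _).2 ⟨i + 1, by omega, by omega, rfl⟩
      refine ((h S hS _ (ht1 i (by omega))).le _ (ht1 (i + 1) (by omega)) hb).trans ?_
      rw [Finset.sum_eq_sum_Ico_succ_bot (by omega)]
      refine add_le_add le_rfl (ih (i + 1) (by omega) _ ((Nat.sub_le _ _).trans_lt hS) fun k => ?_)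
      rw [testBit_sub_two_pow hb, hbit]
      constructor
      · rintro ⟨⟨b, hb1, hb2, rfl⟩, hne⟩
        refine ⟨b, ?_, hb2, rfl⟩
        have : b ≠ i + 1 := fun h => hne (by rw [h])
        omega
      · rintro ⟨b, hb1, hb2, rfl⟩
        refine ⟨⟨b, by omega, hb2, rfl⟩, fun h => ?_⟩
        have := ht2 _ hb2 _ (by omega) h
        omega
  have := key (d - 1) 0 (by omega) (2 ^ d - 2) (by have := Nat.two_pow_pos d; omega) fun k => by
    rw [testBit_start hd]
    constructor
    · rintro ⟨hk, hk0⟩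
      obtain ⟨i, hi, rfl⟩ := ht.exists_eq (Finset.mem_range.2 hk)
      refine ⟨i, Nat.pos_of_ne_zero ?_, by simpa using hi, rfl⟩
      rintro rfl
      exact hk0 h0
    · rintro ⟨b, hb1, hb2, rfl⟩
      refine ⟨ht1 b hb2, fun h => ?_⟩
      have := ht2 b hb2 0 hd (by rw [h, h0])
      omega
  rw [h0] at this
  simpa [tourCost] using this

/-! ### The tours of a threading -/

section Visits

variable {V : Type*}

theorem TurnCost.cost_comm {G : SimpleGraph V} (α : TurnCost G) (e f : Sym2 V) :
    α.cost e f = α.cost f e := by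
  have h : ∀ t t' : Sym2 (Sym2 V), t = t' → ∀ ht ht',
      α ⟨t, ht⟩ = α ⟨t', ht'⟩ := by
    rintro t _ rfl _ _
    rfl
  unfold TurnCost.cost
  by_cases he : s(e, f) ∈ turnSet G
  · have he' : s(f, e) ∈ turnSet G := by rwa [Sym2.eq_swap]
    rw [dif_pos he, dif_pos he', h _ _ Sym2.eq_swap]
  · have he' : s(f, e) ∉ turnSet G := by rwa [Sym2.eq_swap]
    rw [dif_neg he, dif_neg he']

/-- If all fibers have two elements, exchanging the two elements of each fiber is an involution
without fixed points. It is applied to the two halves of visits that share a neighbor. -/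
theorem exists_pairsOn_of_fibers {ι κ : Type*} [DecidableEq ι] [DecidableEq κ] {X : Finset ι}
    (b : ι → κ) (h : ∀ x ∈ X, (X.filter fun y => b y = b x).card = 2) :
    ∃ g : ι → ι, PairsOn X g ∧ (∀ x ∈ X, b (g x) = b x) ∧
      ∀ x ∈ X, ∀ y ∈ X, b y = b x → y = x ∨ y = g x := by
  have hex : ∀ x, ∃ y, x ∈ X → y ∈ X ∧ b y = b x ∧ y ≠ x ∧ ∀ z ∈ X, b z = b x → z = x ∨ z = y := by
    intro x
    by_cases hx : x ∈ X
    · obtain ⟨p, q, hpq, hF⟩ := Finset.card_eq_two.1 (h x hx)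
      have hmem : ∀ y, y ∈ X ∧ b y = b x ↔ y = p ∨ y = q := fun y => by
        rw [← Finset.mem_filter (p := fun y => b y = b x), hF]; simp
      have hp := (hmem p).2 (.inl rfl)
      have hq := (hmem q).2 (.inr rfl)
      rcases (hmem x).1 ⟨hx, rfl⟩ with rfl | rfl
      · exact ⟨q, fun _ => ⟨hq.1, hq.2, hpq.symm, fun z hz hb => (hmem z).1 ⟨hz, hb⟩⟩⟩
      · exact ⟨p, fun _ => ⟨hp.1, hp.2, hpq, fun z hz hb => ((hmem z).1 ⟨hz, hb⟩).symm⟩⟩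
    · exact ⟨x, fun h => absurd h hx⟩
  choose g hg using hex
  refine ⟨g, ⟨fun x hx => (hg x hx).1, fun x hx => ?_, fun x hx => (hg x hx).2.2.1⟩,
    fun x hx => (hg x hx).2.1, fun x hx => (hg x hx).2.2.2⟩
  obtain ⟨h1, h2, h3, h4⟩ := hg x hx
  obtain ⟨h5, h6, h7, -⟩ := hg _ h1
  exact (h4 _ h5 (h6.trans h2)).resolve_right h7

variable {ℓ : ℕ} [NeZero ℓ]

/-- The neighbor of the vertex `w (i + 1)` before or after the visit `i`. -/
def visitNbr (w : Fin ℓ → V) (p : Fin ℓ × Bool) : V :=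
  if p.2 then w (p.1 + 1 + 1) else w p.1

/-- The traversal that belongs to the one or the other half of a visit. -/
def visitEdge (p : Fin ℓ × Bool) : Fin ℓ :=
  if p.2 then p.1 + 1 else p.1

theorem walkEdge_visitEdge (w : Fin ℓ → V) (p : Fin ℓ × Bool) :
    walkEdge w (visitEdge p) = s(visitNbr w p, w (p.1 + 1)) := by
  rcases p with ⟨i, _ | _⟩
  · simp [walkEdge, visitEdge, visitNbr]
  · simp [walkEdge, visitEdge, visitNbr, Sym2.eq_swap]

variable [DecidableEq V]

/-- A threading that traverses every edge twice visits `v` along a tour of the neighbors of `v`. -/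
theorem IsExactlyDoubleThreading.exists_tour {G : SimpleGraph V} {w : Fin ℓ → V}
    (hw : IsExactlyDoubleThreading G w) (α : TurnCost G) {v u : V} {N : Finset V}
    (hN : ∀ u, u ∈ N ↔ G.Adj v u) (hu : u ∈ N) :
    ∃ t : ℕ → V, IsTour N t ∧ t 0 = u ∧
      tourCost (fun a b => (α.cost s(a, v) s(v, b) : ℝ)) N.card t =
        ∑ i with w (i + 1) = v, (α.cost (walkEdge w i) (walkEdge w (i + 1)) : ℝ) := by
  -- The points of `X` are the halves of the visits to `v`: `false` for entering, `true` for
  -- leaving.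
  set X : Finset (Fin ℓ × Bool) := Finset.univ.filter fun p => w (p.1 + 1) = v with hX
  have hmem : ∀ p, p ∈ X ↔ w (p.1 + 1) = v := fun p => by simp [hX]
  have hnbr : ∀ p ∈ X, visitNbr w p ∈ N := by
    rintro ⟨i, _ | _⟩ hp
    · rw [hmem] at hp
      rw [hN, ← hp]
      exact (hw.adj i).symm
    · rw [hmem] at hp
      rw [hN, ← hp]
      exact hw.adj (i + 1)
  -- Each traversal of the edge `av` contributes exactly one half at `v`, and there are two
  -- traversals.
  have hfib : ∀ a ∈ N, (X.filter fun p => visitNbr w p = a).card = 2 := by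
    intro a ha
    have hav := (hN a).1 ha
    rw [← hw.twice s(a, v) ((G.mem_edgeSet).2 hav.symm),
      ← Finset.card_image_of_injOn (f := visitEdge), ← Set.ncard_coe_finset]
    · congr 1
      ext i
      simp only [Finset.coe_image, Finset.coe_filter, Set.mem_image, Set.mem_ofPred_eq]
      constructor
      · rintro ⟨p, ⟨hp, rfl⟩, rfl⟩
        rw [walkEdge_visitEdge, (hmem p).1 hp]
      · intro h
        rcases Sym2.eq_iff.1 h with ⟨h1, h2⟩ | ⟨h1, h2⟩
        · exact ⟨(i, false), ⟨(hmem _).2 h2, h1⟩, rfl⟩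
        -- A traversal `i` that starts at `v` is the leaving half of visit `i - 1`, since visit `i`
        -- takes place at `w (i + 1)`.
        · refine ⟨(i - 1, true), ⟨(hmem _).2 ?_, ?_⟩, ?_⟩
          · simpa using h1
          · simpa [visitNbr] using h2
          · simp [visitEdge]
    · rintro ⟨i, bi⟩ hi ⟨j, bj⟩ hj hij
      simp only [Finset.coe_filter, Set.mem_ofPred_eq, hmem] at hi hj
      rcases bi with _ | _ <;> rcases bj with _ | _ <;> simp only [visitEdge] at hij
      · simpa using hij
      · simp only [Bool.false_eq_true, if_false, if_true] at hij
        have h := hw.adj i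
        rw [hi.1, hij, hj.1] at h
        exact absurd rfl h.ne
      · simp only [Bool.false_eq_true, if_false, if_true] at hij
        have h := hw.adj j
        rw [hj.1, ← hij, hi.1] at h
        exact absurd rfl h.ne
      · simpa using hij
  obtain ⟨g, hg, hgb, hgu⟩ := exists_pairsOn_of_fibers (X := X) (visitNbr w)
    fun p hp => hfib _ (hnbr p hp)
  -- Here `f` exchanges entering and leaving in a visit, while `g` exchanges the two halves with the
  -- same neighbor. The orbits are the components of the junction multigraph.
  set f : Fin ℓ × Bool → Fin ℓ × Bool := fun p => (p.1, !p.2) with hfdef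
  have hf : PairsOn X f := by
    refine ⟨fun p hp => (hmem _).2 ((hmem p).1 hp), fun p _ => by simp [hfdef], fun p _ h => ?_⟩
    have := congrArg Prod.snd h
    simp [hfdef] at this
  obtain ⟨x, hx, hxu⟩ : ∃ x ∈ X, visitNbr w x = u := by
    have : (X.filter fun p => visitNbr w p = u).Nonempty := by
      rw [← Finset.card_pos, hfib u hu]; norm_num
    obtain ⟨x, hx⟩ := this
    exact ⟨x, (Finset.mem_filter.1 hx).1, (Finset.mem_filter.1 hx).2⟩
  have hsame : ∀ p ∈ X, ∀ q ∈ X, visitNbr w p = visitNbr w q → SameOrbit X f g p q := by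
    intro p hp q hq h
    rcases hgu q hq p hp h with rfl | rfl
    · exact .refl _
    · exact (SameOrbit.right hq).symm
  have hedge : ∀ p ∈ X, ∀ q ∈ X, s(visitNbr w p, v) = s(visitNbr w q, v) →
      SameOrbit X f g p q := by
    intro p hp q hq h
    exact hsame p hp q hq (Sym2.congr_left.1 h)
  have horb : ∀ e e' : G.incidenceSet v, (junctionGraph G w v).Walk e e' →
      ∀ p ∈ X, ∀ q ∈ X, s(visitNbr w p, v) = e → s(visitNbr w q, v) = e' →
        SameOrbit X f g p q := by
    intro e e' walk
    induction walk with
    | nil =>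
      intro p hp q hq h1 h2
      exact hedge p hp q hq (h1.trans h2.symm)
    | @cons e₁ e₂ e₃ hadj walk ih =>
      intro p hp q hq h1 h2
      have hstep : ∃ i : Fin ℓ, ∃ b, w (i + 1) = v ∧ s(visitNbr w (i, b), v) = e₁.1 ∧
          s(visitNbr w (i, !b), v) = e₂.1 := by
        simp only [junctionGraph, SimpleGraph.fromRel_adj] at hadj
        rcases hadj.2 with ⟨i, h1, h2, h3⟩ | ⟨i, h1, h2, h3⟩
        · refine ⟨i, false, h1, ?_, ?_⟩
          · rw [← h2, ← h1]; rfl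
          · rw [← h3, ← h1]; exact Sym2.eq_swap
        · refine ⟨i, true, h1, ?_, ?_⟩
          · rw [← h3, ← h1]; exact Sym2.eq_swap
          · rw [← h2, ← h1]; rfl
      obtain ⟨i, b, hi, he1, he2⟩ := hstep
      have hib : (i, b) ∈ X := (hmem _).2 hi
      have hib' : (i, !b) ∈ X := (hmem _).2 hi
      exact (hedge p hp _ hib (h1.trans he1.symm)).trans _ _ _
        ((SameOrbit.left hib).trans _ _ _ (ih _ hib' q hq he2 h2))
  have hall : ∀ y ∈ X, SameOrbit X f g x y := by
    intro y hy
    have hin : ∀ p ∈ X, s(visitNbr w p, v) ∈ G.incidenceSet v := fun p hp =>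
      ⟨(G.mem_edgeSet).2 ((hN _).1 (hnbr p hp)).symm, by simp⟩
    obtain ⟨walk⟩ := (hw.connected v).preconnected ⟨_, hin x hx⟩ ⟨_, hin y hy⟩
    exact horb _ _ walk x hx y hy rfl rfl
  obtain ⟨K, hK, -, hp, hinj, hl, hr, hsum⟩ := exists_walk hf hg hx hall
  have hmemk := iterate_mem hf hg hx
  -- The walk contains exactly one of `y` and `g y`, so it meets each neighbor of `v` once.
  have hinjN : Set.InjOn (fun k => visitNbr w ((g ∘ f)^[k] x)) (Finset.range K) := by
    intro i hi j hj hij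
    rcases hgu _ (hmemk j) _ (hmemk i) hij with h | h
    · exact hinj hi hj h
    · exact absurd ⟨i, by simpa using hi, h⟩
        ((hr _ (hmemk j)).1 ⟨j, by simpa using hj, rfl⟩)
  have himg : (Finset.range K).image (fun k => visitNbr w ((g ∘ f)^[k] x)) = N := by
    ext a
    simp only [Finset.mem_image, Finset.mem_range]
    constructor
    · rintro ⟨k, -, rfl⟩
      exact hnbr _ (hmemk k)
    · intro ha
      have : (X.filter fun p => visitNbr w p = a).Nonempty := by
        rw [← Finset.card_pos, hfib a ha]; norm_num
      obtain ⟨y, hy⟩ := this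
      obtain ⟨hyX, rfl⟩ := Finset.mem_filter.1 hy
      by_cases h : ∃ k < K, (g ∘ f)^[k] x = g y
      · obtain ⟨k, hk, h⟩ := h
        exact ⟨k, hk, by rw [h, hgb y hyX]⟩
      · obtain ⟨k, hk, h⟩ := (hr y hyX).2 h
        exact ⟨k, hk, by rw [h]⟩
  have hcard : N.card = K := by
    rw [← himg, Finset.card_image_of_injOn hinjN, Finset.card_range]
  refine ⟨fun k => visitNbr w ((g ∘ f)^[k] x), ⟨fun i _ => hnbr _ (hmemk i), ?_, ?_⟩, hxu, ?_⟩
  · rw [hcard]; exact hinjN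
  · simp only [hcard, hp, Function.iterate_zero, id]
  · have hs := hsum (fun p => (α.cost s(visitNbr w p, v) s(v, visitNbr w (f p)) : ℝ))
      (fun y hy => by
        simp only [hf.invol y hy]
        rw [α.cost_comm, Sym2.eq_swap (a := v), Sym2.eq_swap (a := v)])
    have h1 : ∑ p ∈ X, (α.cost s(visitNbr w p, v) s(v, visitNbr w (f p)) : ℝ) =
        2 * ∑ i with w (i + 1) = v, (α.cost (walkEdge w i) (walkEdge w (i + 1)) : ℝ) := by
      rw [hX, Finset.sum_filter, Fintype.sum_prod_type, Finset.sum_filter, Finset.mul_sum]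
      refine Finset.sum_congr rfl fun i _ => ?_
      rw [Fintype.sum_bool]
      by_cases hi : w (i + 1) = v
      · subst hi
        simp only [if_true, visitNbr, hfdef, walkEdge, Bool.not_true, Bool.not_false,
          Bool.false_eq_true, if_false]
        rw [α.cost_comm, Sym2.eq_swap (a := w (i + 1)) (b := w i),
          Sym2.eq_swap (a := w (i + 1 + 1))]
        ring
      · simp [hi]
    have h2 : tourCost (fun a b => (α.cost s(a, v) s(v, b) : ℝ)) N.card
        (fun k => visitNbr w ((g ∘ f)^[k] x)) =
        ∑ k ∈ Finset.range K, (α.cost s(visitNbr w ((g ∘ f)^[k] x), v)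
          s(v, visitNbr w (f ((g ∘ f)^[k] x))) : ℝ) := by
      rw [hcard, tourCost]
      refine Finset.sum_congr rfl fun k _ => ?_
      rw [← iterate_succ_comp (f := f) (g := g), hgb _ (hf.mem _ (hmemk k))]
    rw [h2]
    linarith

theorem walkCost_eq_sum [Fintype V] {G : SimpleGraph V} (α : TurnCost G) (w : Fin ℓ → V) :
    (walkCost α w : ℝ) =
      ∑ v, ∑ i with w (i + 1) = v, (α.cost (walkEdge w i) (walkEdge w (i + 1)) : ℝ) := by
  rw [Finset.sum_fiberwise, walkCost, NNReal.coe_sum]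

end Visits

/-! ### The threading of a system of tours -/

section Flags

set_option linter.unusedSectionVars false

variable {V : Type*} [Fintype V] [DecidableEq V] (G : SimpleGraph V) [DecidableRel G.Adj]

/-- The flags of `G`: triples of a vertex `v`, a neighbor `u` of `v`, and a side of the end at `v`
of the edge `vu`. -/
def flags : Finset (V × V × Bool) := Finset.univ.filter fun x => G.Adj x.1 x.2.1

/-- The flag on the other side. -/
def otherSide (x : V × V × Bool) : V × V × Bool := (x.1, x.2.1, !x.2.2)

/-- The edge of a flag. -/
def flagEdge (x : V × V × Bool) : Sym2 V := s(x.1, x.2.1)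

variable {G}

theorem mem_flags {x : V × V × Bool} : x ∈ flags G ↔ G.Adj x.1 x.2.1 := by simp [flags]

theorem otherSide_pairsOn : PairsOn (flags G) otherSide :=
  ⟨fun x hx => by have h := mem_flags.1 hx; exact mem_flags.2 h, fun x _ => by simp [otherSide], fun x _ h => by
    have := congrArg (fun y => y.2.2) h
    simp [otherSide] at this⟩

theorem eq_or_eq_otherSide {x y : V × V × Bool} (h : y.1 = x.1) (h' : y.2.1 = x.2.1) :
    y = x ∨ y = otherSide x := by
  obtain ⟨v, u, o⟩ := x
  obtain ⟨v', u', o'⟩ := y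
  simp only at h h'
  subst h h'
  cases o <;> cases o' <;> simp [otherSide]

/-- `f` joins the two flags of every corner of the given tours. -/
structure Corners (G : SimpleGraph V) [DecidableRel G.Adj] (t : V → ℕ → V)
    (f : V × V × Bool → V × V × Bool) : Prop where
  pairs : PairsOn (flags G) f
  next : ∀ v, ∀ i < (G.neighborFinset v).card, f (v, t v i, false) = (v, t v (i + 1), true)
  prev : ∀ v, ∀ i < (G.neighborFinset v).card, f (v, t v (i + 1), true) = (v, t v i, false)

/-- `g` joins the flags of the two ends of every edge. -/
structure Gluing (G : SimpleGraph V) [DecidableRel G.Adj]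
    (g : V × V × Bool → V × V × Bool) : Prop where
  pairs : PairsOn (flags G) g
  head : ∀ x ∈ flags G, (g x).1 = x.2.1
  tail : ∀ x ∈ flags G, (g x).2.1 = x.1
  side : ∀ x ∈ flags G, g (otherSide x) = otherSide (g x)

/-- Side `false` of a neighbor faces its successor on the tour, side `true` its predecessor. The
function `a` finds the position of a neighbor, and `b` the position before it, cyclically. Since `f`
always changes the side, it has no fixed point. -/
theorem exists_corners {t : V → ℕ → V} (ht : ∀ v, IsTour (G.neighborFinset v) (t v)) :
    ∃ f, Corners G t f := by
  have h1 : ∀ v u, ∃ i, G.Adj v u → i < (G.neighborFinset v).card ∧ t v i = u := by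
    intro v u
    by_cases h : G.Adj v u
    · obtain ⟨i, hi⟩ := (ht v).exists_eq ((G.mem_neighborFinset v u).2 h)
      exact ⟨i, fun _ => hi⟩
    · exact ⟨0, fun h' => absurd h' h⟩
  have h2 : ∀ v u, ∃ i, G.Adj v u → i < (G.neighborFinset v).card ∧ t v (i + 1) = u := by
    intro v u
    by_cases h : G.Adj v u
    · obtain ⟨i, hi, hi'⟩ := (ht v).exists_eq ((G.mem_neighborFinset v u).2 h)
      rcases i with _ | i
      · refine ⟨(G.neighborFinset v).card - 1, fun _ => ⟨by omega, ?_⟩⟩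
        rw [Nat.sub_add_cancel (by omega), (ht v).closed, hi']
      · exact ⟨i, fun _ => ⟨by omega, hi'⟩⟩
    · exact ⟨0, fun h' => absurd h' h⟩
  have inj : ∀ v, ∀ i < (G.neighborFinset v).card, ∀ j < (G.neighborFinset v).card,
      t v i = t v j → i = j := fun v i hi j hj h =>
    (ht v).inj (by simpa using hi) (by simpa using hj) h
  have inj' : ∀ v, ∀ i < (G.neighborFinset v).card, ∀ j < (G.neighborFinset v).card,
      t v (i + 1) = t v (j + 1) → i = j := by
    intro v i hi j hj h
    rcases Nat.lt_or_eq_of_le (Nat.succ_le_of_lt hi) with hi' | hi' <;>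
    rcases Nat.lt_or_eq_of_le (Nat.succ_le_of_lt hj) with hj' | hj'
    · have := inj v _ hi' _ hj' h
      omega
    · rw [show j + 1 = _ from hj', (ht v).closed] at h
      have := inj v _ hi' 0 (by omega) h
      omega
    · rw [show i + 1 = _ from hi', (ht v).closed] at h
      have := inj v 0 (by omega) _ hj' h
      omega
    · omega
  have adj : ∀ v, ∀ i < (G.neighborFinset v).card, G.Adj v (t v i) := fun v i hi =>
    (G.mem_neighborFinset v _).1 ((ht v).maps i hi)
  have adj' : ∀ v, ∀ i < (G.neighborFinset v).card, G.Adj v (t v (i + 1)) := fun v i hi => by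
    rcases Nat.lt_or_eq_of_le (Nat.succ_le_of_lt hi) with hi' | hi'
    · exact adj v _ hi'
    · rw [show i + 1 = _ from hi', (ht v).closed]
      exact adj v 0 (by omega)
  choose a ha using h1
  choose b hb using h2
  refine ⟨fun x => if x.2.2 then (x.1, t x.1 (b x.1 x.2.1), false)
    else (x.1, t x.1 (a x.1 x.2.1 + 1), true), ⟨?_, ?_, ?_⟩, ?_, ?_⟩
  · rintro ⟨v, u, _ | _⟩ hx
    · rw [mem_flags]
      exact adj' v _ (ha v u (mem_flags.1 hx)).1
    · rw [mem_flags]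
      exact adj v _ (hb v u (mem_flags.1 hx)).1
  · rintro ⟨v, u, _ | _⟩ hx
    · obtain ⟨h, h'⟩ := ha v u (mem_flags.1 hx)
      obtain ⟨k, k'⟩ := hb v _ (adj' v _ h)
      simp only [Bool.false_eq_true, if_false, if_true, inj' v _ k _ h k', h']
    · obtain ⟨h, h'⟩ := hb v u (mem_flags.1 hx)
      obtain ⟨k, k'⟩ := ha v _ (adj v _ h)
      simp only [Bool.false_eq_true, if_false, if_true, inj v _ k _ h k', h']
  · rintro ⟨v, u, _ | _⟩ hx h
    · simp at h
    · simp at h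
  · intro v i hi
    obtain ⟨k, k'⟩ := ha v _ (adj v _ hi)
    simp only [Bool.false_eq_true, if_false, inj v _ k _ hi k']
  · intro v i hi
    obtain ⟨k, k'⟩ := hb v _ (adj' v _ hi)
    simp only [if_true, inj' v _ k _ hi k']

theorem exists_index {t : V → ℕ → V} (ht : ∀ v, IsTour (G.neighborFinset v) (t v))
    {x : V × V × Bool} (hx : x ∈ flags G) :
    ∃ i < (G.neighborFinset x.1).card, t x.1 i = x.2.1 :=
  (ht x.1).exists_eq ((G.mem_neighborFinset _ _).2 (mem_flags.1 hx))

namespace Corners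

variable {t : V → ℕ → V} {f : V × V × Bool → V × V × Bool}

theorem cases (hf : Corners G t f) (ht : ∀ v, IsTour (G.neighborFinset v) (t v))
    {x : V × V × Bool} (hx : x ∈ flags G) :
    ∃ v, ∃ i < (G.neighborFinset v).card,
      (x = (v, t v i, false) ∧ f x = (v, t v (i + 1), true)) ∨
      (x = (v, t v (i + 1), true) ∧ f x = (v, t v i, false)) := by
  have key : ∀ y ∈ flags G, y.2.2 = false → ∃ i < (G.neighborFinset y.1).card,
      y = (y.1, t y.1 i, false) := by
    rintro ⟨v, u, o⟩ hy rfl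
    obtain ⟨i, hi, h⟩ := exists_index ht hy
    exact ⟨i, hi, by simp only at h; simp [h]⟩
  rcases hb : x.2.2 with _ | _
  · obtain ⟨i, hi, h⟩ := key x hx hb
    exact ⟨x.1, i, hi, .inl ⟨h, by rw [h]; exact hf.next _ i hi⟩⟩
  · obtain ⟨i, hi, h⟩ := exists_index ht hx
    obtain ⟨v, u, o⟩ := x
    simp only at hb h hi
    subst hb h
    rcases i with _ | i
    · refine ⟨v, (G.neighborFinset v).card - 1, by omega, .inr ?_⟩
      have := hf.prev v ((G.neighborFinset v).card - 1) (by omega)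
      rw [Nat.sub_add_cancel (by omega), (ht v).closed] at this ⊢
      exact ⟨rfl, this⟩
    · exact ⟨v, i, by omega, .inr ⟨rfl, hf.prev v i (by omega)⟩⟩

theorem head (hf : Corners G t f) (ht : ∀ v, IsTour (G.neighborFinset v) (t v))
    {x : V × V × Bool} (hx : x ∈ flags G) : (f x).1 = x.1 := by
  obtain ⟨v, i, hi, ⟨rfl, h⟩ | ⟨rfl, h⟩⟩ := hf.cases ht hx <;> rw [h]

theorem _root_.Threading.IsTour.succ_ne {ι : Type*} {X : Finset ι} {t : ℕ → ι} (h : IsTour X t)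
    (hX : 2 ≤ X.card) {i : ℕ} (hi : i < X.card) : t i ≠ t (i + 1) := by
  intro he
  rcases Nat.lt_or_eq_of_le (Nat.succ_le_of_lt hi) with hi' | hi'
  · have := h.inj (by simpa using hi) (by simpa using hi') he
    omega
  · rw [show i + 1 = _ from hi', h.closed] at he
    have := h.inj (x₁ := i) (x₂ := 0) (by simpa using hi)
      (by simpa using (show 0 < X.card by omega)) he
    omega

theorem tail_ne (hf : Corners G t f) (ht : ∀ v, IsTour (G.neighborFinset v) (t v))
    (hd : ∀ v, 2 ≤ (G.neighborFinset v).card) {x : V × V × Bool} (hx : x ∈ flags G) :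
    (f x).2.1 ≠ x.2.1 := by
  obtain ⟨v, i, hi, ⟨rfl, h⟩ | ⟨rfl, h⟩⟩ := hf.cases ht hx <;> rw [h]
  · exact ((ht v).succ_ne (hd v) hi).symm
  · exact (ht v).succ_ne (hd v) hi

/-- Every corner has one flag of each side, and its cost is symmetric; hence the factor 2. -/
theorem sum_eq (hf : Corners G t f) (ht : ∀ v, IsTour (G.neighborFinset v) (t v))
    (α : TurnCost G) :
    ∑ x ∈ flags G, (α.cost (flagEdge x) (flagEdge (f x)) : ℝ) =
      2 * ∑ v, tourCost (fun a b => (α.cost s(a, v) s(v, b) : ℝ)) (G.neighborFinset v).card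
        (t v) := by
  rw [← Finset.sum_filter_add_sum_filter_not _ (fun x : V × V × Bool => x.2.2 = false)]
  have h1 : ∑ x ∈ flags G with ¬ x.2.2 = false, (α.cost (flagEdge x) (flagEdge (f x)) : ℝ) =
      ∑ x ∈ flags G with x.2.2 = false, (α.cost (flagEdge x) (flagEdge (f x)) : ℝ) := by
    refine Finset.sum_nbij' f f ?_ ?_ ?_ ?_ ?_
    · intro x hx
      rw [Finset.mem_filter] at hx ⊢
      refine ⟨hf.pairs.mem _ hx.1, ?_⟩
      obtain ⟨v, i, hi, ⟨rfl, h⟩ | ⟨rfl, h⟩⟩ := hf.cases ht hx.1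
      · simp at hx
      · rw [h]
    · intro x hx
      rw [Finset.mem_filter] at hx ⊢
      refine ⟨hf.pairs.mem _ hx.1, ?_⟩
      obtain ⟨v, i, hi, ⟨rfl, h⟩ | ⟨rfl, h⟩⟩ := hf.cases ht hx.1
      · rw [h]; simp
      · simp at hx
    · exact fun x hx => hf.pairs.invol _ (Finset.mem_filter.1 hx).1
    · exact fun x hx => hf.pairs.invol _ (Finset.mem_filter.1 hx).1
    · intro x hx
      rw [hf.pairs.invol _ (Finset.mem_filter.1 hx).1, α.cost_comm]
  rw [h1, ← two_mul]
  congr 1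
  rw [flags, Finset.filter_filter, Finset.sum_filter, Fintype.sum_prod_type]
  refine Finset.sum_congr rfl fun v _ => ?_
  have himg : (Finset.range (G.neighborFinset v).card).image (t v) = G.neighborFinset v := by
    refine Finset.eq_of_subset_of_card_le (fun y hy => ?_)
      (by rw [Finset.card_image_of_injOn (ht v).inj, Finset.card_range])
    obtain ⟨i, hi, rfl⟩ := Finset.mem_image.1 hy
    exact (ht v).maps i (Finset.mem_range.1 hi)
  have h2 : ∑ x : V × Bool, (if G.Adj v x.1 ∧ x.2 = false then
      (α.cost (flagEdge (v, x)) (flagEdge (f (v, x))) : ℝ) else 0) =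
      ∑ u ∈ G.neighborFinset v,
        (α.cost (flagEdge (v, u, false)) (flagEdge (f (v, u, false))) : ℝ) := by
    rw [Fintype.sum_prod_type, G.neighborFinset_eq_filter, Finset.sum_filter]
    refine Finset.sum_congr rfl fun u _ => ?_
    simp
  rw [h2, ← himg, Finset.sum_image (ht v).inj, himg, tourCost]
  refine Finset.sum_congr rfl fun i hi => ?_
  rw [hf.next v i (Finset.mem_range.1 hi), flagEdge, flagEdge, Sym2.eq_swap]

/-- If the two sides of every edge are in the same orbit, then there is only one orbit. -/
theorem sameOrbit (hf : Corners G t f) (ht : ∀ v, IsTour (G.neighborFinset v) (t v))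
    (hG : G.Connected) {g : V × V × Bool → V × V × Bool} (hg : Gluing G g)
    (hs : ∀ x ∈ flags G, SameOrbit (flags G) f g x (otherSide x)) :
    ∀ x ∈ flags G, ∀ y ∈ flags G, SameOrbit (flags G) f g x y := by
  have hside : ∀ x ∈ flags G, ∀ y ∈ flags G, x.1 = y.1 → x.2.1 = y.2.1 →
      SameOrbit (flags G) f g x y := by
    intro x hx y hy h h'
    rcases eq_or_eq_otherSide h h' with rfl | rfl
    · exact .refl _
    · exact (hs y hy).symm
  have hmem : ∀ v, ∀ i < (G.neighborFinset v).card, ∀ o, (v, t v i, o) ∈ flags G :=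
    fun v i hi o => mem_flags.2 ((G.mem_neighborFinset v _).1 ((ht v).maps i hi))
  -- A corner followed by a change of side moves to the next neighbor on the tour. This connects all
  -- flags at one vertex, and gluing along walks of `G` then connects the vertices.
  have hv0 : ∀ v, ∀ i < (G.neighborFinset v).card,
      SameOrbit (flags G) f g (v, t v 0, false) (v, t v i, false) := by
    intro v i hi
    induction i with
    | zero => exact .refl _
    | succ i ih =>
      refine (ih (by omega)).trans _ _ _ ?_
      have := SameOrbit.left (f := f) (g := g) (hmem v i (by omega) false)
      rw [hf.next v i (by omega)] at this
      exact this.trans _ _ _ (hside _ (hmem v _ hi _) _ (hmem v _ hi _) rfl rfl)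
  have hv : ∀ x ∈ flags G, ∀ y ∈ flags G, x.1 = y.1 → SameOrbit (flags G) f g x y := by
    have h0 : ∀ x ∈ flags G, SameOrbit (flags G) f g (x.1, t x.1 0, false) x := by
      intro x hx
      obtain ⟨i, hi, h⟩ := exists_index ht hx
      exact (hv0 _ i hi).trans _ _ _ (hside _ (hmem _ i hi _) _ hx rfl h)
    intro x hx y hy h
    have := h0 x hx
    rw [h] at this
    exact this.symm.trans _ _ _ (h0 y hy)
  have hwalk : ∀ a b, G.Walk a b → ∀ x ∈ flags G, ∀ y ∈ flags G, x.1 = a → y.1 = b →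
      SameOrbit (flags G) f g x y := by
    intro a b p
    induction p with
    | nil => exact fun x hx y hy h h' => hv x hx y hy (h.trans h'.symm)
    | @cons a c b hadj p ih =>
      intro x hx y hy h h'
      have hz : (a, c, false) ∈ flags G := mem_flags.2 hadj
      exact (hv x hx _ hz h).trans _ _ _ ((SameOrbit.right hz).trans _ _ _
        (ih _ (hg.pairs.mem _ hz) y hy (hg.head _ hz) h'))
  intro x hx y hy
  obtain ⟨p⟩ := hG.preconnected x.1 y.1
  exact hwalk _ _ p x hx y hy rfl rfl

end Corners

theorem Gluing.flagEdge_eq {g : V × V × Bool → V × V × Bool} (hg : Gluing G g)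
    {x : V × V × Bool} (hx : x ∈ flags G) : flagEdge (g x) = flagEdge x := by
  rw [flagEdge, flagEdge, hg.head x hx, hg.tail x hx, Sym2.eq_swap]

/-- The four flags of an edge form two pairs of `g`. Each pair will account for one traversal of the
edge. -/
theorem Gluing.eq_of_flagEdge_eq {g : V × V × Bool → V × V × Bool} (hg : Gluing G g)
    {x y : V × V × Bool} (hy : y ∈ flags G) (h : flagEdge y = flagEdge x) :
    (y = x ∨ y = g x) ∨ (y = otherSide x ∨ y = g (otherSide x)) := by
  rcases Sym2.eq_iff.1 h with ⟨h1, h2⟩ | ⟨h1, h2⟩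
  · rcases eq_or_eq_otherSide h1 h2 with h | h
    · exact .inl (.inl h)
    · exact .inr (.inl h)
  · rcases eq_or_eq_otherSide (x := x) (y := g y) ((hg.head y hy).trans h2)
      ((hg.tail y hy).trans h1) with h | h
    · exact .inl (.inr (by rw [← h, hg.pairs.invol y hy]))
    · exact .inr (.inr (by rw [← h, hg.pairs.invol y hy]))

/-- The threading defined by tours at all vertices and by a gluing with a single orbit. -/
theorem isOptimal_of_corners {t : V → ℕ → V} {f g : V × V × Bool → V × V × Bool}
    (hG : G.Connected) (hd : ∀ v, 2 ≤ (G.neighborFinset v).card) (α : TurnCost G)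
    (ht : ∀ v, IsTour (G.neighborFinset v) (t v))
    (hopt : ∀ v t', IsTour (G.neighborFinset v) t' → t' 0 = t v 0 →
      tourCost (fun a b => (α.cost s(a, v) s(v, b) : ℝ)) (G.neighborFinset v).card (t v) ≤
        tourCost (fun a b => (α.cost s(a, v) s(v, b) : ℝ)) (G.neighborFinset v).card t')
    (hf : Corners G t f) (hg : Gluing G g)
    (hs : ∀ x ∈ flags G, SameOrbit (flags G) f g x (otherSide x))
    {x : V × V × Bool} (hx : x ∈ flags G) {ℓ : ℕ} [NeZero ℓ] (hℓ : 2 * ℓ = (flags G).card)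
    {w : Fin ℓ → V} (hw : ∀ k, w k = ((g ∘ f)^[k] x).1) : IsOptimal G α w := by
  obtain ⟨K, hK, hcard, hp, hinj, hl, hr, hsum⟩ :=
    exists_walk hf.pairs hg.pairs hx (hf.sameOrbit ht hG hg hs x hx)
  obtain rfl : ℓ = K := by omega
  set y : Fin ℓ → V × V × Bool := fun k => (g ∘ f)^[k] x with hy
  have hymem : ∀ k, y k ∈ flags G := fun k => iterate_mem hf.pairs hg.pairs hx k
  have hysucc : ∀ k, y (k + 1) = g (f (y k)) := by
    intro k
    simp only [hy]
    rw [iterate_succ_comp (f := f) (g := g), ← iterate_add_period hp (k + 1), Fin.val_add,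
      Fin.val_one', Nat.add_mod_mod]
  have hyinj : ∀ i j, y i = y j → i = j := fun i j h =>
    Fin.ext (hinj (by simp) (by simp) h)
  have hl' : ∀ z ∈ flags G, ((∃ k, y k = z) ↔ ¬ ∃ k, y k = f z) := by
    simpa only [hy, Fin.exists_iff, exists_prop] using hl
  have hr' : ∀ z ∈ flags G, ((∃ k, y k = z) ↔ ¬ ∃ k, y k = g z) := by
    simpa only [hy, Fin.exists_iff, exists_prop] using hr
  have hsurj : ∀ k : Fin ℓ, ∃ j, j + 1 = k := fun k => ⟨k - 1, by simp⟩
  have hwy : ∀ k, w k = (y k).1 := hw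
  -- The walk turns by `f` at its current vertex and then crosses an edge by `g`, so this edge
  -- belongs both to `f (y k)` and to `y (k + 1)`.
  have hedge : ∀ k, walkEdge w k = flagEdge (f (y k)) := by
    intro k
    rw [walkEdge, hwy, hwy, hysucc, hg.head _ (hf.pairs.mem _ (hymem k)), flagEdge,
      hf.head ht (hymem k)]
  have hedge' : ∀ k, walkEdge w k = flagEdge (y (k + 1)) := by
    intro k
    rw [hedge, hysucc, hg.flagEdge_eq (hf.pairs.mem _ (hymem k))]
  have htwice : ∀ e ∈ G.edgeSet, {i | walkEdge w i = e}.ncard = 2 := by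
    intro e he
    induction e with
    | _ v u =>
    have hz : (v, u, false) ∈ flags G := mem_flags.2 he
    have hz' := otherSide_pairsOn.mem _ hz
    -- By `hr'` exactly one flag of each pair of `g` is on the walk, and it occurs there once.
    have h1 : ∀ z ∈ flags G, flagEdge z = s(v, u) →
        ∃ k, ∀ j, (y (j + 1) = z ∨ y (j + 1) = g z) ↔ j = k := by
      intro z hz _
      have : ∃ k, y k = z ∨ y k = g z := by
        by_cases h : ∃ k, y k = g z
        · exact ⟨_, .inr h.choose_spec⟩
        · exact ⟨_, .inl ((hr' z hz).2 h).choose_spec⟩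
      obtain ⟨k, hk⟩ := this
      obtain ⟨k, rfl⟩ := hsurj k
      refine ⟨k, fun j => ⟨fun hj => ?_, fun hj => hj ▸ hk⟩⟩
      rcases hk with hk | hk <;> rcases hj with hj | hj
      · simpa using hyinj _ _ (hj.trans hk.symm)
      · exact absurd ⟨_, hj⟩ ((hr' z hz).1 ⟨_, hk⟩)
      · exact absurd ⟨_, hk⟩ ((hr' z hz).1 ⟨_, hj⟩)
      · simpa using hyinj _ _ (hj.trans hk.symm)
    obtain ⟨k, hk⟩ := h1 _ hz rfl
    obtain ⟨k', hk'⟩ := h1 _ hz' rfl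
    have hne : k ≠ k' := by
      rintro rfl
      have a := (hk k).2 rfl
      have b := (hk' k).2 rfl
      rw [hg.side _ hz] at b
      have hadj : v ≠ u := G.ne_of_adj he
      have hh := hg.head _ hz
      have hzz : (otherSide (v, u, false)).1 = v := rfl
      rcases a with a | a <;> rcases b with b | b
      · exact otherSide_pairsOn.ne _ hz (b.symm.trans a)
      · have := congrArg Prod.fst (a.symm.trans b)
        exact hadj (this.trans hh)
      · have := congrArg Prod.fst (b.symm.trans a)
        exact hadj (this.trans hh)
      · exact otherSide_pairsOn.ne _ (hg.pairs.mem _ hz) (b.symm.trans a)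
    rw [← Set.ncard_pair hne]
    congr 1
    ext j
    simp only [Set.mem_ofPred_eq, Set.mem_insert_iff, Set.mem_singleton_iff]
    rw [← hk, ← hk', hedge']
    constructor
    · exact fun h => hg.eq_of_flagEdge_eq (x := (v, u, false)) (hymem _) h
    · rintro ((h | h) | (h | h)) <;> rw [h]
      · rfl
      · rw [hg.flagEdge_eq hz]; rfl
      · rfl
      · rw [hg.flagEdge_eq hz']; rfl
  have hadj : ∀ i, G.Adj (w i) (w (i + 1)) := by
    intro i
    have := mem_flags.1 (hf.pairs.mem _ (hymem i))
    rwa [hwy, hwy, hysucc, hg.head _ (hf.pairs.mem _ (hymem i)), ← hf.head ht (hymem i)]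
  have hthread : IsExactlyDoubleThreading G w := by
    refine ⟨⟨hadj, ?_, ?_, ?_⟩, htwice⟩
    · intro e he
      have : {i | walkEdge w i = e}.Nonempty := by
        rw [← Set.ncard_pos, htwice e he]; norm_num
      exact this
    · intro i
      rw [hedge', hedge, flagEdge, flagEdge, hf.head ht (hymem _)]
      intro h
      -- A corner joins two different neighbors because the tour has at least two members.
      exact hf.tail_ne ht hd (hymem (i + 1)) (Sym2.congr_right.1 h).symm
    · intro v
      have hin : ∀ i < (G.neighborFinset v).card, s(v, t v i) ∈ G.incidenceSet v := fun i hi =>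
        ⟨G.mem_edgeSet.2 ((G.mem_neighborFinset v _).1 ((ht v).maps i hi)), by simp⟩
      have hpos : 0 < (G.neighborFinset v).card := by have := hd v; omega
      have hstep : ∀ i (hi : i + 1 < (G.neighborFinset v).card),
          (junctionGraph G w v).Adj ⟨_, hin i (by omega)⟩ ⟨_, hin (i + 1) hi⟩ := by
        intro i hi
        have hne := (ht v).succ_ne (hd v) (i := i) (by omega)
        simp only [junctionGraph, SimpleGraph.fromRel_adj]
        refine ⟨fun h => hne (Sym2.congr_right.1 (congrArg Subtype.val h)), ?_⟩
        have hz : (v, t v i, false) ∈ flags G := mem_flags.2 (hin i (by omega)).1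
        have hnext := hf.next v i (by omega)
        have hprev := hf.prev v i (by omega)
        -- By `hl'` every corner is passed in one of its two directions; the direction is irrelevant
        -- for the junction graph.
        by_cases h : ∃ k, y k = (v, t v i, false)
        · obtain ⟨k, hk⟩ := h
          obtain ⟨k, rfl⟩ := hsurj k
          refine .inl ⟨k, ?_, ?_, ?_⟩
          · rw [hwy, hk]
          · rw [hedge', hk]; rfl
          · rw [hedge, hk, hnext]; rfl
        · have h' := not_imp_comm.1 (hl' _ hz).2 h
          rw [hnext] at h'
          obtain ⟨k, hk⟩ := h'
          obtain ⟨k, rfl⟩ := hsurj k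
          refine .inr ⟨k, ?_, ?_, ?_⟩
          · rw [hwy, hk]
          · rw [hedge', hk]; rfl
          · rw [hedge, hk, hprev]; rfl
      have hreach : ∀ i (hi : i < (G.neighborFinset v).card),
          (junctionGraph G w v).Reachable ⟨_, hin 0 hpos⟩ ⟨_, hin i hi⟩ := by
        intro i
        induction i with
        | zero => exact fun _ => .refl _
        | succ i ih => exact fun hi => (ih (by omega)).trans (hstep i hi).reachable
      have hreach' : ∀ e, (junctionGraph G w v).Reachable ⟨_, hin 0 hpos⟩ e := by
        rintro ⟨e, he⟩
        obtain ⟨u, rfl⟩ := Sym2.mem_iff_exists.1 he.2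
        obtain ⟨i, hi, rfl⟩ := (ht v).exists_eq ((G.mem_neighborFinset v u).2 he.1)
        exact hreach i hi
      rw [SimpleGraph.connected_iff]
      exact ⟨fun a b => (hreach' a).symm.trans (hreach' b), ⟨⟨_, hin 0 hpos⟩⟩⟩
  have hcost : (walkCost α w : ℝ) =
      ∑ v, tourCost (fun a b => (α.cost s(a, v) s(v, b) : ℝ)) (G.neighborFinset v).card (t v) := by
    have h1 := hsum (fun z => (α.cost (flagEdge z) (flagEdge (f z)) : ℝ)) (fun z hz => by
      simp only [hf.pairs.invol z hz]
      rw [α.cost_comm])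
    rw [hf.sum_eq ht α] at h1
    have h2 : (walkCost α w : ℝ) =
        ∑ k ∈ Finset.range ℓ, (α.cost (flagEdge ((g ∘ f)^[k] x)) (flagEdge (f ((g ∘ f)^[k] x))) : ℝ) := by
      rw [walkCost, NNReal.coe_sum, Finset.sum_range
        (fun k => (α.cost (flagEdge ((g ∘ f)^[k] x)) (flagEdge (f ((g ∘ f)^[k] x))) : ℝ)),
        -- The turn between traversals `i` and `i + 1` is the corner at `y (i + 1)`, whence the
        -- cyclic shift of the summation index.
        ← Equiv.sum_comp (Equiv.addRight (1 : Fin ℓ))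
        (fun k => (α.cost (flagEdge ((g ∘ f)^[k.1] x)) (flagEdge (f ((g ∘ f)^[k.1] x))) : ℝ))]
      refine Finset.sum_congr rfl fun k _ => ?_
      rw [hedge', hedge]
      rfl
    linarith
  refine ⟨hthread, fun ℓ' _ w' hw' => ?_⟩
  rw [← NNReal.coe_le_coe, hcost, walkCost_eq_sum]
  refine Finset.sum_le_sum fun v _ => ?_
  have hpos : 0 < (G.neighborFinset v).card := by have := hd v; omega
  -- The tour induced by the competitor can be started at any neighbor, here at the first one of `t
  -- v`, as `hopt` demands.
  obtain ⟨t', h1, h2, h3⟩ := hw'.exists_tour α (fun u => G.mem_neighborFinset v u)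
    ((ht v).maps 0 hpos)
  rw [← h3]
  exact hopt v t' h1 h2

end Flags

/-! ### The program

Variables: `0` is `n`, `1` the length of the walk, `2` is `n * n`; the others are local.
Arrays of natural numbers: `0` adjacency matrix, `1` output, `2` multiples of `n`, `3` corners,
`4` gluing, `5` heads of flags, `6` neighbors of the current vertex, `7` powers of two,
`8` multiples of the number of sets, `9` choices of the dynamic program.
Arrays of real numbers: `0` turn costs, `1` values of the dynamic program. -/

/-- The code of a flag. -/
def code (n v u : ℕ) (o : Bool) : ℕ := (if o then n * n else 0) + (v * n + u)

/-- The code of a flag. -/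
def enc {n : ℕ} (x : Fin n × Fin n × Bool) : ℕ := code n x.1 x.2.1 x.2.2

theorem row_lt {n v u : ℕ} (hv : v < n) (hu : u < n) : v * n + u < n * n := by nlinarith

theorem code_inj {n v u v' u' : ℕ} {o o' : Bool} (hv : v < n) (hu : u < n) (hv' : v' < n)
    (hu' : u' < n) : code n v u o = code n v' u' o' ↔ v = v' ∧ u = u' ∧ o = o' := by
  constructor
  · intro h
    have h1 := row_lt hv hu
    have h2 := row_lt hv' hu'
    have key : v * n + u = v' * n + u' → v = v' ∧ u = u' := by
      intro h
      have ha := congrArg (· / n) h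
      have hb := congrArg (· % n) h
      have hn : 0 < n := by omega
      simp only [Nat.mul_comm _ n, Nat.mul_add_div hn, Nat.div_eq_of_lt hu, Nat.div_eq_of_lt hu',
        Nat.mul_add_mod, Nat.mod_eq_of_lt hu, Nat.mod_eq_of_lt hu', Nat.add_zero] at ha hb
      exact ⟨ha, hb⟩
    cases o <;> cases o' <;> simp only [code, if_true, Bool.false_eq_true, if_false] at h
    · simpa using key (by omega)
    · omega
    · omega
    · simpa using key (by omega)
  · rintro ⟨rfl, rfl, rfl⟩
    rfl

theorem enc_inj {n : ℕ} {x y : Fin n × Fin n × Bool} : enc x = enc y ↔ x = y := by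
  rw [enc, enc, code_inj x.1.2 x.2.1.2 y.1.2 y.2.1.2, Fin.val_inj, Fin.val_inj, Prod.ext_iff,
    Prod.ext_iff]

open NExpr Program

/-- Store the multiples of the variable `y` in the array `a`. -/
def multiples (a b y : ℕ) : Program :=
  seq (set 7 (const 0))
    (forTo 4 b (seq (store a (.var 4) (.var 7)) (set 7 (add (.var 7) (.var y)))))

/-- Compute `n * n`. -/
def square : Program :=
  seq (set 2 (const 0)) (forTo 3 0 (set 2 (add (.var 2) (.var 0))))

/-- The index of the cell in the row `v` and the column `u`. -/
abbrev cell (v u : NExpr) : NExpr := add (get 2 v) u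

/-- Initially all edges are glued in parallel: `(v, u, o)` is the partner of `(u, v, o)`. Non-edges
are treated alike, which is harmless. -/
def glueCell : Program :=
  seq (store 4 (cell (.var 3) (.var 4)) (cell (.var 4) (.var 3)))
    (seq (store 4 (add (.var 2) (cell (.var 3) (.var 4))) (add (.var 2) (cell (.var 4) (.var 3))))
    (seq (store 5 (cell (.var 3) (.var 4)) (.var 3))
      (store 5 (add (.var 2) (cell (.var 3) (.var 4))) (.var 3))))

/-- Initialize the gluing and the heads. -/
def glue : Program := forTo 3 0 (forTo 4 0 glueCell)

def setup : Program := seq square (seq (multiples 2 2 0) glue)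

/-- List the neighbors of the vertex `3`, and count them in the variable `5`. -/
def listNeighbors : Program :=
  seq (set 5 (const 0)) (forTo 4 0
    (.ite (.le (const 1) (get 0 (cell (.var 3) (.var 4))))
      (seq (store 6 (.var 5) (.var 4)) (set 5 (add (.var 5) (const 1)))) skip))

/-- Compute powers of two. -/
def powers : Program :=
  seq (set 6 (const 1)) (forTo 4 5
    (seq (store 7 (.var 4) (.var 6)) (set 6 (add (.var 6) (.var 6)))))

/-- The cost of passing through the vertex `3` from the neighbor `j` to the neighbor `k`. -/
abbrev turnExpr (j k : NExpr) : RExpr := .get 0 (cell (cell (get 6 j) (.var 3)) (get 6 k))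

/-- The index of the entry for the last neighbor `j` and the set `S`. -/
abbrev entry (j S : NExpr) : NExpr := add (get 8 j) S

/-- The candidate for the entry for the neighbor `9` and the set `8` that goes on to `12`. -/
abbrev candidate : RExpr :=
  .add (turnExpr (.var 9) (.var 12)) (.get 1 (entry (.var 12) (sub (.var 8) (get 7 (.var 12)))))

/-- Compare the current value of an entry with a candidate. -/
def relax : Program :=
  seq
    -- Variable `10` holds the set shifted by the loop index, and its difference from twice its half
    -- is its lowest bit. Variable `11` is `0` until a candidate has been found: the first one is
    -- always accepted, as no infinite initial value is available.
    (.ite (.le (const 1) (sub (.var 10) (add (half (.var 10)) (half (.var 10)))))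
      (.ite (.not (.and (.le (const 1) (.var 11))
          (.rle (.get 1 (entry (.var 9) (.var 8))) candidate)))
        (seq (rstore 1 (entry (.var 9) (.var 8)) candidate)
          (seq (store 9 (entry (.var 9) (.var 8)) (.var 12)) (set 11 (const 1)))) skip) skip)
    (set 10 (half (.var 10)))

/-- Compute the entry for the neighbor `9` and the set `8`. -/
def fillEntry : Program :=
  seq (seq (set 10 (.var 8)) (seq (set 11 (const 0))
    (seq (rstore 1 (entry (.var 9) (.var 8)) (turnExpr (.var 9) (const 0)))
      (store 9 (entry (.var 9) (.var 8)) (const 0)))))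
    (forTo 12 5 relax)

/-- Sets are processed in the order of their codes. Removing an element decreases the code, so all
entries needed are already present. -/
def fillTable : Program := forTo 8 6 (forTo 9 5 fillEntry)

/-- One step of the tour. -/
def tourPart : Program :=
  seq (set 10 (get 9 (entry (.var 9) (.var 8))))
  (seq (store 3 (cell (.var 3) (get 6 (.var 9)))
    (add (.var 2) (cell (.var 3) (get 6 (.var 10)))))
  (seq (store 3 (add (.var 2) (cell (.var 3) (get 6 (.var 10))))
    (cell (.var 3) (get 6 (.var 9))))
  (seq (set 8 (sub (.var 8) (get 7 (.var 10)))) (set 9 (.var 10)))))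

def readTour : Program :=
  seq (seq (set 8 (sub (.var 6) (const 2))) (set 9 (const 0))) (forTo 12 5 tourPart)

def vertexTour : Program :=
  seq listNeighbors (seq powers (seq (multiples 8 5 6) (seq fillTable readTour)))

def tours : Program := forTo 3 0 vertexTour

/-- Test for equality. -/
abbrev eqTest (e e' : NExpr) : BExpr := .and (.le e e') (.le e' e)

/-- One step of the walk. -/
abbrev walkStep : Program := set 4 (get 4 (get 3 (.var 4)))

/-- One step of the walk of the flag `3`, and a comparison with the flags on the other side. -/
def traceStep : Program :=
  seq walkStep
    (.ite (.and (.not (eqTest (.var 4) (add (.var 3) (.var 2))))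
      (.not (eqTest (.var 4) (get 4 (add (.var 3) (.var 2)))))) skip (set 5 (const 1)))

/-- Trace the walk of the flag `3`, and note in the variable `5` whether it meets the other side. -/
def traceWalk : Program :=
  seq (seq (set 4 (.var 3)) (set 5 (const 0))) (forTo 6 13 traceStep)

/-- Exchange the ends of the edge of the flag `3`. -/
def flip : Program :=
  seq (set 7 (get 4 (.var 3))) (seq (set 8 (get 4 (add (.var 3) (.var 2))))
  (seq (store 4 (.var 3) (.var 8)) (seq (store 4 (.var 8) (.var 3))
  (seq (store 4 (add (.var 3) (.var 2)) (.var 7)) (store 4 (.var 7) (add (.var 3) (.var 2)))))))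

/-- Variable `13` is `2 * n * n`, an upper bound for the number of flags and hence for the period of
a walk. The cells of the adjacency matrix index the flags of side `false`. -/
def merge : Program :=
  seq (set 13 (add (.var 2) (.var 2)))
    (forTo 3 2 (.ite (.le (const 1) (get 0 (.var 3)))
      (seq traceWalk (.ite (.le (const 1) (.var 5)) skip flip)) skip))

/-- Count the edges in the variable `1`, and choose a flag in the variable `4`. -/
def countEdges : Program :=
  seq (seq (set 1 (const 0)) (set 4 (const 0)))
    (forTo 3 2 (.ite (.le (const 1) (get 0 (.var 3)))
      (seq (set 1 (add (.var 1) (const 1))) (set 4 (.var 3))) skip))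

def writeWalk : Program :=
  forTo 3 1 (seq (store 1 (.var 3) (get 5 (.var 4))) walkStep)

/-- The program for Exactly-Double Threading. -/
def threadingProgram : Program :=
  seq setup (seq tours (seq merge (seq countEdges writeWalk)))

/-! ### Setup -/

variable {n : ℕ}

/-- The input, `n * n`, and the multiples of `n` are in memory. -/
structure Ready (G : SimpleGraph (Fin n)) (α : TurnCost G) (s : State) : Prop where
  var_zero : s.var 0 = n
  var_two : s.var 2 = n * n
  arr_zero : s.arr 0 = (inputState G α).arr 0
  real_zero : s.real 0 = (inputState G α).real 0
  arr_two : ∀ i < n * n, s.arr 2 i = i * n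

theorem Ready.of_frame {G : SimpleGraph (Fin n)} {α : TurnCost G} {P : Program} {s s' : State}
    (h : Ready G α s) (hf : P.Frame s s') (h0 : P.keepsVar 0 = true) (h2 : P.keepsVar 2 = true)
    (h0' : P.keepsArr 0 = true) (h2' : P.keepsArr 2 = true) (h0'' : P.keepsReal 0 = true) :
    Ready G α s' :=
  ⟨by rw [hf.var 0 h0, h.var_zero], by rw [hf.var 2 h2, h.var_two], by rw [hf.arr 0 h0', h.arr_zero],
    by rw [hf.real 0 h0'', h.real_zero], by rw [hf.arr 2 h2']; exact h.arr_two⟩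

theorem lt_sq {n v : ℕ} (hv : v < n) : v < n * n := by nlinarith

theorem Ready.arr_cell {G : SimpleGraph (Fin n)} {α : TurnCost G} {s : State}
    (h : Ready G α s) {v : ℕ} (hv : v < n) : s.arr 2 v = v * n :=
  h.arr_two v (lt_sq hv)

theorem Ready.adj {G : SimpleGraph (Fin n)} {α : TurnCost G} {s : State}
    (h : Ready G α s) (v u : Fin n) : 1 ≤ s.arr 0 (v * n + u) ↔ G.Adj v u := by
  have hn : 0 < n := v.pos
  have h1 : (v * n + u : ℕ) / n = v := by
    rw [Nat.mul_comm, Nat.mul_add_div hn, Nat.div_eq_of_lt u.2, Nat.add_zero]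
  have h2 : (v * n + u : ℕ) % n = u := by
    rw [Nat.mul_comm, Nat.mul_add_mod, Nat.mod_eq_of_lt u.2]
  rw [h.arr_zero]
  change 1 ≤ adjEntry G ((v * n + u : ℕ) / n) ((v * n + u : ℕ) % n) ↔ _
  rw [h1, h2, adjEntry]
  by_cases hadj : G.Adj v u <;> simp [hadj]

theorem Ready.cost {G : SimpleGraph (Fin n)} {α : TurnCost G} {s : State}
    (h : Ready G α s) (u v w : Fin n) :
    s.real 0 ((u * n + v) * n + w) = (α.cost s(u, v) s(v, w) : ℝ) := by
  have hn : 0 < n := v.pos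
  have h1 : ((u * n + v) * n + w : ℕ) / n = u * n + v := by
    rw [Nat.mul_comm, Nat.mul_add_div hn, Nat.div_eq_of_lt w.2, Nat.add_zero]
  have h2 : ((u * n + v) * n + w : ℕ) % n = w := by
    rw [Nat.mul_comm, Nat.mul_add_mod, Nat.mod_eq_of_lt w.2]
  have h3 : (u * n + v : ℕ) / n = u := by
    rw [Nat.mul_comm, Nat.mul_add_div hn, Nat.div_eq_of_lt v.2, Nat.add_zero]
  have h4 : (u * n + v : ℕ) % n = v := by
    rw [Nat.mul_comm, Nat.mul_add_mod, Nat.mod_eq_of_lt v.2]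
  rw [h.real_zero]
  simp [inputState, h1, h2, h3, h4, costEntry]

theorem multiples_ends {s : State} {a b y m c : ℕ} (hb : s.var b = m) (hy : s.var y = c)
    (hb4 : b ≠ 4) (hb7 : b ≠ 7) (hy4 : y ≠ 4) (hy7 : y ≠ 7) :
    Ends (multiples a b y) s (m * 15 + 8) fun s' => ∀ i < m, s'.arr a i = i * c := by
  refine Ends.mono (B := 2 + (m * (7 + 8) + 6)) (Ends.seq (Q := fun s' => s'.var 7 = 0)
    (Ends.block rfl le_rfl fun _ => by simp [exec, eval]) fun s₁ hf h7 => ?_) (by omega)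
    fun _ _ h => h
  have hb₁ : s₁.var b = m := by rw [hf.var b (by simpa [keepsVar] using hb7), hb]
  have hy₁ : s₁.var y = c := by rw [hf.var y (by simpa [keepsVar] using hy7), hy]
  refine Ends.forTo (fun k s' => s'.var 7 = k * c ∧ ∀ i < k, s'.arr a i = i * c) hb₁ hb4 rfl
    (by simpa [keepsVar] using hb7) (by simp [h7]) ?_ fun _ _ h => h.2
  rintro k - s₂ hf₂ hk - ⟨h₁, h₂⟩
  have hy₂ : s₂.var y = c := by
    rw [hf₂.var y (by simp [keepsVar, forTo, hy4, hy7]), hy₁]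
  refine Ends.block rfl (by simp [maxSteps, size]) fun _ => ?_
  simp only [exec, eval, hk, h₁, State.setArr_var, State.setVar_var, State.setVar_arr,
    State.setArr_arr, hy₂, if_true]
  refine ⟨by simp; ring, fun i hi => ?_⟩
  rw [Function.update_apply]
  split_ifs with h
  · rw [h]
  · exact h₂ i (by omega)

theorem square_ends {s : State} (hs : s.var 0 = n) :
    Ends square s (n * 12 + 8) fun s' => s'.var 2 = n * n := by
  refine Ends.mono (B := 2 + (n * (4 + 8) + 6)) (Ends.seq (Q := fun s' => s'.var 2 = 0)
    (Ends.block rfl le_rfl fun _ => by simp [exec, eval]) fun s₁ hf h2 => ?_) (by omega)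
    fun _ _ h => h
  have h0 : s₁.var 0 = n := by rw [hf.var 0 rfl, hs]
  refine Ends.forTo (fun k s' => s'.var 2 = k * n) h0 (by decide) rfl rfl (by simp [h2]) ?_
    fun _ _ h => h
  rintro k - s₂ hf₂ hk hn h
  refine Ends.block rfl (by simp [maxSteps, size]) fun _ => ?_
  simp [exec, eval, h, hn]
  ring

/-- The initial gluing and the heads are in memory. -/
def GlueRow (n : ℕ) (s : State) (v u : ℕ) : Prop :=
  ∀ o, s.arr 4 (code n v u o) = code n u v o ∧ s.arr 5 (code n v u o) = v

theorem glue_ends {G : SimpleGraph (Fin n)} {α : TurnCost G} {s : State} (hs : Ready G α s) :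
    Ends glue s (n * (n * 48 + 14) + 6) fun s' => ∀ v < n, ∀ u < n, GlueRow n s' v u := by
  refine Ends.mono (B := n * ((n * (40 + 8) + 6) + 8) + 6) (Ends.forTo
    (fun k s' => ∀ v < k, ∀ u < n, GlueRow n s' v u) hs.var_zero (by decide) rfl rfl (by simp) ?_
    fun _ _ h => h) (by nlinarith) fun _ _ h => h
  intro v hv s₁ hf₁ hv₁ hn₁ h₁
  have hs₁ := hs.of_frame hf₁ rfl rfl rfl rfl rfl
  refine Ends.forTo (fun k s' => (∀ v' < v, ∀ u < n, GlueRow n s' v' u) ∧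
    ∀ u < k, GlueRow n s' v u) hn₁ (by decide) rfl rfl ⟨h₁, by simp⟩ ?_ ?_
  · rintro u hu s₂ hf₂ hu₂ hn₂ ⟨h₂, h₃⟩
    have hs₂ := hs₁.of_frame hf₂ rfl rfl rfl rfl rfl
    have hv₂ : s₂.var 3 = v := by rw [hf₂.var 3 rfl, hv₁]
    refine Ends.block rfl (by decide) fun _ => ?_
    have e4 : (glueCell.exec s₂).arr 4 = Function.update (Function.update (s₂.arr 4)
        (code n v u false) (code n u v false)) (code n v u true) (code n u v true) := by
      simp [glueCell, exec, eval, hv₂, hu₂, hs₂.arr_cell hv, hs₂.arr_cell hu, hs₂.var_two, code]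
    have e5 : (glueCell.exec s₂).arr 5 = Function.update (Function.update (s₂.arr 5)
        (code n v u false) v) (code n v u true) v := by
      simp [glueCell, exec, eval, hv₂, hu₂, hs₂.arr_cell hv, hs₂.var_two, code]
    have hupd : ∀ v' < n, ∀ u' < n, ((v' = v ∧ u' = u) ∨ GlueRow n s₂ v' u') →
        GlueRow n (State.setVar (exec glueCell s₂) 4 (u + 1)) v' u' := ?_
    refine ⟨fun v' hv' u' hu' => hupd v' (by omega) u' hu' (.inr (h₂ v' hv' u' hu')),
      fun u' hu' => ?_⟩
    · rcases Nat.lt_or_eq_of_le (Nat.lt_succ_iff.1 hu') with h | h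
      · exact hupd v hv u' (by omega) (.inr (h₃ u' h))
      · exact hupd v hv u' (by omega) (.inl ⟨rfl, h⟩)
    · intro v' hv' u' hu' h o
      simp only [State.setVar_arr, e4, e5, Function.update_apply, code_inj hv' hu' hv hu]
      rcases h with ⟨rfl, rfl⟩ | h
      · cases o <;> simp
      · by_cases h' : v' = v ∧ u' = u
        · obtain ⟨rfl, rfl⟩ := h'
          cases o <;> simp
        · rw [if_neg (by tauto), if_neg (by tauto), if_neg (by tauto), if_neg (by tauto)]
          exact h o
  · rintro s' - ⟨h₂, h₃⟩ v' hv' u hu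
    rcases Nat.lt_or_eq_of_le (Nat.lt_succ_iff.1 hv') with h | rfl
    · exact h₂ v' h u hu
    · exact h₃ u hu

theorem setup_ends (G : SimpleGraph (Fin n)) (α : TurnCost G) :
    Ends setup (inputState G α) (63 * n * n + 26 * n + 22) fun s =>
      Ready G α s ∧ ∀ v < n, ∀ u < n, GlueRow n s v u := by
  refine Ends.mono (B := (n * 12 + 8) + ((n * n * 15 + 8) + (n * (n * 48 + 14) + 6)))
    (Ends.seq (square_ends (by simp [inputState])) fun s₁ hf₁ h₁ => Ends.seq
      (multiples_ends h₁ (hf₁.var 0 rfl) (by decide) (by decide) (by decide) (by decide))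
      fun s₂ hf₂ h₂ => ?_) (by nlinarith) fun _ _ h => h
  have hs : Ready G α s₂ := by
    refine ⟨?_, ?_, ?_, ?_, ?_⟩
    · rw [hf₂.var 0 rfl, hf₁.var 0 rfl]; simp [inputState]
    · rw [hf₂.var 2 rfl, h₁]
    · rw [hf₂.arr 0 rfl, hf₁.arr 0 rfl]
    · rw [hf₂.real 0 rfl, hf₁.real 0 rfl]
    · intro i hi
      rw [h₂ i hi]
      simp [inputState]
  exact (glue_ends hs).mono le_rfl fun s₃ hf₃ h₃ => ⟨hs.of_frame hf₃ rfl rfl rfl rfl rfl, h₃⟩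

/-! ### Tours -/

theorem listNeighbors_ends {G : SimpleGraph (Fin n)} [DecidableRel G.Adj] {α : TurnCost G}
    {s : State} (hs : Ready G α s) {v : Fin n} (hv : s.var 3 = v) :
    Ends listNeighbors s (n * 24 + 8) fun s' => s'.var 5 = (G.neighborFinset v).card ∧
      ∃ nb : ℕ → Fin n, (∀ i < (G.neighborFinset v).card, s'.arr 6 i = nb i) ∧
        (∀ i < (G.neighborFinset v).card, nb i ∈ G.neighborFinset v) ∧
        Set.InjOn nb (Finset.range (G.neighborFinset v).card) := by
  refine Ends.mono (B := 2 + (n * (16 + 8) + 6)) (Ends.seq (Q := fun s' => s'.var 5 = 0)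
    (Ends.block rfl le_rfl fun _ => by simp [exec, eval]) fun s₁ hf h5 => ?_) (by omega)
    fun _ _ h => h
  have hs₁ := hs.of_frame hf rfl rfl rfl rfl rfl
  have hv₁ : s₁.var 3 = v := by rw [hf.var 3 rfl, hv]
  -- The bound `u < k` on the listed neighbors makes the next one different from all of them.
  refine Ends.forTo (fun k s' =>
    (∀ i < s'.var 5, ∃ u : Fin n, s'.arr 6 i = u ∧ G.Adj v u ∧ u < k) ∧
    (∀ i < s'.var 5, ∀ j < s'.var 5, s'.arr 6 i = s'.arr 6 j → i = j) ∧
    ∀ u : Fin n, u < k → G.Adj v u → ∃ i < s'.var 5, s'.arr 6 i = u)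
    hs₁.var_zero (by decide) rfl rfl (by simp [h5]) ?_ ?_
  · rintro k hk s₂ hf₂ hk₂ - ⟨h₁, h₂, h₃⟩
    have hs₂ := hs₁.of_frame hf₂ rfl rfl rfl rfl rfl
    have hv₂ : s₂.var 3 = v := by rw [hf₂.var 3 rfl, hv₁]
    have hadj := hs₂.adj v ⟨k, hk⟩
    refine Ends.mono (B := 7 + 9) (Ends.ite (B := 9) (fun h => ?_) (fun h => ?_)) le_rfl
      fun _ _ h => h
    · have h : G.Adj v ⟨k, hk⟩ := by
        rw [← hadj]
        simpa [BExpr.Holds, eval, hv₂, hk₂, hs₂.arr_cell v.2] using h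
      refine Ends.block rfl (by decide) fun _ => ?_
      have e5 : ((exec ((store 6 (.var 5) (.var 4)).seq
          (set 5 (add (.var 5) (const 1)))) s₂).setVar 4 (k + 1)).var 5 = s₂.var 5 + 1 := by
        simp [exec, eval]
      have e6 : ((exec ((store 6 (.var 5) (.var 4)).seq
          (set 5 (add (.var 5) (const 1)))) s₂).setVar 4 (k + 1)).arr 6 =
          Function.update (s₂.arr 6) (s₂.var 5) k := by
        simp [exec, eval, hk₂]
      rw [e5, e6]
      refine ⟨fun i hi => ?_, fun i hi j hj hij => ?_, fun u hu hvu => ?_⟩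
      · rcases Nat.lt_or_eq_of_le (Nat.lt_succ_iff.1 hi) with hi | rfl
        · obtain ⟨u, h1, h2, h3⟩ := h₁ i hi
          exact ⟨u, by rw [Function.update_of_ne hi.ne, h1], h2, by omega⟩
        · exact ⟨⟨k, hk⟩, by simp, h, by simp⟩
      · rcases Nat.lt_or_eq_of_le (Nat.lt_succ_iff.1 hi) with hi | rfl <;>
        rcases Nat.lt_or_eq_of_le (Nat.lt_succ_iff.1 hj) with hj | rfl
        · rw [Function.update_of_ne hi.ne, Function.update_of_ne hj.ne] at hij
          exact h₂ i hi j hj hij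
        · rw [Function.update_of_ne hi.ne, Function.update_self] at hij
          obtain ⟨u, h1, -, h3⟩ := h₁ i hi
          omega
        · rw [Function.update_of_ne hj.ne, Function.update_self] at hij
          obtain ⟨u, h1, -, h3⟩ := h₁ j hj
          omega
        · rfl
      · rcases Nat.lt_or_eq_of_le (Nat.lt_succ_iff.1 hu) with hu | hu
        · obtain ⟨i, hi, h⟩ := h₃ u hu hvu
          exact ⟨i, by omega, by rw [Function.update_of_ne hi.ne, h]⟩
        · exact ⟨s₂.var 5, by omega, by simp [hu]⟩
    · have h : ¬ G.Adj v ⟨k, hk⟩ := by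
        rw [← hadj]
        simpa [BExpr.Holds, eval, hv₂, hk₂, hs₂.arr_cell v.2] using h
      refine Ends.block rfl (by decide) fun _ => ?_
      simp only [exec, State.setVar_var, State.setVar_arr]
      refine ⟨fun i hi => ?_, h₂, fun u hu hvu => ?_⟩
      · obtain ⟨u, h1, h2, h3⟩ := h₁ i hi
        exact ⟨u, h1, h2, by omega⟩
      · rcases Nat.lt_or_eq_of_le (Nat.lt_succ_iff.1 hu) with hu | hu
        · exact h₃ u hu hvu
        · exact absurd (show G.Adj v ⟨k, hk⟩ from by
            have : u = ⟨k, hk⟩ := Fin.ext hu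
            rwa [← this]) h
  · rintro s' - ⟨h₁, h₂, h₃⟩
    have : ∀ i, ∃ u : Fin n, i < s'.var 5 → s'.arr 6 i = u ∧ G.Adj v u := by
      intro i
      by_cases hi : i < s'.var 5
      · obtain ⟨u, h1, h2, -⟩ := h₁ i hi
        exact ⟨u, fun _ => ⟨h1, h2⟩⟩
      · exact ⟨v, fun h => absurd h hi⟩
    choose nb hnb using this
    have hinj : Set.InjOn nb (Finset.range (s'.var 5)) := by
      intro i hi j hj hij
      simp only [Finset.coe_range, Set.mem_Iio] at hi hj
      exact h₂ i hi j hj (by rw [(hnb i hi).1, (hnb j hj).1, hij])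
    have hcard : s'.var 5 = (G.neighborFinset v).card := by
      have : (Finset.range (s'.var 5)).image nb = G.neighborFinset v := by
        ext u
        simp only [Finset.mem_image, Finset.mem_range, SimpleGraph.mem_neighborFinset]
        constructor
        · rintro ⟨i, hi, rfl⟩
          exact (hnb i hi).2
        · intro hu
          obtain ⟨i, hi, h⟩ := h₃ u u.2 hu
          exact ⟨i, hi, Fin.ext (by rw [← (hnb i hi).1, h])⟩
      rw [← this, Finset.card_image_of_injOn hinj, Finset.card_range]
    rw [← hcard]
    exact ⟨rfl, nb, fun i hi => (hnb i hi).1,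
      fun i hi => (G.mem_neighborFinset v _).2 (hnb i hi).2, hinj⟩

theorem powers_ends {s : State} {d : ℕ} (hd : s.var 5 = d) :
    Ends powers s (d * 15 + 8) fun s' => s'.var 6 = 2 ^ d ∧ ∀ i < d, s'.arr 7 i = 2 ^ i := by
  refine Ends.mono (B := 2 + (d * (7 + 8) + 6)) (Ends.seq (Q := fun s' => s'.var 6 = 1)
    (Ends.block rfl le_rfl fun _ => by simp [exec, eval]) fun s₁ hf h6 => ?_) (by omega)
    fun _ _ h => h
  refine Ends.forTo (fun k s' => s'.var 6 = 2 ^ k ∧ ∀ i < k, s'.arr 7 i = 2 ^ i)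
    (by rw [hf.var 5 rfl, hd]) (by decide) rfl rfl (by simp [h6]) ?_ fun _ _ h => h
  rintro k - s₂ hf₂ hk - ⟨h₁, h₂⟩
  refine Ends.block rfl (by decide) fun _ => ?_
  simp only [exec, eval, hk, h₁, State.setArr_var, State.setVar_var, State.setVar_arr,
    State.setArr_arr, if_true]
  refine ⟨by simp; ring, fun i hi => ?_⟩
  rw [Function.update_apply]
  split_ifs with h
  · rw [h]
  · exact h₂ i (by omega)

/-! ### The Held–Karp table in memory -/

/-- The data of the dynamic program for the vertex `v` with the neighbors `nb 0, …, nb (d - 1)`. -/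
structure Prepared (G : SimpleGraph (Fin n)) (α : TurnCost G) (v : Fin n) (d : ℕ)
    (nb : ℕ → Fin n) (s : State) : Prop extends Ready G α s where
  vertex : s.var 3 = v
  degree : s.var 5 = d
  sets : s.var 6 = 2 ^ d
  nbr : ∀ i < d, s.arr 6 i = nb i
  power : ∀ i < d, s.arr 7 i = 2 ^ i
  row : ∀ i < d, s.arr 8 i = i * 2 ^ d

theorem Prepared.of_frame {G : SimpleGraph (Fin n)} {α : TurnCost G} {v : Fin n} {d : ℕ}
    {nb : ℕ → Fin n} {P : Program} {s s' : State} (h : Prepared G α v d nb s) (hf : P.Frame s s')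
    (hv : P.keepsVar 0 = true ∧ P.keepsVar 2 = true ∧ P.keepsVar 3 = true ∧ P.keepsVar 5 = true ∧
      P.keepsVar 6 = true)
    (ha : P.keepsArr 0 = true ∧ P.keepsArr 2 = true ∧ P.keepsArr 6 = true ∧ P.keepsArr 7 = true ∧
      P.keepsArr 8 = true) (hr : P.keepsReal 0 = true) : Prepared G α v d nb s' where
  toReady := h.toReady.of_frame hf hv.1 hv.2.1 ha.1 ha.2.1 hr
  vertex := by rw [hf.var 3 hv.2.2.1, h.vertex]
  degree := by rw [hf.var 5 hv.2.2.2.1, h.degree]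
  sets := by rw [hf.var 6 hv.2.2.2.2, h.sets]
  nbr := by rw [hf.arr 6 ha.2.2.1]; exact h.nbr
  power := by rw [hf.arr 7 ha.2.2.2.1]; exact h.power
  row := by rw [hf.arr 8 ha.2.2.2.2]; exact h.row

/-- The index of an entry of the dynamic program. -/
def entryIndex (d j S : ℕ) : ℕ := j * 2 ^ d + S

theorem entryIndex_inj {d j S j' S' : ℕ} (hS : S < 2 ^ d) (hS' : S' < 2 ^ d) :
    entryIndex d j S = entryIndex d j' S' ↔ j = j' ∧ S = S' := by
  constructor
  · intro h
    have ha := congrArg (· / 2 ^ d) h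
    have hb := congrArg (· % 2 ^ d) h
    simp only [entryIndex, Nat.mul_comm _ (2 ^ d), Nat.mul_add_div (Nat.two_pow_pos d),
      Nat.div_eq_of_lt hS, Nat.div_eq_of_lt hS', Nat.mul_add_mod, Nat.mod_eq_of_lt hS,
      Nat.mod_eq_of_lt hS', Nat.add_zero] at ha hb
    exact ⟨ha, hb⟩
  · rintro ⟨rfl, rfl⟩
    rfl

/-- The cost of passing through `v` from the neighbor `j` to the neighbor `k`. -/
noncomputable def nbrCost {G : SimpleGraph (Fin n)} (α : TurnCost G) (v : Fin n) (nb : ℕ → Fin n)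
    (j k : ℕ) : ℝ := (α.cost s(nb j, v) s(v, nb k) : ℝ)

namespace Prepared

variable {G : SimpleGraph (Fin n)} {α : TurnCost G} {v : Fin n} {d : ℕ} {nb : ℕ → Fin n}
  {s : State}

theorem eval_turn (h : Prepared G α v d nb s) {ej ek : NExpr} {j k : ℕ} (hj : ej.eval s = j)
    (hk : ek.eval s = k) (hjd : j < d) (hkd : k < d) :
    (turnExpr ej ek).eval s = nbrCost α v nb j k := by
  have h1 : (nb j : ℕ) * n + v < n * n := row_lt (nb j).2 v.2
  simp only [RExpr.eval, eval, hj, hk, h.nbr j hjd, h.nbr k hkd, h.vertex,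
    h.arr_cell (nb j).2, h.arr_two _ h1]
  exact h.cost _ _ _

theorem eval_entry (h : Prepared G α v d nb s) {ej eS : NExpr} {j S : ℕ} (hj : ej.eval s = j)
    (hS : eS.eval s = S) (hjd : j < d) : (entry ej eS).eval s = entryIndex d j S := by
  simp only [eval, hj, hS, h.row j hjd, entryIndex]

theorem eval_candidate (h : Prepared G α v d nb s) {j k S : ℕ} (hj : s.var 9 = j)
    (hS : s.var 8 = S) (hk : s.var 12 = k) (hjd : j < d) (hkd : k < d) :
    candidate.eval s = nbrCost α v nb j k + s.real 1 (entryIndex d k (S - 2 ^ k)) := by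
  rw [RExpr.eval, h.eval_turn (ej := .var 9) (ek := .var 12) hj hk hjd hkd, RExpr.eval,
    h.eval_entry (ej := .var 12) (j := k) (S := S - 2 ^ k) hk (by simp [eval, hS, hk, h.power k hkd]) hkd]

end Prepared

theorem testBit_lt_self {S k : ℕ} (hk : S.testBit k = true) : S - 2 ^ k < S := by
  have := Nat.ge_two_pow_of_testBit hk
  have := Nat.two_pow_pos k
  omega

/-- An entry refers only to entries of sets with smaller codes, so completed entries survive the
filling of later ones. -/
theorem IsTable.congr {d : ℕ} {c : ℕ → ℕ → ℝ} {D D' : ℕ → ℕ → ℝ} {C C' : ℕ → ℕ → ℕ} {S j : ℕ}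
    (h : IsTable d c D C S j) (hD : D' j S = D j S) (hC : C' j S = C j S)
    (hlow : ∀ k < d, ∀ S' < S, D' k S' = D k S') : IsTable d c D' C' S j := by
  refine ⟨fun h0 => ?_, fun h0 => ?_, fun k hk hb => ?_⟩
  · rw [hD, hC]; exact h.zero h0
  · obtain ⟨h1, h2, h3⟩ := h.choice h0
    rw [hD, hC, hlow _ h1 _ (testBit_lt_self h2)]
    exact ⟨h1, h2, h3⟩
  · rw [hD, hlow k hk _ (testBit_lt_self hb)]
    exact h.le k hk hb

/-- The values of the dynamic program in memory. -/
def valueTable (d : ℕ) (s : State) (j S : ℕ) : ℝ := s.real 1 (entryIndex d j S)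

/-- The choices of the dynamic program in memory. -/
def choiceTable (d : ℕ) (s : State) (j S : ℕ) : ℕ := s.arr 9 (entryIndex d j S)

/-- The entry for `j` and `S` takes into account all successors that are less than `k`. -/
structure Relaxed (d : ℕ) (c : ℕ → ℕ → ℝ) (D : ℕ → ℕ → ℝ) (S j k : ℕ) (x : ℝ) (a found : ℕ) :
    Prop where
  start : found = 0 → (∀ i < k, S.testBit i = false) ∧ a = 0 ∧ x = c j 0
  found_eq : found ≠ 0 → a < k ∧ S.testBit a = true ∧ x = c j a + D a (S - 2 ^ a) ∧
    ∀ i < k, S.testBit i = true → x ≤ c j i + D i (S - 2 ^ i)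

theorem Relaxed.skip {d : ℕ} {c : ℕ → ℕ → ℝ} {D : ℕ → ℕ → ℝ} {S j k : ℕ} {x : ℝ} {a found : ℕ}
    (h : Relaxed d c D S j k x a found)
    (hk : S.testBit k = true → found ≠ 0 ∧ x ≤ c j k + D k (S - 2 ^ k)) :
    Relaxed d c D S j (k + 1) x a found := by
  refine ⟨fun h0 => ?_, fun h0 => ?_⟩
  · obtain ⟨h1, h2⟩ := h.start h0
    refine ⟨fun i hi => ?_, h2⟩
    rcases Nat.lt_or_eq_of_le (Nat.lt_succ_iff.1 hi) with hi | rfl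
    · exact h1 i hi
    · by_contra hb
      exact (hk (by simpa using hb)).1 h0
  · obtain ⟨h1, h2, h3, h4⟩ := h.found_eq h0
    refine ⟨by omega, h2, h3, fun i hi hb => ?_⟩
    rcases Nat.lt_or_eq_of_le (Nat.lt_succ_iff.1 hi) with hi | rfl
    · exact h4 i hi hb
    · exact (hk hb).2

/-- Either no candidate came before, or the new one is less than the current value and thus less
than all earlier candidates. -/
theorem Relaxed.update {d : ℕ} {c : ℕ → ℕ → ℝ} {D : ℕ → ℕ → ℝ} {S j k : ℕ} {x : ℝ} {a found : ℕ}
    (h : Relaxed d c D S j k x a found) (hb : S.testBit k = true)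
    (hk : ¬ (found ≠ 0 ∧ x ≤ c j k + D k (S - 2 ^ k))) :
    Relaxed d c D S j (k + 1) (c j k + D k (S - 2 ^ k)) k 1 := by
  refine ⟨fun h0 => by omega, fun _ => ⟨by omega, hb, rfl, fun i hi hib => ?_⟩⟩
  rcases Nat.lt_or_eq_of_le (Nat.lt_succ_iff.1 hi) with hi | rfl
  · by_cases h0 : found = 0
    · have := (h.start h0).1 i hi
      simp [hib] at this
    · have := (h.found_eq h0).2.2.2 i hi hib
      by_contra hlt
      exact hk ⟨h0, by linarith⟩
  · exact le_rfl

/-- If no successor was found, the set is empty, and the initial contents of the entry are exactly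
the base case. -/
theorem Relaxed.isTable {d : ℕ} {c : ℕ → ℕ → ℝ} {D D' : ℕ → ℕ → ℝ} {S j : ℕ} (hS : S < 2 ^ d)
    {C : ℕ → ℕ → ℕ} {found : ℕ} (h : Relaxed d c D S j d (D' j S) (C j S) found)
    (hlow : ∀ k < d, ∀ S' < S, D' k S' = D k S') : IsTable d c D' C S j := by
  have hnz : S ≠ 0 → found ≠ 0 := by
    intro h0 hf
    refine h0 (Nat.eq_of_testBit_eq fun i => ?_)
    rw [Nat.zero_testBit]
    rcases lt_or_ge i d with hi | hi
    · exact (h.start hf).1 i hi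
    · exact Nat.testBit_eq_false_of_lt (hS.trans_le (Nat.pow_le_pow_right (by norm_num) hi))
  refine ⟨fun h0 => ?_, fun h0 => ?_, fun k hk hb => ?_⟩
  · by_cases hf : found = 0
    · exact (h.start hf).2
    · have := (h.found_eq hf).2.1
      simp [h0] at this
  · obtain ⟨h1, h2, h3, -⟩ := h.found_eq (hnz h0)
    rw [hlow _ h1 _ (testBit_lt_self h2)]
    exact ⟨h1, h2, h3⟩
  · have h0 : S ≠ 0 := by
      rintro rfl
      simp at hb
    rw [hlow k hk _ (testBit_lt_self hb)]
    exact (h.found_eq (hnz h0)).2.2.2 k hk hb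

theorem relax_exec {G : SimpleGraph (Fin n)} {α : TurnCost G} {v : Fin n} {d : ℕ}
    {nb : ℕ → Fin n} {s : State} (h : Prepared G α v d nb s) {j k S : ℕ} (hj : s.var 9 = j)
    (hS : s.var 8 = S) (hk : s.var 12 = k) (hr : s.var 10 = S / 2 ^ k) (hjd : j < d)
    (hkd : k < d) :
    ((S.testBit k = true → s.var 11 ≠ 0 ∧
        valueTable d s j S ≤ nbrCost α v nb j k + valueTable d s k (S - 2 ^ k)) ∧
      relax.exec s = s.setVar 10 (S / 2 ^ (k + 1))) ∨
    (S.testBit k = true ∧ ¬ (s.var 11 ≠ 0 ∧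
        valueTable d s j S ≤ nbrCost α v nb j k + valueTable d s k (S - 2 ^ k)) ∧
      relax.exec s = (((s.setReal 1 (entryIndex d j S)
        (nbrCost α v nb j k + valueTable d s k (S - 2 ^ k))).setArr 9 (entryIndex d j S) k).setVar
          11 1).setVar 10 (S / 2 ^ (k + 1))) := by
  have hhalf : S / 2 ^ k / 2 = S / 2 ^ (k + 1) := by rw [Nat.div_div_eq_div_mul, pow_succ]
  have hodd : (BExpr.le (const 1) (sub (.var 10) (add (half (.var 10)) (half (.var 10))))).Holds s
      ↔ S.testBit k = true := by
    rw [Nat.testBit_eq_decide_div_mod_eq]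
    simp only [BExpr.Holds, eval, hr, decide_eq_true_eq]
    omega
  have hentry : (entry (.var 9) (.var 8)).eval s = entryIndex d j S := h.eval_entry hj hS hjd
  have hcand := h.eval_candidate hj hS hk hjd hkd
  have hcmp : (BExpr.not (.and (.le (const 1) (.var 11))
      (.rle (.get 1 (entry (.var 9) (.var 8))) candidate))).Holds s ↔ ¬ (s.var 11 ≠ 0 ∧
        valueTable d s j S ≤ nbrCost α v nb j k + valueTable d s k (S - 2 ^ k)) := by
    rw [BExpr.Holds, BExpr.Holds, BExpr.Holds, BExpr.Holds, hcand, RExpr.eval, hentry,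
      show (const 1).eval s = 1 from rfl, Nat.one_le_iff_ne_zero]
    rfl
  by_cases hb : S.testBit k = true
  · by_cases hc : s.var 11 ≠ 0 ∧
        valueTable d s j S ≤ nbrCost α v nb j k + valueTable d s k (S - 2 ^ k)
    · refine .inl ⟨fun _ => hc, ?_⟩
      simp only [relax, exec, if_pos (hodd.2 hb), if_neg (hcmp.not.2 (not_not.2 hc)), eval, hr,
        hhalf]
    · refine .inr ⟨hb, hc, ?_⟩
      simp only [relax, exec, if_pos (hodd.2 hb), if_pos (hcmp.2 hc)]
      rw [hcand, hentry,
        show (entry (.var 9) (.var 8)).eval (s.setReal 1 (entryIndex d j S)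
          (nbrCost α v nb j k + s.real 1 (entryIndex d k (S - 2 ^ k)))) = entryIndex d j S
          from hentry]
      simp [eval, hr, hhalf, hk, valueTable]
  · refine .inl ⟨fun h' => absurd h' hb, ?_⟩
    simp only [relax, exec, if_neg (hodd.not.2 hb), eval, hr, hhalf]

theorem fillEntry_ends {G : SimpleGraph (Fin n)} {α : TurnCost G} {v : Fin n} {d : ℕ}
    {nb : ℕ → Fin n} {s : State} (h : Prepared G α v d nb s) {j S : ℕ} (hj : s.var 9 = j)
    (hS : s.var 8 = S) (hjd : j < d) (hSd : S < 2 ^ d) :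
    Ends fillEntry s (d * 100 + 50) fun s' =>
      IsTable d (nbrCost α v nb) (valueTable d s') (choiceTable d s') S j ∧
      (∀ i ≠ entryIndex d j S, s'.real 1 i = s.real 1 i) ∧
      ∀ i ≠ entryIndex d j S, s'.arr 9 i = s.arr 9 i := by
  refine Ends.mono (B := 31 + (d * (relax.maxSteps + 8) + 6)) (Ends.seq
    (Q := fun s' => s'.var 10 = S ∧ s'.var 11 = 0 ∧
      s'.real 1 = Function.update (s.real 1) (entryIndex d j S) (nbrCost α v nb j 0) ∧
      s'.arr 9 = Function.update (s.arr 9) (entryIndex d j S) 0)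
    (Ends.block rfl (by decide) fun _ => ?_) fun s₁ hf₁ h₁ => ?_)
    (by have : relax.maxSteps ≤ 92 := by decide
        nlinarith) fun _ _ h => h
  · have hentry := h.eval_entry (ej := .var 9) (eS := .var 8) hj hS hjd
    have hturn := h.eval_turn (ej := .var 9) (ek := const 0) (k := 0) hj rfl hjd (by omega)
    have e : ∀ x k y k', (entry (.var 9) (.var 8)).eval ((s.setVar 10 x).setVar 11 k) =
        (entry (.var 9) (.var 8)).eval s ∧
        (turnExpr (.var 9) (const 0)).eval ((s.setVar 10 x).setVar 11 k) =
        (turnExpr (.var 9) (const 0)).eval s ∧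
        (entry (.var 9) (.var 8)).eval (((s.setVar 10 x).setVar 11 k).setReal 1 k' y) =
        (entry (.var 9) (.var 8)).eval s := by
      intro x k y k'
      simp [eval, RExpr.eval]
    simp only [exec, (e _ _ 0 0).1, (e _ _ 0 0).2.1, (e _ _ _ _).2.2, hentry, hturn]
    simp [eval, hS]
  · have hp₁ := h.of_frame hf₁ ⟨rfl, rfl, rfl, rfl, rfl⟩ ⟨rfl, rfl, rfl, rfl, rfl⟩ rfl
    have hj₁ : s₁.var 9 = j := by rw [hf₁.var 9 rfl, hj]
    have hS₁ : s₁.var 8 = S := by rw [hf₁.var 8 rfl, hS]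
    refine Ends.forTo (fun k s' => s'.var 10 = S / 2 ^ k ∧
      Relaxed d (nbrCost α v nb) (valueTable d s) S j k (valueTable d s' j S)
        (choiceTable d s' j S) (s'.var 11) ∧
      (∀ i ≠ entryIndex d j S, s'.real 1 i = s.real 1 i) ∧
      ∀ i ≠ entryIndex d j S, s'.arr 9 i = s.arr 9 i) hp₁.degree (by decide) rfl rfl ?_ ?_ ?_
    · obtain ⟨h10, h11, hr, ha⟩ := h₁
      refine ⟨by simp [h10], ⟨fun _ => ⟨by simp, ?_, ?_⟩, fun h0 => absurd (by simp [h11]) h0⟩,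
        fun i hi => ?_, fun i hi => ?_⟩
      · simp [choiceTable, ha]
      · simp [valueTable, hr]
      · simp [hr, Function.update_of_ne hi]
      · simp [ha, Function.update_of_ne hi]
    · rintro k hk s₂ hf₂ hk₂ - ⟨h10, hrel, hr, ha⟩
      have hp₂ := hp₁.of_frame hf₂ ⟨rfl, rfl, rfl, rfl, rfl⟩ ⟨rfl, rfl, rfl, rfl, rfl⟩ rfl
      have hj₂ : s₂.var 9 = j := by rw [hf₂.var 9 rfl, hj₁]
      have hS₂ : s₂.var 8 = S := by rw [hf₂.var 8 rfl, hS₁]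
      -- The value read belongs to a smaller set, so it is not the entry being overwritten.
      have hval : S.testBit k = true →
          valueTable d s₂ k (S - 2 ^ k) = valueTable d s k (S - 2 ^ k) := by
        intro hb
        have hlt := testBit_lt_self hb
        refine hr _ fun he => ?_
        have := ((entryIndex_inj (hlt.trans hSd) hSd).1 he).2
        omega
      refine Ends.block rfl le_rfl fun _ => ?_
      rcases relax_exec hp₂ hj₂ hS₂ hk₂ h10 hjd hk with ⟨hb, he⟩ | ⟨hb, hc, he⟩
      · rw [he]
        refine ⟨by simp, ?_, hr, ha⟩
        refine (hrel.skip fun hbit => ?_)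
        have := hb hbit
        rwa [hval hbit] at this
      · rw [hval hb] at hc
        rw [he, hval hb]
        refine ⟨by simp, ?_, fun i hi => ?_, fun i hi => ?_⟩
        · simpa [valueTable, choiceTable] using hrel.update hb hc
        · simpa [Function.update_of_ne hi] using hr i hi
        · simpa [Function.update_of_ne hi] using ha i hi
    · rintro s' - ⟨-, hrel, hr, ha⟩
      refine ⟨hrel.isTable hSd fun k hk S' hS' => hr _ fun he => ?_, hr, ha⟩
      have := ((entryIndex_inj (hS'.trans hSd) hSd).1 he).2
      omega

theorem fillTable_ends {G : SimpleGraph (Fin n)} {α : TurnCost G} {v : Fin n} {d : ℕ}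
    {nb : ℕ → Fin n} {s : State} (h : Prepared G α v d nb s) :
    Ends fillTable s (2 ^ d * (d * (d * 100 + 58) + 14) + 6) fun s' =>
      ∀ S < 2 ^ d, ∀ j < d,
        IsTable d (nbrCost α v nb) (valueTable d s') (choiceTable d s') S j := by
  refine Ends.mono (B := 2 ^ d * ((d * ((d * 100 + 50) + 8) + 6) + 8) + 6) (Ends.forTo
    (fun S₀ s' => ∀ S < S₀, ∀ j < d,
      IsTable d (nbrCost α v nb) (valueTable d s') (choiceTable d s') S j)
    h.sets (by decide) rfl rfl (by simp) ?_ fun _ _ h => h) (by simp [Nat.add_assoc])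
    fun _ _ h => h
  rintro S₀ hS₀ s₁ hf₁ hS₁ - h₁
  have hp₁ := h.of_frame hf₁ ⟨rfl, rfl, rfl, rfl, rfl⟩ ⟨rfl, rfl, rfl, rfl, rfl⟩ rfl
  refine Ends.forTo (fun j₀ s' => (∀ S < S₀, ∀ j < d,
      IsTable d (nbrCost α v nb) (valueTable d s') (choiceTable d s') S j) ∧
      ∀ j < j₀, IsTable d (nbrCost α v nb) (valueTable d s') (choiceTable d s') S₀ j)
    hp₁.degree (by decide) rfl rfl ⟨h₁, by simp⟩ ?_ ?_
  · rintro j₀ hj₀ s₂ hf₂ hj₂ - ⟨h₂, h₃⟩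
    have hp₂ := hp₁.of_frame hf₂ ⟨rfl, rfl, rfl, rfl, rfl⟩ ⟨rfl, rfl, rfl, rfl, rfl⟩ rfl
    refine (fillEntry_ends hp₂ hj₂ (by rw [hf₂.var 8 rfl, hS₁]) hj₀ hS₀).mono le_rfl ?_
    rintro s₃ - ⟨h₄, hr, ha⟩
    have hne : ∀ j S, S ≤ S₀ → ¬ (j = j₀ ∧ S = S₀) → entryIndex d j S ≠ entryIndex d j₀ S₀ :=
      fun j S hS hjS he => hjS ((entryIndex_inj (hS.trans_lt hS₀) hS₀).1 he)
    have hcongr : ∀ j S, S ≤ S₀ → ¬ (j = j₀ ∧ S = S₀) →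
        IsTable d (nbrCost α v nb) (valueTable d s₂) (choiceTable d s₂) S j →
        IsTable d (nbrCost α v nb) (valueTable d s₃) (choiceTable d s₃) S j :=
      fun j S hS hjS ht => ht.congr (hr _ (hne j S hS hjS)) (ha _ (hne j S hS hjS))
        fun k _ S' hS' => hr _ (hne k S' (by omega) (by omega))
    refine ⟨fun S hS j hj => hcongr j S (by omega) (by omega) (h₂ S hS j hj), fun j hj => ?_⟩
    rcases Nat.lt_or_eq_of_le (Nat.lt_succ_iff.1 hj) with hj | rfl
    · exact hcongr j S₀ le_rfl (by omega) (h₃ j hj)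
    · exact h₄
  · rintro s' - ⟨h₂, h₃⟩ S hS j hj
    rcases Nat.lt_or_eq_of_le (Nat.lt_succ_iff.1 hS) with hS | rfl
    · exact h₂ S hS j hj
    · exact h₃ j hj

/-! ### Reading an optimal tour off the table -/

theorem tourPart_exec {G : SimpleGraph (Fin n)} {α : TurnCost G} {v : Fin n} {d : ℕ}
    {nb : ℕ → Fin n} {s : State} (h : Prepared G α v d nb s) {j S k : ℕ} (hj : s.var 9 = j)
    (hS : s.var 8 = S) (hk : choiceTable d s j S = k) (hjd : j < d) (hkd : k < d) :
    (tourPart.exec s).var 9 = k ∧ (tourPart.exec s).var 8 = S - 2 ^ k ∧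
      (tourPart.exec s).arr 3 = Function.update (Function.update (s.arr 3)
        (enc (v, nb j, false)) (enc (v, nb k, true))) (enc (v, nb k, true))
          (enc (v, nb j, false)) := by
  have hk' : s.arr 9 (s.arr 8 j + S) = k := by rw [h.row j hjd]; exact hk
  refine ⟨?_, ?_, ?_⟩
  · simp [tourPart, exec, eval, hj, hS, hk']
  · simp [tourPart, exec, eval, hj, hS, hk', h.power k hkd]
  · simp [tourPart, exec, eval, hj, hS, hk', h.vertex, h.arr_cell v.2, h.nbr k hkd, h.nbr j hjd,
      h.var_two, enc, code]

theorem readTour_ends {G : SimpleGraph (Fin n)} {α : TurnCost G} {v : Fin n} {d : ℕ}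
    {nb : ℕ → Fin n} {s : State} (h : Prepared G α v d nb s)
    (hnb : Set.InjOn nb (Finset.range d)) {t : ℕ → ℕ}
    (hd : 0 < d) (ht : t = fun i => ((tourStep (choiceTable d s))^[i] (0, 2 ^ d - 2)).1)
    (htour : IsTour (Finset.range d) t) :
    Ends readTour s (d * 60 + 20) fun s' =>
      (∀ i < d, s'.arr 3 (enc (v, nb (t i), false)) = enc (v, nb (t (i + 1)), true) ∧
        s'.arr 3 (enc (v, nb (t (i + 1)), true)) = enc (v, nb (t i), false)) ∧
      ∀ x : Fin n × Fin n × Bool, x.1 ≠ v → s'.arr 3 (enc x) = s.arr 3 (enc x) := by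
  have htd : ∀ i < d, t i < d := fun i hi => by simpa using htour.maps i (by simpa using hi)
  have htd' : ∀ i ≤ d, t i < d := fun i hi => by
    rcases Nat.lt_or_eq_of_le hi with hi | rfl
    · exact htd i hi
    · have := htour.closed
      rw [Finset.card_range] at this
      rw [this]
      exact htd 0 hd
  have hinj : ∀ i < d, ∀ j < d, nb (t i) = nb (t j) → i = j := fun i hi j hj hij =>
    htour.inj (by simpa using hi) (by simpa using hj)
      (hnb (by simpa using htd i hi) (by simpa using htd j hj) hij)
  have hinj' : ∀ i < d, ∀ j < d, nb (t (i + 1)) = nb (t (j + 1)) → i = j := by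
    have hcl : t d = t 0 := by simpa using htour.closed
    intro i hi j hj hij
    rcases Nat.lt_or_eq_of_le (Nat.succ_le_of_lt hi) with hi' | hi' <;>
    rcases Nat.lt_or_eq_of_le (Nat.succ_le_of_lt hj) with hj' | hj'
    · have := hinj _ hi' _ hj' hij
      omega
    · rw [show j + 1 = _ from hj', hcl] at hij
      have := hinj _ hi' 0 (by omega) hij
      omega
    · rw [show i + 1 = _ from hi', hcl] at hij
      have := hinj 0 (by omega) _ hj' hij
      omega
    · omega
  refine Ends.mono (B := 6 + (d * (40 + 8) + 6)) (Ends.seq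
    (Q := fun s' => s'.var 8 = 2 ^ d - 2 ∧ s'.var 9 = 0)
    (Ends.block rfl (by decide) fun _ => by simp [exec, eval, h.sets]) fun s₁ hf₁ h₁ => ?_)
    (by omega) fun _ _ h => h
  have hp₁ := h.of_frame hf₁ ⟨rfl, rfl, rfl, rfl, rfl⟩ ⟨rfl, rfl, rfl, rfl, rfl⟩ rfl
  refine Ends.forTo (fun k s' =>
    (s'.var 9, s'.var 8) = (tourStep (choiceTable d s))^[k] (0, 2 ^ d - 2) ∧
    (∀ i < k, s'.arr 3 (enc (v, nb (t i), false)) = enc (v, nb (t (i + 1)), true) ∧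
        s'.arr 3 (enc (v, nb (t (i + 1)), true)) = enc (v, nb (t i), false)) ∧
      ∀ x : Fin n × Fin n × Bool, x.1 ≠ v → s'.arr 3 (enc x) = s.arr 3 (enc x))
    hp₁.degree (by decide) rfl rfl ?_ ?_ fun _ _ h => h.2
  · refine ⟨by simp [h₁], by simp, fun x _ => ?_⟩
    rw [State.setVar_arr, hf₁.arr 3 rfl]
  · rintro k hk s₂ hf₂ - - ⟨hq, h₂, h₃⟩
    have hp₂ := hp₁.of_frame hf₂ ⟨rfl, rfl, rfl, rfl, rfl⟩ ⟨rfl, rfl, rfl, rfl, rfl⟩ rfl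
    have hC : choiceTable d s₂ = choiceTable d s := by
      funext j S
      rw [choiceTable, hf₂.arr 9 rfl, hf₁.arr 9 rfl]
      rfl
    have h9 : s₂.var 9 = t k := by rw [ht]; exact congrArg Prod.fst hq
    have hstep : tourStep (choiceTable d s) (s₂.var 9, s₂.var 8) =
        (tourStep (choiceTable d s))^[k + 1] (0, 2 ^ d - 2) := by
      rw [hq, Function.iterate_succ_apply']
    have hchoice : choiceTable d s₂ (t k) (s₂.var 8) = t (k + 1) := by
      rw [hC, ← h9, ht]
      exact congrArg Prod.fst hstep
    obtain ⟨e9, e8, e3⟩ := tourPart_exec hp₂ h9 rfl hchoice (htd k hk) (htd' (k + 1) hk)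
    refine Ends.block rfl (by decide) fun _ => ?_
    simp only [State.setVar_arr, State.setVar_var, Nat.reduceEqDiff, if_false,
      e9, e8, e3]
    refine ⟨?_, fun i hi => ?_, fun x hx => ?_⟩
    · rw [← hstep, tourStep, ← hC, h9, hchoice]
    · simp only [Function.update_apply, enc_inj, Prod.mk.injEq, Bool.false_eq_true, and_false,
        if_false, true_and, Bool.true_eq_false, and_true]
      rcases Nat.lt_or_eq_of_le (Nat.lt_succ_iff.1 hi) with hi | rfl
      -- Earlier corners are not overwritten: tour positions and their successors are both without
      -- repetition.
      · rw [if_neg fun he => by have := hinj i (by omega) k hk he; omega,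
          if_neg fun he => by have := hinj' i (by omega) k hk he; omega]
        exact h₂ i hi
      · simp
    · rw [Function.update_of_ne, Function.update_of_ne, h₃ x hx]
      · rw [Ne, enc_inj]; rintro rfl; exact hx rfl
      · rw [Ne, enc_inj]; rintro rfl; exact hx rfl

/-- Memory holds the corners of an optimal tour at `v`. -/
def HasTour (G : SimpleGraph (Fin n)) [DecidableRel G.Adj] (α : TurnCost G) (v : Fin n)
    (s : State) : Prop :=
  ∃ t : ℕ → Fin n, IsTour (G.neighborFinset v) t ∧
    (∀ t', IsTour (G.neighborFinset v) t' → t' 0 = t 0 →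
      tourCost (fun a b => (α.cost s(a, v) s(v, b) : ℝ)) (G.neighborFinset v).card t ≤
        tourCost (fun a b => (α.cost s(a, v) s(v, b) : ℝ)) (G.neighborFinset v).card t') ∧
    ∀ i < (G.neighborFinset v).card, s.arr 3 (enc (v, t i, false)) = enc (v, t (i + 1), true) ∧
      s.arr 3 (enc (v, t (i + 1), true)) = enc (v, t i, false)

theorem HasTour.congr {G : SimpleGraph (Fin n)} [DecidableRel G.Adj] {α : TurnCost G} {v : Fin n}
    {s s' : State} (h : HasTour G α v s)
    (hs : ∀ x : Fin n × Fin n × Bool, x.1 = v → s'.arr 3 (enc x) = s.arr 3 (enc x)) :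
    HasTour G α v s' := by
  obtain ⟨t, h1, h2, h3⟩ := h
  refine ⟨t, h1, h2, fun i hi => ?_⟩
  rw [hs _ rfl, hs _ rfl]
  exact h3 i hi

theorem IsTour.comp {ι κ : Type*} {X : Finset ι} {Y : Finset κ} {t : ℕ → ι} (h : IsTour X t)
    {b : ι → κ} (hb : ∀ x ∈ X, b x ∈ Y) (hinj : Set.InjOn b X) (hcard : Y.card = X.card) :
    IsTour Y (b ∘ t) := by
  refine ⟨fun i hi => hb _ (h.maps i (by omega)), ?_, ?_⟩
  · rw [hcard]
    exact hinj.comp h.inj fun i hi => h.maps i (by simpa using hi)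
  · rw [hcard, Function.comp_apply, Function.comp_apply, h.closed]

theorem vertexTour_ends {G : SimpleGraph (Fin n)} [DecidableRel G.Adj] {α : TurnCost G}
    {s : State} (hs : Ready G α s) {v : Fin n} (hv : s.var 3 = v)
    (hd : 0 < (G.neighborFinset v).card) {d : ℕ} (hdeg : d = (G.neighborFinset v).card) :
    Ends vertexTour s ((n * 24 + 8) + ((d * 15 + 8) + ((d * 15 + 8) +
      ((2 ^ d * (d * (d * 100 + 58) + 14) + 6) + (d * 60 + 20))))) fun s' =>
      HasTour G α v s' ∧
        ∀ x : Fin n × Fin n × Bool, x.1 ≠ v → s'.arr 3 (enc x) = s.arr 3 (enc x) := by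
  refine (listNeighbors_ends hs hv).seq fun s₁ hf₁ h₁ => ?_
  rw [← hdeg] at h₁ hd
  obtain ⟨h5, nb, hnb, hnbmem, hnbinj⟩ := h₁
  refine (powers_ends h5).seq fun s₂ hf₂ h₂ => ?_
  refine (multiples_ends (a := 8) (b := 5) (y := 6) ((hf₂.var 5 rfl).trans h5) h₂.1 (by decide)
    (by decide) (by decide) (by decide)).seq fun s₃ hf₃ h₃ => ?_
  have hp : Prepared G α v d nb s₃ := by
    refine ⟨((hs.of_frame hf₁ rfl rfl rfl rfl rfl).of_frame hf₂ rfl rfl rfl rfl rfl).of_frame hf₃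
      rfl rfl rfl rfl rfl, ?_, ?_, ?_, ?_, ?_, h₃⟩
    · rw [hf₃.var 3 rfl, hf₂.var 3 rfl, hf₁.var 3 rfl, hv]
    · rw [hf₃.var 5 rfl, hf₂.var 5 rfl, h5]
    · rw [hf₃.var 6 rfl, h₂.1]
    · rw [hf₃.arr 6 rfl, hf₂.arr 6 rfl]; exact hnb
    · rw [hf₃.arr 7 rfl]; exact h₂.2
  refine (fillTable_ends hp).seq fun s₄ hf₄ h₄ => ?_
  have hp₄ := hp.of_frame hf₄ ⟨rfl, rfl, rfl, rfl, rfl⟩ ⟨rfl, rfl, rfl, rfl, rfl⟩ rfl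
  obtain ⟨htour, hcost⟩ := IsTable.tour hd h₄
  have harr : s₄.arr 3 = s.arr 3 := by
    rw [hf₄.arr 3 rfl, hf₃.arr 3 rfl, hf₂.arr 3 rfl, hf₁.arr 3 rfl]
  refine (readTour_ends hp₄ hnbinj hd rfl htour).mono le_rfl ?_
  rintro s₅ - ⟨h₅, h₆⟩
  refine ⟨⟨_, htour.comp (Y := G.neighborFinset v) (b := nb)
    (fun x hx => hnbmem x (Finset.mem_range.1 hx)) hnbinj (by simp [← hdeg]), ?_, ?_⟩,
    fun x hx => by rw [h₆ x hx, harr]⟩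
  · intro t' ht' h0
    -- The competing tour is pulled back to indices through an inverse of `nb`. It starts at index
    -- `0` because both tours start at `nb 0`, so the lower bound for the table applies.
    have hsurj : ∀ u, ∃ i, u ∈ G.neighborFinset v → i < d ∧ nb i = u := by
      intro u
      by_cases hu : u ∈ G.neighborFinset v
      · have himg : (Finset.range d).image nb = G.neighborFinset v := by
          refine Finset.eq_of_subset_of_card_le (fun y hy => ?_)
            (by rw [Finset.card_image_of_injOn hnbinj, Finset.card_range, hdeg])
          obtain ⟨i, hi, rfl⟩ := Finset.mem_image.1 hy
          exact hnbmem i (Finset.mem_range.1 hi)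
        rw [← himg] at hu
        obtain ⟨i, hi, h⟩ := Finset.mem_image.1 hu
        exact ⟨i, fun _ => ⟨Finset.mem_range.1 hi, h⟩⟩
      · exact ⟨0, fun h => absurd h hu⟩
    choose ix hix using hsurj
    have hix0 : ix (nb 0) = 0 := by
      obtain ⟨h1, h2⟩ := hix (nb 0) (hnbmem 0 hd)
      exact hnbinj (by simpa using h1) (by simpa using hd) h2
    have htour' : IsTour (Finset.range d) (ix ∘ t') := by
      refine ht'.comp (fun x hx => Finset.mem_range.2 (hix x hx).1) (fun x hx y hy hxy => ?_)
        (by simp [hdeg])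
      rw [← (hix x hx).2, ← (hix y hy).2, hxy]
    have hle := IsTable.le_tourCost hd h₄ htour' (by
      rw [Function.comp_apply, h0]
      simpa using hix0)
    rw [← hcost] at hle
    rw [← hdeg]
    refine hle.trans (le_of_eq ?_)
    have hmem : ∀ i ≤ d, t' i ∈ G.neighborFinset v := by
      intro i hi
      rcases Nat.lt_or_eq_of_le hi with hi | rfl
      · exact ht'.maps i (by omega)
      · rw [hdeg, ht'.closed]
        exact ht'.maps 0 (by omega)
    refine Finset.sum_congr rfl fun i hi => ?_
    have hi := Finset.mem_range.1 hi
    simp only [nbrCost, Function.comp_apply, (hix _ (hmem i (by omega))).2,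
      (hix _ (hmem (i + 1) (by omega))).2]
  · rw [← hdeg]
    exact h₅

theorem tours_ends {G : SimpleGraph (Fin n)} [DecidableRel G.Adj] {α : TurnCost G}
    {s : State} (hs : Ready G α s) (hd : ∀ v, 0 < (G.neighborFinset v).card) {Δ : ℕ}
    (hΔ : ∀ v, (G.neighborFinset v).card ≤ Δ) :
    Ends tours s (n * ((n * 24 + 8) + ((Δ * 15 + 8) + ((Δ * 15 + 8) +
      ((2 ^ Δ * (Δ * (Δ * 100 + 58) + 14) + 6) + (Δ * 60 + 20)))) + 8) + 6) fun s' =>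
      ∀ v, HasTour G α v s' := by
  refine Ends.forTo (fun k s' => ∀ v : Fin n, v < k → HasTour G α v s') hs.var_zero (by decide)
    rfl rfl (by simp) ?_ fun _ _ h v => h v v.2
  rintro k hk s₁ hf₁ hk₁ - h₁
  refine (vertexTour_ends (hs.of_frame hf₁ rfl rfl rfl rfl rfl) (v := ⟨k, hk⟩) hk₁ (hd _) rfl).mono
    ?_ ?_
  · have := hΔ ⟨k, hk⟩
    have := Nat.pow_le_pow_right (n := 2) (by norm_num) this
    gcongr
  · rintro s₂ - ⟨h₂, h₃⟩ v hv
    rcases Nat.lt_or_eq_of_le (Nat.lt_succ_iff.1 hv) with hv | hv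
    · refine (h₁ v hv).congr fun x hx => h₃ x ?_
      rw [hx]
      exact fun h => by have := congrArg Fin.val h; simp at this; omega
    · obtain rfl : v = ⟨k, hk⟩ := Fin.ext hv
      exact h₂.congr fun _ _ => rfl

/-! ### Merging the walks -/

section Flip

variable {V : Type*} [Fintype V] [DecidableEq V] {G : SimpleGraph V} [DecidableRel G.Adj]

/-- Exchange the partners of `x` and of the flag on the other side of `x`. -/
def flipAt (g : V × V × Bool → V × V × Bool) (x y : V × V × Bool) : V × V × Bool :=
  if (y = x ∨ y = g x) ∨ (y = otherSide x ∨ y = g (otherSide x)) then otherSide (g y) else g y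

/-- The four flags affected are precisely the flags of one edge, and on them `g` is composed with
`otherSide`. This is again an involution because `g` commutes with `otherSide`; it has no fixed
point because it moves each flag to the other end of its edge. -/
theorem Gluing.flip {g : V × V × Bool → V × V × Bool} (hg : Gluing G g) {x : V × V × Bool}
    (hx : x ∈ flags G) : Gluing G (flipAt g x) := by
  have hz := otherSide_pairsOn.mem x hx
  have hedge : ∀ y ∈ flags G,
      ((y = x ∨ y = g x) ∨ (y = otherSide x ∨ y = g (otherSide x)) ↔ flagEdge y = flagEdge x) := by
    intro y hy
    refine ⟨?_, hg.eq_of_flagEdge_eq hy⟩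
    rintro ((h | h) | (h | h)) <;> rw [h]
    · exact hg.flagEdge_eq hx
    · rfl
    · exact hg.flagEdge_eq hz
  have hval : ∀ y ∈ flags G,
      flipAt g x y = if flagEdge y = flagEdge x then otherSide (g y) else g y := by
    intro y hy
    rw [flipAt]
    exact if_congr (hedge y hy) rfl rfl
  have hos : ∀ y : V × V × Bool, flagEdge (otherSide y) = flagEdge y := fun _ => rfl
  have hoo : ∀ y : V × V × Bool, otherSide (otherSide y) = y := fun y => by simp [otherSide]
  refine ⟨⟨fun y hy => ?_, fun y hy => ?_, fun y hy => ?_⟩, fun y hy => ?_, fun y hy => ?_,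
    fun y hy => ?_⟩
  · rw [hval y hy]
    split_ifs
    · exact otherSide_pairsOn.mem _ (hg.pairs.mem y hy)
    · exact hg.pairs.mem y hy
  · have hgy := hg.pairs.mem y hy
    by_cases h : flagEdge y = flagEdge x
    · rw [hval y hy, if_pos h, hval _ (otherSide_pairsOn.mem _ hgy),
        if_pos (by rw [hos, hg.flagEdge_eq hy, h]), hg.side _ hgy, hoo, hg.pairs.invol y hy]
    · rw [hval y hy, if_neg h, hval _ hgy, if_neg (by rwa [hg.flagEdge_eq hy]),
        hg.pairs.invol y hy]
  · intro h
    have hne := (mem_flags.1 hy).ne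
    have h1 : (flipAt g x y).1 = y.2.1 := by
      rw [hval y hy]
      split_ifs
      · exact hg.head y hy
      · exact hg.head y hy
    rw [h] at h1
    exact hne h1
  · rw [hval y hy]
    split_ifs
    · exact hg.head y hy
    · exact hg.head y hy
  · rw [hval y hy]
    split_ifs
    · exact hg.tail y hy
    · exact hg.tail y hy
  · rw [hval y hy, hval _ (otherSide_pairsOn.mem y hy), hos]
    split_ifs
    · rw [hg.side y hy]
    · rw [hg.side y hy]

end Flip

theorem enc_otherSide {x : Fin n × Fin n × Bool} (h : x.2.2 = false) :
    enc x + n * n = enc (otherSide x) := by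
  simp [enc, otherSide, code, h]
  ring

/-- Memory holds the functions `f` and `g` on flags. -/
structure InMemory (G : SimpleGraph (Fin n)) [DecidableRel G.Adj]
    (f g : Fin n × Fin n × Bool → Fin n × Fin n × Bool) (s : State) : Prop where
  corner : ∀ x ∈ flags G, s.arr 3 (enc x) = enc (f x)
  glue : ∀ x ∈ flags G, s.arr 4 (enc x) = enc (g x)

theorem card_flags_le (G : SimpleGraph (Fin n)) [DecidableRel G.Adj] :
    (flags G).card ≤ n * n + n * n := by
  refine (Finset.card_le_univ _).trans ?_
  simp [Fintype.card_prod]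
  nlinarith

theorem traceStep_exec {s : State} {x y z : ℕ} (h3 : s.var 3 = x) (h2 : s.var 2 = n * n)
    (h4 : s.arr 4 (s.arr 3 (s.var 4)) = y) (hz : s.arr 4 (x + n * n) = z) :
    (traceStep.exec s).var 4 = y ∧
      (traceStep.exec s).var 5 = if y = x + n * n ∨ y = z then 1 else s.var 5 := by
  by_cases h : y = x + n * n ∨ y = z
  · have hc : ¬ (BExpr.and (.not (eqTest (.var 4) (add (.var 3) (.var 2))))
        (.not (eqTest (.var 4) (get 4 (add (.var 3) (.var 2)))))).Holds (walkStep.exec s) := by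
      simp only [BExpr.Holds, exec, eval, State.setVar_var, State.setVar_arr, h4, if_true, h3, h2,
        Nat.reduceEqDiff, if_false, hz]
      omega
    have e : traceStep.exec s = (Program.set 5 (const 1)).exec (walkStep.exec s) := if_neg hc
    rw [e, if_pos h]
    simp [exec, eval, h4]
  · have hc : (BExpr.and (.not (eqTest (.var 4) (add (.var 3) (.var 2))))
        (.not (eqTest (.var 4) (get 4 (add (.var 3) (.var 2)))))).Holds (walkStep.exec s) := by
      simp only [BExpr.Holds, exec, eval, State.setVar_var, State.setVar_arr, h4, if_true, h3, h2,
        Nat.reduceEqDiff, if_false, hz]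
      omega
    have e : traceStep.exec s = walkStep.exec s := if_pos hc
    rw [e, if_neg h]
    simp [exec, eval, h4]

/-- The other side `z` of `x` is in the orbit of `x` if it is on the walk or on the reversed walk.
In the second case `z = f y` with `y` on the walk, whose next point is `g z`; so both `z` and `g z`
are looked for. Testing only after a step loses nothing: `z` differs from the starting flag, and `g
z` is found as a successor. -/
theorem traceWalk_ends {G : SimpleGraph (Fin n)} [DecidableRel G.Adj]
    {f g : Fin n × Fin n × Bool → Fin n × Fin n × Bool} (hf : PairsOn (flags G) f)
    (hg : PairsOn (flags G) g) {s : State} (hs : InMemory G f g s) (h2 : s.var 2 = n * n)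
    (h13 : s.var 13 = n * n + n * n) {x : Fin n × Fin n × Bool} (hx : x ∈ flags G)
    (hside : x.2.2 = false) (h3 : s.var 3 = enc x) :
    Ends traceWalk s (n * n * 100 + 20) fun s' =>
      s'.var 5 ≠ 0 ↔ SameOrbit (flags G) f g x (otherSide x) := by
  refine Ends.mono (B := 6 + ((n * n + n * n) * (40 + 8) + 6)) (Ends.seq
    (Q := fun s' => s'.var 4 = enc x ∧ s'.var 5 = 0)
    (Ends.block rfl (by decide) fun _ => by simp [exec, eval, h3]) fun s₁ hf₁ h₁ => ?_)
    (by omega) fun _ _ h => h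
  have hz := otherSide_pairsOn.mem x hx
  have hmem := iterate_mem hf hg hx
  refine Ends.forTo (fun k s' => s'.var 4 = enc ((g ∘ f)^[k] x) ∧
    (s'.var 5 ≠ 0 ↔ ∃ a < k, (g ∘ f)^[a + 1] x = otherSide x ∨
      (g ∘ f)^[a + 1] x = g (otherSide x)))
    (by rw [hf₁.var 13 rfl, h13]) (by decide) rfl rfl (by simp [h₁]) ?_ ?_
  · rintro k - s₂ hf₂ - - ⟨h₂, h₃⟩
    have hframe : ∀ y ∈ flags G, s₂.arr 4 (enc y) = enc (g y) := by
      rw [hf₂.arr 4 rfl, hf₁.arr 4 rfl]; exact hs.glue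
    have hframe' : ∀ y ∈ flags G, s₂.arr 3 (enc y) = enc (f y) := by
      rw [hf₂.arr 3 rfl, hf₁.arr 3 rfl]; exact hs.corner
    obtain ⟨e4, e5⟩ := traceStep_exec (n := n) (s := s₂) (x := enc x)
      (y := enc ((g ∘ f)^[k + 1] x)) (z := enc (g (otherSide x)))
      (by rw [hf₂.var 3 rfl, hf₁.var 3 rfl, h3]) (by rw [hf₂.var 2 rfl, hf₁.var 2 rfl, h2])
      (by rw [h₂, hframe' _ (hmem k), hframe _ (hf.mem _ (hmem k)),
        iterate_succ_comp (f := f) (g := g)])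
      (by rw [enc_otherSide hside, hframe _ hz])
    refine Ends.block rfl (by decide) fun _ => ?_
    simp only [State.setVar_var, Nat.reduceEqDiff, if_false, e4, e5, true_and]
    simp only [enc_otherSide hside, enc_inj]
    split_ifs with h
    · exact ⟨fun _ => ⟨k, by omega, h⟩, fun _ => one_ne_zero⟩
    · rw [h₃]
      constructor
      · rintro ⟨a, ha, h'⟩
        exact ⟨a, by omega, h'⟩
      · rintro ⟨a, ha, h'⟩
        rcases Nat.lt_or_eq_of_le (Nat.lt_succ_iff.1 ha) with ha | rfl
        · exact ⟨a, ha, h'⟩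
        · exact absurd h' h
  · rintro s' - ⟨-, h⟩
    rw [h]
    constructor
    · rintro ⟨a, -, h | h⟩
      · rw [← h]; exact iterate_sameOrbit hf hg hx _
      · have h' := iterate_sameOrbit hf hg hx (a + 1)
        rw [h] at h'
        exact h'.trans _ _ _ (SameOrbit.right hz).symm
    · intro h
      obtain ⟨K, hK, hKcard, hp, -⟩ := exists_period hf hg hx
      have hcard := card_flags_le G
      obtain ⟨k, hk, h | h⟩ := (sameOrbit_iff hf hg hx hK hp).1 h
      · rcases k with _ | k
        · exact absurd h (otherSide_pairsOn.ne x hx)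
        · exact ⟨k, by omega, .inl h.symm⟩
      · exact ⟨k, by omega, .inr (by rw [h, iterate_succ_comp (f := f) (g := g)])⟩

theorem flip_ends {G : SimpleGraph (Fin n)} [DecidableRel G.Adj]
    {f g : Fin n × Fin n × Bool → Fin n × Fin n × Bool} (hg : Gluing G g) {s : State}
    (hs : InMemory G f g s) (h2 : s.var 2 = n * n) {x : Fin n × Fin n × Bool} (hx : x ∈ flags G)
    (hside : x.2.2 = false) (h3 : s.var 3 = enc x) :
    Ends flip s 40 fun s' => InMemory G f (flipAt g x) s' := by
  have hz := otherSide_pairsOn.mem x hx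
  have hmem := hg.pairs.mem
  have h7 : s.arr 4 (enc x) = enc (g x) := hs.glue x hx
  have h8 : s.arr 4 (enc (otherSide x)) = enc (g (otherSide x)) := hs.glue _ hz
  refine Ends.block rfl (by decide) fun hfr => ⟨?_, fun y hy => ?_⟩
  · rw [hfr.arr 3 rfl]
    exact hs.corner
  · have e : (flip.exec s).arr 4 = Function.update (Function.update (Function.update
        (Function.update (s.arr 4) (enc x) (enc (g (otherSide x)))) (enc (g (otherSide x)))
        (enc x)) (enc (otherSide x)) (enc (g x))) (enc (g x)) (enc (otherSide x)) := by
      simp [flip, exec, eval, h3, h2, h7, h8, enc_otherSide hside]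
    have hoo : otherSide (otherSide x) = x := otherSide_pairsOn.invol x hx
    rw [e]
    simp only [Function.update_apply, enc_inj]
    rw [flipAt]
    -- The cases follow the nested updates from the outermost, that is, the last write.
    by_cases h1 : y = g x
    · subst h1
      rw [if_pos rfl, if_pos (by simp), hg.pairs.invol x hx]
    by_cases h2 : y = otherSide x
    · subst h2
      rw [if_neg h1, if_pos rfl, if_pos (by simp), hg.side x hx, otherSide_pairsOn.invol _ (hmem x hx)]
    by_cases h3 : y = g (otherSide x)
    · subst h3
      rw [if_neg h1, if_neg h2, if_pos rfl, if_pos (by simp), hg.pairs.invol _ hz, hoo]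
    by_cases h4 : y = x
    · subst h4
      rw [if_neg h1, if_neg h2, if_neg h3, if_pos rfl, if_pos (by simp), hg.side y hx]
    · rw [if_neg h1, if_neg h2, if_neg h3, if_neg h4, if_neg (by tauto), hs.glue y hy]

theorem exists_flag {k : ℕ} (hk : k < n * n) :
    ∃ x : Fin n × Fin n × Bool, x.2.2 = false ∧ k = enc x := by
  have hn : 0 < n := by
    rcases Nat.eq_zero_or_pos n with rfl | h
    · simp at hk
    · exact h
  refine ⟨(⟨k / n, Nat.div_lt_of_lt_mul hk⟩, ⟨k % n, Nat.mod_lt _ hn⟩, false), rfl, ?_⟩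
  simp only [enc, code, Bool.false_eq_true, if_false, Nat.zero_add]
  exact (Nat.div_add_mod' k n).symm

theorem enc_lt {x : Fin n × Fin n × Bool} (hx : x.2.2 = false) : enc x < n * n := by
  simp only [enc, code, hx, Bool.false_eq_true, if_false, Nat.zero_add]
  exact row_lt x.1.2 x.2.1.2

theorem Ready.mem_flags {G : SimpleGraph (Fin n)} [DecidableRel G.Adj] {α : TurnCost G} {s : State}
    (hs : Ready G α s) {x : Fin n × Fin n × Bool} (hx : x.2.2 = false) :
    1 ≤ s.arr 0 (enc x) ↔ x ∈ flags G := by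
  rw [Threading.mem_flags, ← hs.adj]
  simp [enc, code, hx]

/-- A single sweep suffices: a flip joins the two sides at the current flag and splits no orbit, so
flags treated before stay joined to their other sides. -/
theorem merge_ends {G : SimpleGraph (Fin n)} [DecidableRel G.Adj] {α : TurnCost G}
    {f : Fin n × Fin n × Bool → Fin n × Fin n × Bool} (hf : PairsOn (flags G) f) {s : State}
    (hs : Ready G α s) (hcorner : ∀ x ∈ flags G, s.arr 3 (enc x) = enc (f x))
    (hglue : ∀ v < n, ∀ u < n, GlueRow n s v u) :
    Ends merge s (n * n * (n * n * 100 + 100) + 20) fun s' => ∃ g, Gluing G g ∧ InMemory G f g s' ∧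
      ∀ x ∈ flags G, SameOrbit (flags G) f g x (otherSide x) := by
  refine Ends.mono (B := 4 + (n * n * ((4 + ((n * n * 100 + 20) + (3 + 40))) + 8) + 6)) (Ends.seq
    (Q := fun s' => s'.var 13 = n * n + n * n)
    (Ends.block rfl (by decide) fun _ => by simp [exec, eval, hs.var_two]) fun s₁ hf₁ h13 => ?_)
    (by nlinarith) fun _ _ h => h
  have hs₁ := hs.of_frame hf₁ rfl rfl rfl rfl rfl
  refine Ends.forTo (fun k s' => ∃ g, Gluing G g ∧ InMemory G f g s' ∧
    ∀ x ∈ flags G, x.2.2 = false → enc x < k → SameOrbit (flags G) f g x (otherSide x))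
    hs₁.var_two (by decide) rfl rfl ?_ ?_ ?_
  -- The initial gluing is parallel at every edge.
  · refine ⟨fun x => (x.2.1, x.1, x.2.2), ⟨⟨fun x hx => ?_, fun _ _ => rfl, fun x hx h => ?_⟩,
      fun _ _ => rfl, fun _ _ => rfl, fun _ _ => rfl⟩, ⟨fun x hx => ?_, fun x hx => ?_⟩, ?_⟩
    · have := mem_flags.1 hx
      exact mem_flags.2 this.symm
    · exact (mem_flags.1 hx).ne (congrArg Prod.fst h).symm
    · rw [State.setVar_arr, hf₁.arr 3 rfl, hcorner x hx]
    · rw [State.setVar_arr, hf₁.arr 4 rfl]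
      exact (hglue x.1 x.1.2 x.2.1 x.2.1.2 x.2.2).1
    · simp
  · rintro k hk s₂ hf₂ hk₂ hn₂ ⟨g, hg, h₂, h₃⟩
    have hs₂ := hs₁.of_frame hf₂ rfl rfl rfl rfl rfl
    obtain ⟨x, hxb, hkx⟩ := exists_flag hk
    have hadj : 1 ≤ s₂.arr 0 k ↔ x ∈ flags G := by rw [hkx, hs₂.mem_flags hxb]
    have hlast : ∀ y : Fin n × Fin n × Bool, enc y < k + 1 → y = x ∨ enc y < k := by
      intro y hy
      rcases Nat.lt_or_eq_of_le (Nat.lt_succ_iff.1 hy) with hy | hy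
      · exact .inr hy
      · exact .inl (enc_inj.1 (hy.trans hkx))
    refine Ends.ite (fun h => ?_) (fun h => ?_)
    · have hxm : x ∈ flags G := by
        rw [← hadj]
        simpa [BExpr.Holds, eval, hk₂] using h
      refine (traceWalk_ends hf hg.pairs h₂ hs₂.var_two (by rw [hf₂.var 13 rfl, h13]) hxm hxb
        (hk₂.trans hkx)).seq fun s₃ hf₃ h5 => ?_
      have hs₃ : InMemory G f g s₃ := by
        refine ⟨?_, ?_⟩
        · rw [hf₃.arr 3 rfl]; exact h₂.corner
        · rw [hf₃.arr 4 rfl]; exact h₂.glue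
      refine Ends.ite (fun h => ?_) (fun h => ?_)
      · have hmet : SameOrbit (flags G) f g x (otherSide x) := by
          rw [← h5]
          simpa [BExpr.Holds, eval, Nat.one_le_iff_ne_zero] using h
        refine Ends.block rfl (by decide) fun _ => ⟨g, hg, ⟨hs₃.1, hs₃.2⟩, fun y hy hb hlt => ?_⟩
        rcases hlast y hlt with rfl | hlt
        · exact hmet
        · exact h₃ y hy hb hlt
      · have hmet : ¬ SameOrbit (flags G) f g x (otherSide x) := by
          rw [← h5]
          simpa [BExpr.Holds, eval, Nat.one_le_iff_ne_zero] using h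
        refine (flip_ends hg hs₃ (by rw [hf₃.var 2 rfl, hs₂.var_two]) hxm hxb
          (by rw [hf₃.var 3 rfl, hk₂, hkx])).mono le_rfl fun s₄ _ h₄ =>
          ⟨flipAt g x, hg.flip hxm, ⟨h₄.1, h₄.2⟩, fun y hy hb hlt => ?_⟩
        have hz := otherSide_pairsOn.mem x hxm
        obtain ⟨h1, h2⟩ := SameOrbit.merge hf hg.pairs (g' := flipAt g x) hxm hz hmet
          (fun y _ h1 h2 h3 h4 => by rw [flipAt, if_neg (by tauto)])
          (by rw [flipAt, if_pos (by simp), hg.side x hxm])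
        rcases hlast y hlt with rfl | hlt
        · exact h1
        · exact h2 _ _ (h₃ y hy hb hlt)
    · have hxm : x ∉ flags G := by
        rw [← hadj]
        simpa [BExpr.Holds, eval, hk₂] using h
      refine Ends.block rfl (by simp [maxSteps]) fun _ => ⟨g, hg, ⟨h₂.1, h₂.2⟩, fun y hy hb hlt => ?_⟩
      rcases hlast y hlt with rfl | hlt
      · exact absurd hy hxm
      · exact h₃ y hy hb hlt
  · rintro s' - ⟨g, hg, h₁, h₂⟩
    refine ⟨g, hg, h₁, fun x hx => ?_⟩
    rcases hb : x.2.2 with _ | _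
    · exact h₂ x hx hb (enc_lt hb)
    · have hb' : (otherSide x).2.2 = false := by simp [otherSide, hb]
      have := h₂ _ (otherSide_pairsOn.mem x hx) hb' (enc_lt hb')
      rw [otherSide_pairsOn.invol x hx] at this
      exact this.symm

/-! ### Output -/

/-- Every edge contributes two ones to the adjacency matrix, so the count is the length of an
exactly-double threading. It is half the number of flags, since each one stands for the two sides of
an edge end. -/
theorem countEdges_ends {G : SimpleGraph (Fin n)} [DecidableRel G.Adj] {α : TurnCost G}
    {s : State} (hs : Ready G α s) :
    Ends countEdges s (n * n * 20 + 10) fun s' => 2 * s'.var 1 = (flags G).card ∧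
      (0 < s'.var 1 → ∃ x ∈ flags G, s'.var 4 = enc x) := by
  refine Ends.mono (B := 4 + (n * n * ((4 + 8) + 8) + 6)) (Ends.seq
    (Q := fun s' => s'.var 1 = 0)
    (Ends.block rfl (by decide) fun _ => by simp [exec, eval]) fun s₁ hf₁ h₁ => ?_)
    (by omega) fun _ _ h => h
  have hs₁ := hs.of_frame hf₁ rfl rfl rfl rfl rfl
  refine Ends.forTo (fun k s' =>
    2 * s'.var 1 = ((flags G).filter fun x => enc (x.1, x.2.1, false) < k).card ∧
      (0 < s'.var 1 → ∃ x ∈ flags G, s'.var 4 = enc x)) hs₁.var_two (by decide) rfl rfl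
    (by simp [h₁]) ?_ ?_
  · rintro k hk s₂ hf₂ hk₂ hn₂ ⟨h₂, h₃⟩
    have hs₂ := hs₁.of_frame hf₂ rfl rfl rfl rfl rfl
    obtain ⟨x, hxb, hkx⟩ := exists_flag hk
    have hadj : 1 ≤ s₂.arr 0 k ↔ x ∈ flags G := by rw [hkx, hs₂.mem_flags hxb]
    have hlast : ∀ y : Fin n × Fin n × Bool, enc (y.1, y.2.1, false) = k ↔
        y = x ∨ y = otherSide x := by
      intro y
      rw [hkx, enc_inj]
      constructor
      · intro h
        exact eq_or_eq_otherSide (by rw [← h]) (by rw [← h])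
      · obtain ⟨v, u, o⟩ := x
        simp only at hxb
        subst hxb
        rintro (rfl | rfl) <;> rfl
    refine Ends.ite (fun h => ?_) (fun h => ?_)
    · have hxm : x ∈ flags G := by
        rw [← hadj]
        simpa [BExpr.Holds, eval, hk₂] using h
      have hz := otherSide_pairsOn.mem x hxm
      refine Ends.block rfl (by decide) fun _ => ?_
      -- Flags are ordered by the code of their `false` side, so one cell adds both sides at once.
      have hset : (flags G).filter (fun x => enc (x.1, x.2.1, false) < k + 1) =
          insert x (insert (otherSide x)
            ((flags G).filter fun x => enc (x.1, x.2.1, false) < k)) := by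
        ext y
        simp only [Finset.mem_filter, Finset.mem_insert, Nat.lt_succ_iff_lt_or_eq, hlast]
        constructor
        · tauto
        · rintro (rfl | rfl | h)
          · exact ⟨hxm, .inr (.inl rfl)⟩
          · exact ⟨hz, .inr (.inr rfl)⟩
          · tauto
      have hnot : ∀ y, y = x ∨ y = otherSide x →
          y ∉ (flags G).filter fun x => enc (x.1, x.2.1, false) < k := by
        intro y hy hmem
        have := (hlast y).2 hy
        have := (Finset.mem_filter.1 hmem).2
        omega
      rw [hset, Finset.card_insert_of_notMem, Finset.card_insert_of_notMem (hnot _ (.inr rfl)),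
        ← h₂]
      · simp only [exec, eval, State.setVar_var, Nat.reduceEqDiff, if_false, if_true, hk₂]
        exact ⟨by omega, fun _ => ⟨x, hxm, by simp [hkx]⟩⟩
      · rw [Finset.mem_insert, not_or]
        exact ⟨fun h => otherSide_pairsOn.ne x hxm h.symm, hnot _ (.inl rfl)⟩
    · have hxm : x ∉ flags G := by
        rw [← hadj]
        simpa [BExpr.Holds, eval, hk₂] using h
      have hset : (flags G).filter (fun x => enc (x.1, x.2.1, false) < k + 1) =
          (flags G).filter fun x => enc (x.1, x.2.1, false) < k := by
        refine Finset.filter_congr fun y hy => ?_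
        rw [Nat.lt_succ_iff_lt_or_eq, hlast]
        refine or_iff_left ?_
        rintro (rfl | rfl)
        · exact hxm hy
        · exact hxm (Threading.mem_flags.2 (Threading.mem_flags.1 hy :))
      refine Ends.block rfl (by decide) fun _ => ?_
      rw [hset, ← h₂]
      exact ⟨by simp [exec], by simpa [exec] using h₃⟩
  · rintro s' - ⟨h₂, h₃⟩
    refine ⟨?_, h₃⟩
    rw [h₂]
    congr 1
    exact Finset.filter_true_of_mem fun x _ => enc_lt rfl

theorem writeWalk_ends {G : SimpleGraph (Fin n)} [DecidableRel G.Adj]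
    {f g : Fin n × Fin n × Bool → Fin n × Fin n × Bool} (hf : PairsOn (flags G) f)
    (hg : PairsOn (flags G) g) {s : State} (hs : InMemory G f g s)
    (hhead : ∀ v < n, ∀ u < n, ∀ o, s.arr 5 (code n v u o) = v) {ℓ : ℕ} (hℓ : s.var 1 = ℓ)
    {x : Fin n × Fin n × Bool} (hx : x ∈ flags G) (h4 : s.var 4 = enc x) :
    Ends writeWalk s (ℓ * 20 + 6) fun s' => s'.var 1 = ℓ ∧
      ∀ k < ℓ, s'.arr 1 k = ((g ∘ f)^[k] x).1 := by
  have hmem := iterate_mem hf hg hx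
  refine Ends.mono (B := ℓ * (12 + 8) + 6) (Ends.forTo (fun k s' =>
    s'.var 4 = enc ((g ∘ f)^[k] x) ∧ ∀ i < k, s'.arr 1 i = ((g ∘ f)^[i] x).1) hℓ (by decide) rfl rfl
    (by simp [h4]) ?_ fun s' _ h => h.2) le_rfl fun s' hf' h => ⟨by rw [hf'.var 1 rfl, hℓ], h⟩
  rintro k - s₁ hf₁ hk - ⟨h₁, h₂⟩
  have h3 : s₁.arr 3 (enc ((g ∘ f)^[k] x)) = enc (f ((g ∘ f)^[k] x)) := by
    rw [hf₁.arr 3 rfl, hs.corner _ (hmem k)]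
  have h4 : s₁.arr 4 (enc (f ((g ∘ f)^[k] x))) = enc ((g ∘ f)^[k + 1] x) := by
    rw [hf₁.arr 4 rfl, hs.glue _ (hf.mem _ (hmem k)), iterate_succ_comp (f := f) (g := g)]
  have h5 : s₁.arr 5 (enc ((g ∘ f)^[k] x)) = ((g ∘ f)^[k] x).1 := by
    rw [hf₁.arr 5 rfl]
    exact hhead _ (Fin.is_lt _) _ (Fin.is_lt _) _
  refine Ends.block rfl (by decide) fun _ => ?_
  simp only [exec, eval, State.setVar_var, State.setVar_arr, State.setArr_arr, State.setArr_var, h₁,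
    hk, Nat.reduceEqDiff, if_false, if_true, h3, h4, h5, true_and]
  intro i hi
  rw [Function.update_apply]
  split_ifs with h
  · rw [h]
  · exact h₂ i (by omega)

/-! ### Main theorem -/

theorem threadingProgram_solves {G : SimpleGraph (Fin n)} [DecidableRel G.Adj] (α : TurnCost G)
    (hG : G.Connected) (hd : ∀ v, 2 ≤ G.degree v) :
    SolvesWithin threadingProgram G α (1000 * (n + 1) ^ 4 * 2 ^ G.maxDegree) := by
  have hd' : ∀ v, 2 ≤ (G.neighborFinset v).card := hd
  have hΔ : G.maxDegree ≤ n := by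
    refine G.maxDegree_le_of_forall_degree_le n fun v => ?_
    simpa using (G.degree_lt_card_verts v).le
  set Δ := G.maxDegree with hΔdef
  have hE : 1 ≤ 2 ^ Δ := Nat.one_le_two_pow
  refine Ends.mono (Q := fun s => ∃ (ℓ : ℕ) (_ : NeZero ℓ) (w : Fin ℓ → Fin n),
    Outputs s w ∧ IsOptimal G α w)
    ((setup_ends G α).seq fun s₁ hf₁ h₁ => (tours_ends h₁.1 (Δ := Δ)
      (fun v => by have := hd' v; omega) (fun v => G.degree_le_maxDegree v)).seq
      (B' := n * n * (n * n * 100 + 100) + 20 + (n * n * 20 + 10 + (n * n * 20 + 6)))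
      fun s₂ hf₂ h₂ => ?_) ?_ fun _ _ h => h
  · choose t ht hopt hcorner using h₂
    obtain ⟨f, hf⟩ := exists_corners ht
    have hf₂corner : ∀ x ∈ flags G, s₂.arr 3 (enc x) = enc (f x) := by
      intro x hx
      obtain ⟨v, i, hi, ⟨rfl, h⟩ | ⟨rfl, h⟩⟩ := hf.cases ht hx
      · rw [h]; exact (hcorner v i hi).1
      · rw [h]; exact (hcorner v i hi).2
    have hs₂ := h₁.1.of_frame hf₂ rfl rfl rfl rfl rfl
    refine (merge_ends hf.pairs hs₂ hf₂corner (fun v hv u hu => ?_)).seq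
      fun s₃ hf₃ ⟨g, hg, hm₃, horb⟩ => ?_
    · rw [GlueRow, hf₂.arr 4 rfl, hf₂.arr 5 rfl]
      exact h₁.2 v hv u hu
    have hs₃ := hs₂.of_frame hf₃ rfl rfl rfl rfl rfl
    refine (countEdges_ends hs₃).seq fun s₄ hf₄ ⟨hℓ, hx⟩ => ?_
    -- A vertex exists and has a neighbor; hence there is a flag to start from and the walk is
    -- nonempty.
    have hpos : 0 < s₄.var 1 := by
      obtain ⟨v⟩ := hG.nonempty
      have hv := hd' v
      have hmem := (ht v).maps 0 (by omega)
      have : (v, t v 0, false) ∈ flags G := mem_flags.2 ((G.mem_neighborFinset v _).1 hmem)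
      have := Finset.card_pos.2 ⟨_, this⟩
      omega
    obtain ⟨x, hxm, h4⟩ := hx hpos
    have hm₄ : InMemory G f g s₄ := by
      refine ⟨?_, ?_⟩
      · rw [hf₄.arr 3 rfl]; exact hm₃.corner
      · rw [hf₄.arr 4 rfl]; exact hm₃.glue
    have hcard := card_flags_le G
    refine (writeWalk_ends hf.pairs hg.pairs hm₄ (fun v hv u hu o => ?_) rfl hxm h4).mono
      (B' := n * n * 20 + 6) (by nlinarith) ?_
    · rw [hf₄.arr 5 rfl, hf₃.arr 5 rfl, hf₂.arr 5 rfl]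
      exact (h₁.2 v hv u hu o).2
    · rintro s₅ - ⟨h₅, h₆⟩
      have : NeZero (s₄.var 1) := ⟨hpos.ne'⟩
      exact ⟨s₄.var 1, this, fun k => ((g ∘ f)^[k] x).1, ⟨h₅, fun k => h₆ k k.2⟩,
        isOptimal_of_corners hG hd' α ht hopt hf hg horb hxm hℓ fun _ => rfl⟩
  · have h1 : Δ * (Δ * 100 + 58) + 14 ≤ n * (n * 100 + 58) + 14 := by gcongr
    -- Only the table size is exponential; the other summands are multiplied by `2 ^ Δ ≥ 1` so that
    -- this factor can be taken out.
    have h2 : n * ((n * 24 + 8) + ((Δ * 15 + 8) + ((Δ * 15 + 8) +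
        ((2 ^ Δ * (Δ * (Δ * 100 + 58) + 14) + 6) + (Δ * 60 + 20)))) + 8) + 6 ≤
        2 ^ Δ * (n * ((n * 24 + 8) + ((n * 15 + 8) + ((n * 15 + 8) +
        (((n * (n * 100 + 58) + 14) + 6) + (n * 60 + 20)))) + 8) + 6) := by
      calc _ ≤ n * ((n * 24 + 8) + ((n * 15 + 8) + ((n * 15 + 8) +
          ((2 ^ Δ * (n * (n * 100 + 58) + 14) + 6) + (n * 60 + 20)))) + 8) + 6 := by gcongr
        _ ≤ n * (2 ^ Δ * (n * 24 + 8) + (2 ^ Δ * (n * 15 + 8) + (2 ^ Δ * (n * 15 + 8) +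
          ((2 ^ Δ * (n * (n * 100 + 58) + 14) + 2 ^ Δ * 6) + 2 ^ Δ * (n * 60 + 20)))) +
          2 ^ Δ * 8) + 2 ^ Δ * 6 := by
            gcongr <;> exact Nat.le_mul_of_pos_left _ hE
        _ = _ := by ring
    have h3 : ∀ a, a ≤ 2 ^ Δ * a := fun a => Nat.le_mul_of_pos_left _ hE
    -- The degree 4 comes from the merging: `n * n` cells with a trace of `2 * n * n` steps each.
    have h4 : 63 * n * n + 26 * n + 22 + (n * ((n * 24 + 8) + ((n * 15 + 8) + ((n * 15 + 8) +
        (((n * (n * 100 + 58) + 14) + 6) + (n * 60 + 20)))) + 8) + 6 +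
        (n * n * (n * n * 100 + 100) + 20 + (n * n * 20 + 10 + (n * n * 20 + 6)))) ≤
        1000 * (n + 1) ^ 4 := by
      ring_nf
      nlinarith [Nat.zero_le (n ^ 4), Nat.zero_le (n ^ 3), Nat.zero_le (n ^ 2), Nat.zero_le n]
    refine (Nat.add_le_add (h3 _) (Nat.add_le_add h2 (h3 _))).trans ?_
    rw [← Nat.mul_add, ← Nat.mul_add, Nat.mul_comm]
    exact Nat.mul_le_mul_right _ h4

/-- For large `n`, `2 ^ Δ ≤ exp Δ ≤ exp (⌈C⌉ * log n) = n ^ ⌈C⌉`. For the finitely many other `n`,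
the bound `Δ ≤ n` gives a constant, which is added. -/
theorem exists_pow_bound {δ : ℕ → ℝ} (hδ : δ =O[Filter.atTop] fun n : ℕ => Real.log (n : ℝ)) :
    ∃ c N : ℕ, ∀ n Δ : ℕ, Δ ≤ n → (Δ : ℝ) ≤ δ n → 2 ^ Δ ≤ n ^ c + 2 ^ N := by
  obtain ⟨C, hC, hb⟩ := hδ.exists_pos
  rw [Asymptotics.isBigOWith_iff, Filter.eventually_atTop] at hb
  obtain ⟨N, hN⟩ := hb
  -- The threshold `N + 1` instead of `N` ensures `1 ≤ n`, so that the logarithm is nonnegative.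
  refine ⟨⌈C⌉₊, N + 1, fun n Δ hΔ hle => ?_⟩
  rcases lt_or_ge n (N + 1) with h | h
  · exact (Nat.pow_le_pow_right (by norm_num) (hΔ.trans h.le)).trans (Nat.le_add_left _ _)
  · refine le_trans ?_ (Nat.le_add_right _ _)
    have hn : (1 : ℝ) ≤ n := by exact_mod_cast (by omega : 1 ≤ n)
    have hlog : 0 ≤ Real.log n := Real.log_nonneg hn
    have h1 : (Δ : ℝ) ≤ ⌈C⌉₊ * Real.log n := by
      have h2 := hN n (by omega)
      rw [Real.norm_eq_abs, Real.norm_eq_abs, abs_of_nonneg hlog] at h2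
      have h3 := mul_le_mul_of_nonneg_right (Nat.le_ceil C) hlog
      linarith [le_abs_self (δ n)]
    have h4 : ((2 ^ Δ : ℕ) : ℝ) ≤ ((n ^ ⌈C⌉₊ : ℕ) : ℝ) := by
      push_cast
      calc (2 : ℝ) ^ Δ ≤ Real.exp 1 ^ Δ := by
            gcongr
            linarith [Real.add_one_le_exp 1]
        _ = Real.exp Δ := by rw [← Real.exp_nat_mul, mul_one]
        _ ≤ Real.exp (⌈C⌉₊ * Real.log n) := Real.exp_le_exp.2 h1
        _ = (n : ℝ) ^ ⌈C⌉₊ := by rw [Real.exp_nat_mul, Real.exp_log (by linarith)]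
    exact_mod_cast h4

theorem SolvesWithin.mono {P : Program} {G : SimpleGraph (Fin n)} {α : TurnCost G} {B B' : ℕ}
    (h : SolvesWithin P G α B) (hB : B ≤ B') : SolvesWithin P G α B' := by
  obtain ⟨t, ht, h⟩ := h
  exact ⟨t, ht.trans hB, h⟩

end Threading

theorem mainTheorem10 :
    ∃ P : Threading.Program,
      (∃ p : Polynomial ℕ,
        ∀ (n : ℕ) (G : SimpleGraph (Fin n)) [DecidableRel G.Adj] (α : Threading.TurnCost G),
          G.Connected → (∀ v, 2 ≤ G.degree v) →
            Threading.SolvesWithin P G α (p.eval n * 2 ^ G.maxDegree)) ∧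
      (∀ δ : ℕ → ℝ, δ =O[Filter.atTop] (fun n : ℕ => Real.log (n : ℝ)) →
        ∃ q : Polynomial ℕ,
          ∀ (n : ℕ) (G : SimpleGraph (Fin n)) [DecidableRel G.Adj] (α : Threading.TurnCost G),
            G.Connected → (∀ v, 2 ≤ G.degree v) → (G.maxDegree : ℝ) ≤ δ n →
              Threading.SolvesWithin P G α (q.eval n)) := by
  refine ⟨Threading.threadingProgram, ⟨1000 * (Polynomial.X + 1) ^ 4, ?_⟩, fun δ hδ => ?_⟩
  · intro n G _ α hG hd
    refine (Threading.threadingProgram_solves α hG hd).mono (le_of_eq ?_)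
    simp
  · obtain ⟨c, N, hcN⟩ := Threading.exists_pow_bound hδ
    refine ⟨1000 * (Polynomial.X + 1) ^ 4 * (Polynomial.X ^ c + Polynomial.C (2 ^ N)), ?_⟩
    intro n G _ α hG hd hΔ
    refine (Threading.threadingProgram_solves α hG hd).mono ?_
    have hn : G.maxDegree ≤ n := by
      refine G.maxDegree_le_of_forall_degree_le n fun v => ?_
      simpa using (G.degree_lt_card_verts v).le
    have := Nat.mul_le_mul_left (1000 * (n + 1) ^ 4) (hcN n _ hn hΔ)
    simpa using this
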